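/- Let $0<\gamma\le\infty$ and let $\psi:[0,\gamma)\to[0,\infty)$ be a non-zero, increasing (i.e. non-decreasing), concave function that is continuous on $(0,\gamma)$ and satisfies $\psi(0)=0$. Let $L_0(0,\gamma)$ be the space of (a.e.-equivalence classes of) Lebesgue measurable functions $f:(0,\gamma)\to\mathbb{R}$; for $f\in L_0(0,\gamma)$ let $f^*(t)=\inf\{s\ge 0: m(\{x\in(0,\gamma):|f(x)|>s\})\le t\}$, $t\geq 0$, be its decreasing rearrangement, where $m$ is Lebesgue measure and $\inf\emptyset=\infty$. Let $M_\psi(0,\gamma)$ be the real Marcinkiewicz space of all $f\in L_0(0,\gamma)$ with $$\|f\|_{M_\psi}=\sup_{0<t<\gamma}\frac{1}{\psi(t)}\int_0^t f^*(s)\,ds<\infty,$$ equipped with the norm $\|\cdot\|_{M_\psi}$. Then $M_\psi(0,\gamma)$ is a Grothendieck space (that is, a Banach space such that every weak-$*$ convergent sequence in its dual is weakly convergent) if and only if one of the following two conditions holds: (A) $\gamma=\infty$, $\displaystyle\liminf_{t\downarrow 0}\frac{\psi(2t)}{\psi(t)}>1$ and $\displaystyle\liminf_{t\to\infty}\frac{\psi(2t)}{\psi(t)}>1$;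 (B) $\gamma<\infty$ and $\displaystyle\liminf_{t\downarrow 0}\frac{\psi(2t)}{\psi(t)}>1$. -/

import Mathlib

open MeasureTheory Set Filter Topology
open scoped ENNReal

noncomputable section

/-! ### Distribution function and decreasing rearrangement -/

/-- The distribution function `d_{|f|}(s) = μ {x : |f x| > s}` of `|f|`. -/
def distribFun {α : Type*} [MeasurableSpace α] (μ : Measure α) (f : α → ℝ) (s : ℝ) : ℝ≥0∞ :=
  μ {x | s < |f x|}

/-- The decreasing rearrangement `f* (t) = inf {s ≥ 0 : d_{|f|}(s) ≤ t}`, with values in `[0, ∞]`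
(the infimum of the empty set is `∞`). -/
def rearrangement {α : Type*} [MeasurableSpace α] (μ : Measure α) (f : α → ℝ) (t : ℝ) : ℝ≥0∞ :=
  ⨅ (s : ℝ) (_ : 0 ≤ s ∧ distribFun μ f s ≤ ENNReal.ofReal t), ENNReal.ofReal s

section Rearrangement

variable {α : Type*} [MeasurableSpace α] {μ : Measure α}

theorem distribFun_congr {f g : α → ℝ} (h : f =ᵐ[μ] g) : distribFun μ f = distribFun μ g := by
  funext s
  refine measure_congr ?_
  filter_upwards [h] with x hx
  have : (s < |f x|) = (s < |g x|) := by rw [hx]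
  exact this

theorem rearrangement_congr {f g : α → ℝ} (h : f =ᵐ[μ] g) :
    rearrangement μ f = rearrangement μ g := by
  funext t
  simp only [rearrangement, distribFun_congr h]

theorem distribFun_antitone (f : α → ℝ) : Antitone (distribFun μ f) := fun _ _ hab =>
  measure_mono fun _ hx => lt_of_le_of_lt hab hx

theorem rearrangement_antitone (f : α → ℝ) : Antitone (rearrangement μ f) := fun _ _ hab =>
  le_iInf₂ fun s hs => iInf₂_le s ⟨hs.1, hs.2.trans (ENNReal.ofReal_le_ofReal hab)⟩

theorem exists_gt_lt_distribFun {f : α → ℝ} {s : ℝ} {c : ℝ≥0∞} (h : c < distribFun μ f s) :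
    ∃ s' > s, c < distribFun μ f s' := by
  have hU : {x | s < |f x|} = ⋃ n : ℕ, {x | s + 1 / ((n : ℝ) + 1) < |f x|} := by
    ext x
    simp only [mem_ofPred_eq, mem_iUnion]
    constructor
    · intro hx
      obtain ⟨n, hn⟩ := exists_nat_one_div_lt (sub_pos.2 hx)
      exact ⟨n, by linarith⟩
    · rintro ⟨n, hn⟩
      have : (0 : ℝ) < 1 / ((n : ℝ) + 1) := Nat.one_div_pos_of_nat
      linarith
  have hm : Monotone fun n : ℕ => {x | s + 1 / ((n : ℝ) + 1) < |f x|} := by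
    intro a b hab x hx
    have : 1 / ((b : ℝ) + 1) ≤ 1 / ((a : ℝ) + 1) := Nat.one_div_le_one_div hab
    simp only [mem_ofPred_eq] at hx ⊢
    linarith
  rw [distribFun, hU, hm.measure_iUnion, lt_iSup_iff] at h
  obtain ⟨n, hn⟩ := h
  exact ⟨_, lt_add_of_pos_right s Nat.one_div_pos_of_nat, hn⟩

theorem lt_rearrangement_iff {f : α → ℝ} {s t : ℝ} (hs : 0 ≤ s) :
    ENNReal.ofReal s < rearrangement μ f t ↔ ENNReal.ofReal t < distribFun μ f s := by
  constructor
  · intro h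
    by_contra! hc
    exact absurd h (not_lt.2 (iInf₂_le s ⟨hs, hc⟩))
  · intro h
    obtain ⟨s', hs', h'⟩ := exists_gt_lt_distribFun h
    refine lt_of_lt_of_le ((ENNReal.ofReal_lt_ofReal_iff (hs.trans_lt hs')).2 hs') ?_
    refine le_iInf₂ fun r hr => ENNReal.ofReal_le_ofReal ?_
    by_contra! hrs
    exact absurd (h'.trans_le (distribFun_antitone f hrs.le)) (not_lt.2 hr.2)

theorem volume_ofReal_lt (a : ℝ≥0∞) :
    volume ({s : ℝ | ENNReal.ofReal s < a} ∩ Ioi 0) = a := by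
  induction a with
  | top =>
    have : {s : ℝ | ENNReal.ofReal s < ∞} ∩ Ioi 0 = Ioi 0 := by
      ext s; simp
    rw [this, Real.volume_Ioi]
  | coe a =>
    have : {s : ℝ | ENNReal.ofReal s < a} ∩ Ioi 0 = Ioo 0 (a : ℝ) := by
      ext s
      simp only [mem_inter_iff, mem_ofPred_eq, mem_Ioi, mem_Ioo]
      rw [← ENNReal.ofReal_coe_nnreal]
      constructor
      · rintro ⟨h, h0⟩
        exact ⟨h0, (ENNReal.ofReal_lt_ofReal_iff_of_nonneg h0.le).1 h⟩
      · rintro ⟨h0, h⟩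
        exact ⟨(ENNReal.ofReal_lt_ofReal_iff_of_nonneg h0.le).2 h, h0⟩
    rw [this, Real.volume_Ioo, sub_zero, ENNReal.ofReal_coe_nnreal]

theorem volume_ofReal_lt_min (a : ℝ≥0∞) (t : ℝ) :
    volume ({u : ℝ | ENNReal.ofReal u < a} ∩ Ioo 0 t) = min (ENNReal.ofReal t) a := by
  rw [← volume_ofReal_lt (min (ENNReal.ofReal t) a)]
  congr 1
  ext u
  simp only [mem_inter_iff, mem_ofPred_eq, mem_Ioo, mem_Ioi, lt_min_iff]
  constructor
  · rintro ⟨h1, h2, h3⟩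
    exact ⟨⟨(ENNReal.ofReal_lt_ofReal_iff_of_nonneg h2.le).2 h3, h1⟩, h2⟩
  · rintro ⟨⟨h1, h2⟩, h3⟩
    exact ⟨h2, h3, (ENNReal.ofReal_lt_ofReal_iff_of_nonneg (le_of_lt h3)).1 h1⟩

theorem lintegral_rearrangement (f : α → ℝ) (t : ℝ) :
    ∫⁻ u in Ioo 0 t, rearrangement μ f u
      = ∫⁻ s in Ioi 0, min (ENNReal.ofReal t) (distribFun μ f s) := by
  have hmeas : Measurable (rearrangement μ f) := (rearrangement_antitone f).measurable
  have hset : MeasurableSet {p : ℝ × ℝ | ENNReal.ofReal p.2 < rearrangement μ f p.1} :=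
    measurableSet_lt (ENNReal.measurable_ofReal.comp measurable_snd) (hmeas.comp measurable_fst)
  have h1 : ∀ u, rearrangement μ f u = ∫⁻ s in Ioi (0 : ℝ),
      ({p : ℝ × ℝ | ENNReal.ofReal p.2 < rearrangement μ f p.1}.indicator 1 (u, s) : ℝ≥0∞) := by
    intro u
    have hm : MeasurableSet {s : ℝ | ENNReal.ofReal s < rearrangement μ f u} :=
      measurableSet_lt ENNReal.measurable_ofReal measurable_const
    have : (fun s => ({p : ℝ × ℝ | ENNReal.ofReal p.2 < rearrangement μ f p.1}.indicator 1 (u, s)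
        : ℝ≥0∞)) = {s : ℝ | ENNReal.ofReal s < rearrangement μ f u}.indicator 1 := by
      funext s; simp [indicator]
    rw [this, lintegral_indicator_one hm, Measure.restrict_apply hm, volume_ofReal_lt]
  calc ∫⁻ u in Ioo 0 t, rearrangement μ f u
      = ∫⁻ u in Ioo 0 t, ∫⁻ s in Ioi (0 : ℝ),
        ({p : ℝ × ℝ | ENNReal.ofReal p.2 < rearrangement μ f p.1}.indicator 1 (u, s) : ℝ≥0∞) :=
        lintegral_congr h1
    _ = ∫⁻ s in Ioi (0 : ℝ), ∫⁻ u in Ioo 0 t,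
        ({p : ℝ × ℝ | ENNReal.ofReal p.2 < rearrangement μ f p.1}.indicator 1 (u, s) : ℝ≥0∞) :=
        lintegral_lintegral_swap (measurable_one.indicator hset).aemeasurable
    _ = _ := by
        refine setLIntegral_congr_fun measurableSet_Ioi fun s hs => ?_
        have hm : MeasurableSet {u : ℝ | ENNReal.ofReal u < distribFun μ f s} :=
          measurableSet_lt ENNReal.measurable_ofReal measurable_const
        have : (fun u => ({p : ℝ × ℝ | ENNReal.ofReal p.2 < rearrangement μ f p.1}.indicator 1 (u, s)
            : ℝ≥0∞)) = {u : ℝ | ENNReal.ofReal u < distribFun μ f s}.indicator 1 := by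
          funext u; simp [indicator, lt_rearrangement_iff (le_of_lt hs)]
        simp only [this]
        rw [lintegral_indicator_one hm, Measure.restrict_apply hm, volume_ofReal_lt_min]

theorem lintegral_sub_eq {f : α → ℝ} (hf : AEMeasurable f μ) (s : ℝ) :
    ∫⁻ x, ENNReal.ofReal (|f x| - s) ∂μ = ∫⁻ u in Ioi s, distribFun μ f u := by
  have h1 : ∫⁻ x, ENNReal.ofReal (|f x| - s) ∂μ
      = ∫⁻ x, ENNReal.ofReal (max (|f x| - s) 0) ∂μ :=
    lintegral_congr fun x => by rw [ENNReal.ofReal_max]; simp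
  rw [h1, lintegral_eq_lintegral_meas_lt (f := fun x => max (|f x| - s) 0) μ
    (Eventually.of_forall fun x => le_max_right _ _)
    ((hf.abs.sub_const s).max aemeasurable_const)]
  have h2 : ∫⁻ u in Ioi 0, μ {a | u < max (|f a| - s) 0}
      = ∫⁻ u in Ioi 0, distribFun μ f (s + u) := by
    refine setLIntegral_congr_fun measurableSet_Ioi fun u hu => ?_
    have hu' : (0 : ℝ) < u := hu
    simp only [distribFun]
    congr 1
    ext a
    simp only [mem_ofPred_eq, lt_max_iff, not_lt.2 hu'.le, or_false]
    constructor <;> intro h <;> linarith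
  rw [h2, ← lintegral_indicator measurableSet_Ioi, ← lintegral_indicator measurableSet_Ioi,
    ← lintegral_add_left_eq_self ((Ioi s).indicator (distribFun μ f)) s]
  refine lintegral_congr fun u => ?_
  simp [indicator]

theorem lintegral_rearrangement_le {f : α → ℝ} (hf : AEMeasurable f μ) (t : ℝ) {s : ℝ}
    (hs : 0 ≤ s) :
    ∫⁻ u in Ioo 0 t, rearrangement μ f u
      ≤ ENNReal.ofReal t * ENNReal.ofReal s + ∫⁻ x, ENNReal.ofReal (|f x| - s) ∂μ := by
  rw [lintegral_rearrangement, lintegral_sub_eq hf s, ← Ioc_union_Ioi_eq_Ioi hs,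
    lintegral_union measurableSet_Ioi (Ioc_disjoint_Ioi le_rfl)]
  gcongr
  · refine (lintegral_mono fun u => min_le_left _ _).trans ?_
    simp
  · exact min_le_right _ _

theorem lintegral_rearrangement_eq {f : α → ℝ} (hf : AEMeasurable f μ) (t : ℝ)
    (ht : rearrangement μ f t ≠ ∞) :
    ∫⁻ u in Ioo 0 t, rearrangement μ f u
      = ENNReal.ofReal t * rearrangement μ f t
        + ∫⁻ x, ENNReal.ofReal (|f x| - (rearrangement μ f t).toReal) ∂μ := by
  set s := (rearrangement μ f t).toReal with hsdef
  have hs : 0 ≤ s := ENNReal.toReal_nonneg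
  have hs' : ENNReal.ofReal s = rearrangement μ f t := ENNReal.ofReal_toReal ht
  rw [lintegral_rearrangement, lintegral_sub_eq hf s, ← Ioc_union_Ioi_eq_Ioi hs,
    lintegral_union measurableSet_Ioi (Ioc_disjoint_Ioi le_rfl)]
  congr 1
  · rw [setLIntegral_congr Ioo_ae_eq_Ioc.symm,
      setLIntegral_congr_fun (g := fun _ => ENNReal.ofReal t) measurableSet_Ioo]
    · simp [hs']
    · intro u hu
      refine min_eq_left (le_of_lt ((lt_rearrangement_iff hu.1.le).1 ?_))
      rw [← hs']
      exact (ENNReal.ofReal_lt_ofReal_iff_of_nonneg hu.1.le).2 hu.2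
  · refine setLIntegral_congr_fun measurableSet_Ioi fun u hu => min_eq_right ?_
    have hu' : s < u := hu
    by_contra! hc
    have := (lt_rearrangement_iff (hs.trans hu'.le)).2 hc
    rw [← hs', ENNReal.ofReal_lt_ofReal_iff_of_nonneg (hs.trans hu'.le)] at this
    linarith

theorem lintegral_rearrangement_eq_top {f : α → ℝ} {t : ℝ} (ht : 0 < t)
    (h : rearrangement μ f t = ∞) : ∫⁻ u in Ioo 0 t, rearrangement μ f u = ∞ := by
  refine top_le_iff.1 (le_trans ?_ (setLIntegral_mono' (f := fun _ => ∞) measurableSet_Ioo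
    fun u hu => h ▸ rearrangement_antitone f hu.2.le))
  simp [ht]

/-- Subadditivity of `f ↦ ∫₀ᵗ f*(s) ds`. -/
theorem lintegral_rearrangement_add_le {f g : α → ℝ} (hf : AEMeasurable f μ)
    (hg : AEMeasurable g μ) {t : ℝ} (ht : 0 < t) :
    ∫⁻ u in Ioo 0 t, rearrangement μ (f + g) u
      ≤ (∫⁻ u in Ioo 0 t, rearrangement μ f u) + ∫⁻ u in Ioo 0 t, rearrangement μ g u := by
  by_cases h1 : rearrangement μ f t = ∞
  · simp [lintegral_rearrangement_eq_top ht h1]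
  by_cases h2 : rearrangement μ g t = ∞
  · simp [lintegral_rearrangement_eq_top ht h2]
  rw [lintegral_rearrangement_eq hf t h1, lintegral_rearrangement_eq hg t h2]
  set a := (rearrangement μ f t).toReal
  set b := (rearrangement μ g t).toReal
  have ha : 0 ≤ a := ENNReal.toReal_nonneg
  have hb : 0 ≤ b := ENNReal.toReal_nonneg
  refine (lintegral_rearrangement_le (hf.add hg) t (add_nonneg ha hb)).trans ?_
  rw [← ENNReal.ofReal_toReal h1, ← ENNReal.ofReal_toReal h2, add_add_add_comm, ← mul_add,
    ← ENNReal.ofReal_add ha hb,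
    ← lintegral_add_left' (hf.abs.sub_const a).ennreal_ofReal]
  gcongr with x
  refine le_trans (ENNReal.ofReal_le_ofReal ?_) ENNReal.ofReal_add_le
  have := abs_add_le (f x) (g x)
  simp only [Pi.add_apply]
  linarith

theorem rearrangement_zero (t : ℝ) : rearrangement μ (0 : α → ℝ) t = 0 := by
  refine nonpos_iff_eq_zero.1 ((iInf₂_le 0 ⟨le_rfl, ?_⟩).trans (by simp))
  simp [distribFun]

theorem rearrangement_smul_le (c : ℝ) (f : α → ℝ) (t : ℝ) :
    rearrangement μ (c • f) t ≤ ENNReal.ofReal |c| * rearrangement μ f t := by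
  rcases eq_or_ne c 0 with rfl | hc
  · simp [rearrangement_zero]
  have hc' : 0 < |c| := abs_pos.2 hc
  have h0 : ENNReal.ofReal |c| ≠ 0 := by simpa using hc
  rw [rearrangement, rearrangement, ENNReal.mul_iInf_of_ne h0 ENNReal.ofReal_ne_top]
  refine le_iInf fun s => ?_
  rw [ENNReal.mul_iInf_of_ne h0 ENNReal.ofReal_ne_top]
  refine le_iInf fun hs => ?_
  rw [← ENNReal.ofReal_mul hc'.le]
  refine iInf₂_le _ ⟨mul_nonneg hc'.le hs.1, ?_⟩
  refine le_trans (le_of_eq ?_) hs.2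
  simp only [distribFun]
  congr 1
  ext x
  simp [abs_mul, mul_lt_mul_iff_right₀ hc']

theorem rearrangement_smul (c : ℝ) (f : α → ℝ) (t : ℝ) :
    rearrangement μ (c • f) t = ENNReal.ofReal |c| * rearrangement μ f t := by
  refine le_antisymm (rearrangement_smul_le c f t) ?_
  rcases eq_or_ne c 0 with rfl | hc
  · simp
  have h := rearrangement_smul_le (μ := μ) c⁻¹ (c • f) t
  rw [smul_smul, inv_mul_cancel₀ hc, one_smul] at h
  calc ENNReal.ofReal |c| * rearrangement μ f t
      ≤ ENNReal.ofReal |c| * (ENNReal.ofReal |c⁻¹| * rearrangement μ (c • f) t) := by gcongr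
    _ = rearrangement μ (c • f) t := by
      rw [← mul_assoc, ← ENNReal.ofReal_mul (abs_nonneg c), ← abs_mul, mul_inv_cancel₀ hc]
      simp

theorem ae_eq_zero_of_lintegral_rearrangement {f : α → ℝ} {t : ℝ} (ht : 0 < t)
    (h : ∫⁻ u in Ioo 0 t, rearrangement μ f u = 0) : f =ᵐ[μ] 0 := by
  have h0 : distribFun μ f 0 = 0 := by
    by_contra hc
    obtain ⟨s, hs, hs'⟩ := exists_gt_lt_distribFun (pos_iff_ne_zero.2 hc)
    rw [lintegral_rearrangement] at h
    have hpos : 0 < min (ENNReal.ofReal t) (distribFun μ f s) :=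
      lt_min (ENNReal.ofReal_pos.2 ht) hs'
    have hle : min (ENNReal.ofReal t) (distribFun μ f s) * ENNReal.ofReal s ≤ 0 := by
      rw [← h]
      calc min (ENNReal.ofReal t) (distribFun μ f s) * ENNReal.ofReal s
          = ∫⁻ _ in Ioo 0 s, min (ENNReal.ofReal t) (distribFun μ f s) := by simp
        _ ≤ ∫⁻ u in Ioo 0 s, min (ENNReal.ofReal t) (distribFun μ f u) :=
          setLIntegral_mono' measurableSet_Ioo fun u hu =>
            min_le_min le_rfl (distribFun_antitone f hu.2.le)
        _ ≤ _ := lintegral_mono_set Ioo_subset_Ioi_self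
    exact absurd (ENNReal.mul_pos hpos.ne' (ENNReal.ofReal_pos.2 hs).ne') (not_lt.2 hle)
  rw [Filter.EventuallyEq, ae_iff]
  simpa [distribFun] using h0

end Rearrangement

/-! ### Marcinkiewicz spaces on `(0, γ)` -/

/-- The interval `[0, γ)` of the real line, for `γ ∈ [0, ∞]`. -/
def intervalIco (γ : ℝ≥0∞) : Set ℝ := {t | 0 ≤ t ∧ ENNReal.ofReal t < γ}

/-- The interval `(0, γ)` of the real line, for `γ ∈ [0, ∞]`. -/
def intervalIoo (γ : ℝ≥0∞) : Set ℝ := {t | 0 < t ∧ ENNReal.ofReal t < γ}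

/-- `L₀(0, γ)`: classes modulo a.e. equality of measurable real functions on `(0, γ)`, with
respect to Lebesgue measure. -/
abbrev LZero (γ : ℝ≥0∞) : Type := ℝ →ₘ[volume.restrict (intervalIoo γ)] ℝ

/-- `‖f‖ = sup_{0 < t < γ} (1 / ψ t) ∫₀ᵗ f*(s) ds`, as an element of `[0, ∞]`. -/
def marcinkiewiczENorm (ψ : ℝ → ℝ) (γ : ℝ≥0∞) (f : LZero γ) : ℝ≥0∞ :=
  ⨆ t ∈ intervalIoo γ,
    (∫⁻ s in Ioo 0 t, rearrangement (volume.restrict (intervalIoo γ)) f s) / ENNReal.ofReal (ψ t)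

theorem marcinkiewiczENorm_add_le (ψ : ℝ → ℝ) (γ : ℝ≥0∞) (f g : LZero γ) :
    marcinkiewiczENorm ψ γ (f + g) ≤ marcinkiewiczENorm ψ γ f + marcinkiewiczENorm ψ γ g := by
  refine iSup₂_le fun t ht => ?_
  rw [rearrangement_congr (AEEqFun.coeFn_add f g)]
  refine (ENNReal.div_le_div_right (lintegral_rearrangement_add_le f.aemeasurable g.aemeasurable
    ht.1) _).trans ?_
  rw [ENNReal.add_div]
  exact add_le_add
    (le_iSup₂ (f := fun t (_ : t ∈ intervalIoo γ) => (∫⁻ s in Ioo 0 t,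
      rearrangement (volume.restrict (intervalIoo γ)) f s) / ENNReal.ofReal (ψ t)) t ht)
    (le_iSup₂ (f := fun t (_ : t ∈ intervalIoo γ) => (∫⁻ s in Ioo 0 t,
      rearrangement (volume.restrict (intervalIoo γ)) g s) / ENNReal.ofReal (ψ t)) t ht)

theorem marcinkiewiczENorm_smul (ψ : ℝ → ℝ) (γ : ℝ≥0∞) (c : ℝ) (f : LZero γ) :
    marcinkiewiczENorm ψ γ (c • f) = ENNReal.ofReal |c| * marcinkiewiczENorm ψ γ f := by
  simp only [marcinkiewiczENorm, ENNReal.mul_iSup]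
  refine iSup_congr fun t => iSup_congr fun _ => ?_
  rw [rearrangement_congr (AEEqFun.coeFn_smul c f)]
  simp_rw [rearrangement_smul]
  rw [lintegral_const_mul' _ _ ENNReal.ofReal_ne_top, mul_div_assoc]

theorem marcinkiewiczENorm_eq_zero {ψ : ℝ → ℝ} {γ : ℝ≥0∞} {f : LZero γ}
    (h : marcinkiewiczENorm ψ γ f = 0) : f = 0 := by
  refine AEEqFun.ext (EventuallyEq.trans ?_ AEEqFun.coeFn_zero.symm)
  rcases (intervalIoo γ).eq_empty_or_nonempty with he | ⟨t, ht⟩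
  · rw [Filter.EventuallyEq, ae_iff]
    exact nonpos_iff_eq_zero.1 ((measure_mono (subset_univ _)).trans (by simp [he]))
  · refine ae_eq_zero_of_lintegral_rearrangement ht.1 ?_
    have := iSup₂_le_iff.1 h.le t ht
    rw [nonpos_iff_eq_zero, ENNReal.div_eq_zero_iff] at this
    exact this.resolve_right ENNReal.ofReal_ne_top

/-- The Marcinkiewicz space `M_ψ(0, γ) = {f ∈ L₀(0, γ) : ‖f‖ < ∞}`. -/
def marcinkiewiczSpace (ψ : ℝ → ℝ) (γ : ℝ≥0∞) : Submodule ℝ (LZero γ) where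
  carrier := {f | marcinkiewiczENorm ψ γ f < ∞}
  add_mem' hf hg := (marcinkiewiczENorm_add_le ψ γ _ _).trans_lt (ENNReal.add_lt_top.2 ⟨hf, hg⟩)
  zero_mem' := by
    have h := marcinkiewiczENorm_smul ψ γ 0 0
    rw [zero_smul, abs_zero, ENNReal.ofReal_zero, zero_mul] at h
    simp only [mem_ofPred_eq, h, ENNReal.zero_lt_top]
  smul_mem' c f hf := by
    simp only [mem_ofPred_eq, marcinkiewiczENorm_smul]
    exact ENNReal.mul_lt_top ENNReal.ofReal_lt_top hf

instance marcinkiewiczSpace.instNorm (ψ : ℝ → ℝ) (γ : ℝ≥0∞) : Norm (marcinkiewiczSpace ψ γ) :=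
  ⟨fun f => (marcinkiewiczENorm ψ γ f.1).toReal⟩

theorem marcinkiewiczSpace.core (ψ : ℝ → ℝ) (γ : ℝ≥0∞) :
    NormedSpace.Core ℝ (marcinkiewiczSpace ψ γ) where
  norm_nonneg _ := ENNReal.toReal_nonneg
  norm_smul c f := by
    change (marcinkiewiczENorm ψ γ (c • f.1)).toReal = _
    rw [marcinkiewiczENorm_smul, ENNReal.toReal_mul, ENNReal.toReal_ofReal (abs_nonneg c)]
    rfl
  norm_triangle f g := by
    change (marcinkiewiczENorm ψ γ (f.1 + g.1)).toReal ≤ _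
    refine (ENNReal.toReal_mono (ENNReal.add_lt_top.2 ⟨f.2, g.2⟩).ne
      (marcinkiewiczENorm_add_le ψ γ _ _)).trans_eq ?_
    rw [ENNReal.toReal_add (ne_of_lt f.2) (ne_of_lt g.2)]
    rfl
  norm_eq_zero_iff f := by
    constructor
    · intro h
      have h' : (marcinkiewiczENorm ψ γ f.1).toReal = 0 := h
      rw [ENNReal.toReal_eq_zero_iff] at h'
      exact Subtype.ext (marcinkiewiczENorm_eq_zero (h'.resolve_right (ne_of_lt f.2)))
    · rintro rfl
      change (marcinkiewiczENorm ψ γ 0).toReal = 0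
      have h := marcinkiewiczENorm_smul ψ γ 0 0
      rw [zero_smul, abs_zero, ENNReal.ofReal_zero, zero_mul] at h
      rw [h, ENNReal.toReal_zero]

instance marcinkiewiczSpace.instNormedAddCommGroup (ψ : ℝ → ℝ) (γ : ℝ≥0∞) :
    NormedAddCommGroup (marcinkiewiczSpace ψ γ) :=
  NormedAddCommGroup.ofCore (marcinkiewiczSpace.core ψ γ)

instance marcinkiewiczSpace.instNormedSpace (ψ : ℝ → ℝ) (γ : ℝ≥0∞) :
    NormedSpace ℝ (marcinkiewiczSpace ψ γ) :=
  NormedSpace.ofCore (marcinkiewiczSpace.core ψ γ)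

/-! ### Grothendieck spaces and the two conditions -/

/-- A Grothendieck space: a Banach space `X` such that every weak-* convergent sequence in the
dual `X*` converges weakly, i.e. for `σ(X*, X**)` (necessarily to the same limit). -/
structure IsGrothendieckSpace (X : Type*) [NormedAddCommGroup X] [NormedSpace ℝ X] : Prop where
  complete : CompleteSpace X
  weak_of_weakStar : ∀ (φ : ℕ → StrongDual ℝ X) (φ₀ : StrongDual ℝ X),
    Tendsto (fun n => StrongDual.toWeakDual (φ n)) atTop (𝓝 (StrongDual.toWeakDual φ₀)) →
    Tendsto (fun n => toWeakSpace ℝ (StrongDual ℝ X) (φ n)) atTop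
      (𝓝 (toWeakSpace ℝ (StrongDual ℝ X) φ₀))

/-- `γ = ∞` and `liminf ψ(2t)/ψ(t) > 1` both as `t ↓ 0` and as `t → ∞`; the lower limits are taken
in the extended reals. -/
def ConditionA (ψ : ℝ → ℝ) (γ : ℝ≥0∞) : Prop :=
  γ = ∞ ∧ 1 < liminf (fun t => ((ψ (2 * t) / ψ t : ℝ) : EReal)) (𝓝[>] 0) ∧
    1 < liminf (fun t => ((ψ (2 * t) / ψ t : ℝ) : EReal)) atTop

/-- `γ < ∞` and `liminf ψ(2t)/ψ(t) > 1` as `t ↓ 0`. -/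
def ConditionB (ψ : ℝ → ℝ) (γ : ℝ≥0∞) : Prop :=
  γ < ∞ ∧ 1 < liminf (fun t => ((ψ (2 * t) / ψ t : ℝ) : EReal)) (𝓝[>] 0)

end

/-! ### Pointwise null sequences dominated by a uniformly smooth seminorm -/

/-! Sufficiency. Under (A) or (B), concavity upgrades the lower limits to geometric decay `κ ^ j * ψ
(t / 2 ^ j) ≤ C * ψ t` with `κ > 1` (`IsConcaveWeight.exists_decay`). Cut `f` in the unit ball into
its dyadic layers `2 ^ k < |f| ≤ 2 ^ (k + 1)`. Divided by `2 ^ (k + 1)`, they are bounded by `1` in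
supremum norm, and also in `L^q` of Lebesgue measure scaled by the largest measure that `{2 ^ k <
|f|}` can have. Conversely, if `q > 1` is so close to `1` that `2 ^ (1 - q⁻¹) < κ`, the decay bounds
`∑ 2 ^ (k + 1) g_k` in `M_ψ` for every family `g` with such bounds. Hence `M_ψ` is a quotient of an
`ℓ∞`-sum of spaces `L∞ ∩ L^q` (`exists_grid_quotient`).

By a separation argument (`tendsto_weak_of_small_convexHull`) it suffices that every pointwise null
sequence of functionals `φ n` on this sum, dominated by its norm `N`, has convex combinations of
arbitrarily small norm (`exists_mem_convexHull_le_gridNorm`). There are two cases.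

Either unit vectors `g` with `φ n g` bounded below can be averaged so that the means of `|g| ^ q`
and of the energies are arbitrarily small. Then disjoint vectors with bounded total energy can be
peeled off on which the functionals stay bounded below. They span an image of `ℓ∞`, against
Phillips' lemma. Or such averages do not exist, and Hahn–Banach gives a positive functional `ν` on
bounded functions such that `p g = ν(|g| ^ q) ^ q⁻¹`, with the energies included in the argument of
`ν`, dominates every late `φ n` up to `ε N`. As `1 < q ≤ 2`, `p` is uniformly smooth; norming
functionals are then almost unique, so the near-optimal convex combinations from different tails
almost agree, and they vanish in the limit (`exists_mem_convexHull_small_of_smooth`).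

Necessity. Where `ψ (2 t) / ψ t` comes close to `1`, concavity keeps `ψ` flat on long intervals `[t,
c t]`. There the norm resembles an `L¹` norm, and normalised integrals over consecutive intervals of
length `t` resemble the coordinates of `ℓ¹`. An ultrafilter limit along longer and longer blocks
produces a bounded operator into `ℓ¹` with bounded liftings of the unit vectors, which no
Grothendieck space admits (`not_isGrothendieckSpace_of_biorthogonal`). -/

theorem abs_le_of_mem_convexHull {Y : Type*} [AddCommGroup Y] [Module ℝ Y]
    {S : Set (Y →ₗ[ℝ] ℝ)} {θ : Y →ₗ[ℝ] ℝ} (hθ : θ ∈ convexHull ℝ S) {g : Y} {c : ℝ}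
    (h : ∀ φ ∈ S, |φ g| ≤ c) : |θ g| ≤ c := by
  have hconv : Convex ℝ {θ : Y →ₗ[ℝ] ℝ | |θ g| ≤ c} := by
    have : {θ : Y →ₗ[ℝ] ℝ | |θ g| ≤ c} = (LinearMap.applyₗ g) ⁻¹' (Metric.closedBall (0 : ℝ) c) := by
      ext θ; simp
    rw [this]
    exact (convex_closedBall 0 c).linear_preimage _
  exact convexHull_min (s := S) h hconv hθ

/-- Smoothness makes norming functionals almost unique. Let `d` be the limit over the tails of the
least constant `c` for which the tail hull contains some `θ` with `|θ| ≤ c p + ε N`. The midpoint of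
two near-optimal functionals `θ`, `θ'` cannot do much better, so one vector almost norms both, and
smoothness at that vector forces `θ - θ' ≤ 3 ε N`. As `θ'` may come from arbitrarily late tails,
which vanish pointwise, `θ` itself is small. -/
theorem exists_mem_convexHull_small_of_smooth {Y : Type*} [AddCommGroup Y] [Module ℝ Y]
    (N : Seminorm ℝ Y) (p : Y → ℝ) {q A ε : ℝ} (hq : 1 < q) (hA : 0 < A) (hε : 0 < ε)
    (hp0 : ∀ g, 0 ≤ p g) (hpA : ∀ g, p g ≤ A * N g) (hps : ∀ (c : ℝ) g, p (c • g) = |c| * p g)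
    (hpq : ∀ f g, p (f + g) ^ q + p (f - g) ^ q ≤ 2 * (p f ^ q + p g ^ q))
    (φ : ℕ → Y →ₗ[ℝ] ℝ) (hφ : ∀ g, Tendsto (fun n => φ n g) atTop (𝓝 0))
    (hdom : ∀ n g, |φ n g| ≤ p g + ε * N g) :
    ∃ θ ∈ convexHull ℝ (range φ), ∀ g, |θ g| ≤ 4 * ε * N g := by
  have hN0 : ∀ g, 0 ≤ N g := fun g => apply_nonneg N g
  set H : ℕ → Set (Y →ₗ[ℝ] ℝ) := fun n => convexHull ℝ (φ '' Ici n) with hH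
  have hHanti : ∀ {m n}, m ≤ n → H n ⊆ H m := fun h =>
    convexHull_mono (image_mono (Ici_subset_Ici.2 h))
  have hHr : ∀ n, H n ⊆ convexHull ℝ (range φ) := fun n => convexHull_mono (image_subset_range _ _)
  set S : ℕ → Set ℝ := fun n =>
    {c | 0 ≤ c ∧ ∃ θ ∈ H n, ∀ g, |θ g| ≤ c * p g + ε * N g} with hS
  have hS1 : ∀ n, (1 : ℝ) ∈ S n := fun n =>
    ⟨zero_le_one, φ n, subset_convexHull ℝ _ ⟨n, mem_Ici.2 le_rfl, rfl⟩, fun g => by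
      rw [one_mul]; exact hdom n g⟩
  have hSb : ∀ n, BddBelow (S n) := fun n => ⟨0, fun c hc => hc.1⟩
  have hSanti : ∀ {m n}, m ≤ n → S n ⊆ S m := fun h c hc =>
    ⟨hc.1, hc.2.imp fun θ hθ => ⟨hHanti h hθ.1, hθ.2⟩⟩
  set c : ℕ → ℝ := fun n => sInf (S n) with hc
  have hc1 : ∀ n, c n ≤ 1 := fun n => csInf_le (hSb n) (hS1 n)
  have hc0 : ∀ n, 0 ≤ c n := fun n => le_csInf ⟨1, hS1 n⟩ fun b hb => hb.1
  have hcb : BddAbove (range c) := ⟨1, by rintro _ ⟨n, rfl⟩; exact hc1 n⟩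
  set d : ℝ := ⨆ n, c n with hd
  have hd1 : d ≤ 1 := ciSup_le hc1
  have hcd : ∀ n, c n ≤ d := fun n => le_ciSup hcb n
  have hd0 : 0 ≤ d := (hc0 0).trans (hcd 0)
  -- `τ` is the size of the perturbation of the norming vector, `s` the tolerance of
  -- near-optimality. The final error is `p g * (4 * s / τ + 4 * τ ^ (q - 1))`, so `τ` is fixed
  -- first, by `q > 1`, and then `s`.
  obtain ⟨τ, hτ0, hτ1, hτ⟩ : ∃ τ : ℝ, 0 < τ ∧ τ ≤ 1 ∧ 4 * τ ^ (q - 1) * A ≤ ε / 2 := by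
    refine ⟨min 1 ((ε / (8 * A)) ^ (q - 1)⁻¹), by positivity, min_le_left _ _, ?_⟩
    have hb : (0 : ℝ) < ε / (8 * A) := by positivity
    have : (min 1 ((ε / (8 * A)) ^ (q - 1)⁻¹)) ^ (q - 1) ≤ ε / (8 * A) := by
      calc (min 1 ((ε / (8 * A)) ^ (q - 1)⁻¹)) ^ (q - 1)
          ≤ ((ε / (8 * A)) ^ (q - 1)⁻¹) ^ (q - 1) :=
            Real.rpow_le_rpow (by positivity) (min_le_right _ _) (by linarith)
        _ = ε / (8 * A) := Real.rpow_inv_rpow hb.le (by linarith)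
    calc _ ≤ 4 * (ε / (8 * A)) * A := by gcongr
      _ = ε / 2 := by field_simp; ring
  obtain ⟨s, hs0, hs1, hs⟩ : ∃ s : ℝ, 0 < s ∧ s ≤ 1 ∧ 4 * s / τ * A ≤ ε / 2 := by
    refine ⟨min 1 (τ * ε / (8 * A)), by positivity, min_le_left _ _, ?_⟩
    calc 4 * (min 1 (τ * ε / (8 * A))) / τ * A ≤ 4 * (τ * ε / (8 * A)) / τ * A := by
          gcongr; exact min_le_right _ _
      _ = ε / 2 := by field_simp; ring
  have hex : ∀ n, ∃ θ ∈ H n, ∀ g, |θ g| ≤ (d + s) * p g + ε * N g := by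
    intro n
    obtain ⟨b, hb, hbd⟩ := exists_lt_of_csInf_lt ⟨1, hS1 n⟩ (show sInf (S n) < d + s by
      have := hcd n; simp only [hc] at this; linarith)
    obtain ⟨θ, hθ, hθb⟩ := hb.2
    refine ⟨θ, hθ, fun g => (hθb g).trans ?_⟩
    have := hp0 g
    gcongr
  rcases lt_or_ge d s with hds | hds
  · obtain ⟨θ, hθ, hθb⟩ := hex 0
    refine ⟨θ, hHr 0 hθ, fun g => (hθb g).trans ?_⟩
    have h1 : (d + s) * p g ≤ (4 * s / τ) * (A * N g) := by
      have : d + s ≤ 4 * s / τ := by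
        rw [le_div_iff₀ hτ0]; nlinarith
      have h2 : 0 ≤ 4 * s / τ := by positivity
      exact mul_le_mul this (hpA g) (hp0 g) h2
    have h2 : (4 * s / τ) * (A * N g) ≤ ε / 2 * N g := by
      rw [← mul_assoc]; exact mul_le_mul_of_nonneg_right hs (hN0 g)
    have h3 := mul_nonneg hε.le (hN0 g)
    linarith
  obtain ⟨n₀, hn₀⟩ := exists_lt_of_lt_ciSup (show d - s < ⨆ n, c n by linarith)
  obtain ⟨θ, hθ, hθb⟩ := hex n₀
  refine ⟨θ, hHr n₀ hθ, fun g => ?_⟩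
  have key : ∀ m ≥ n₀, ∀ θ' ∈ H m, (∀ g, |θ' g| ≤ (d + s) * p g + ε * N g) →
      ∀ g, (θ - θ') g ≤ 3 * ε * N g := by
    intro m hm θ' hθ' hθb' g
    have hmid : (2⁻¹ : ℝ) • θ + (2⁻¹ : ℝ) • θ' ∈ H n₀ :=
      (convex_convexHull ℝ _) hθ (hHanti hm hθ') (by norm_num) (by norm_num) (by norm_num)
    -- The midpoint lies in `H n₀`, and `d - s` is below the infimum `c n₀` of the admissible
    -- constants there.
    have hnot : ¬ ∀ f, |((2⁻¹ : ℝ) • θ + (2⁻¹ : ℝ) • θ') f| ≤ (d - s) * p f + ε * N f := by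
      intro h
      exact absurd (csInf_le (hSb n₀) ⟨by linarith, _, hmid, h⟩) (not_le.2 hn₀)
    push Not at hnot
    obtain ⟨f₀, hf₀⟩ := hnot
    obtain ⟨f, hf⟩ : ∃ f, 2 * ((d - s) * p f + ε * N f) < θ f + θ' f := by
      have e : ∀ f, ((2⁻¹ : ℝ) • θ + (2⁻¹ : ℝ) • θ') f = 2⁻¹ * (θ f + θ' f) := fun f => by
        simp; ring
      rw [e] at hf₀
      rcases abs_cases (2⁻¹ * (θ f₀ + θ' f₀)) with ⟨h, -⟩ | ⟨h, -⟩
      · exact ⟨f₀, by linarith⟩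
      · refine ⟨-f₀, ?_⟩
        have h1 : p (-f₀) = p f₀ := by have := hps (-1) f₀; simpa using this
        rw [h1, map_neg_eq_map N, map_neg θ, map_neg θ']
        linarith
    have hpf : 0 < p f := by
      rcases (hp0 f).eq_or_lt with h | h
      · exfalso
        have h1 := (le_abs_self _).trans (hθb f)
        have h2 := (le_abs_self _).trans (hθb' f)
        rw [← h] at h1 h2 hf
        linarith
      · exact h
    -- `p g` may vanish, so `g` is scaled by a strict upper bound `σ` that afterwards decreases to
    -- `p g`.
    have hbound : ∀ σ, p g < σ →
        (θ - θ') g ≤ σ * (4 * s / τ + 4 * τ ^ (q - 1)) + 2 * ε * N g := by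
      intro σ hσ
      have hσ0 : 0 < σ := (hp0 g).trans_lt hσ
      set u : Y := (p f)⁻¹ • f with hu
      set v : Y := (τ / σ) • g with hv
      have hpu : p u = 1 := by
        rw [hu, hps, abs_of_pos (by positivity)]; field_simp
      have hpv : p v ≤ τ := by
        rw [hv, hps, abs_of_pos (by positivity), div_mul_eq_mul_div, div_le_iff₀ hσ0]
        gcongr
      have hsum : p (u + v) + p (u - v) ≤ 2 + 2 * τ ^ q := by
        -- Bernoulli's inequality linearises the `q`-th power inequality around `p u = 1`.
        have b : ∀ x : ℝ, 0 ≤ x → q * (x - 1) ≤ x ^ q - 1 := fun x hx => by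
          have := one_add_mul_self_le_rpow_one_add (s := x - 1) (p := q) (by linarith) hq.le
          rw [show 1 + (x - 1) = x by ring] at this
          linarith
        have h1 := b _ (hp0 (u + v))
        have h2 := b _ (hp0 (u - v))
        have h3 := hpq u v
        have h4 : p v ^ q ≤ τ ^ q := Real.rpow_le_rpow (hp0 v) hpv (by linarith)
        rw [hpu, Real.one_rpow] at h3
        have h5 : (0 : ℝ) ≤ τ ^ q := by positivity
        nlinarith
      have hu2 : 2 * (d - s) + 2 * ε * N u < θ u + θ' u := by
        rw [hu, map_smul θ, map_smul θ', map_smul_eq_mul N, smul_eq_mul, smul_eq_mul, Real.norm_eq_abs,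
          abs_of_pos (by positivity : 0 < (p f)⁻¹), ← mul_add]
        have := mul_lt_mul_of_pos_left hf (by positivity : 0 < (p f)⁻¹)
        refine lt_of_eq_of_lt ?_ this
        field_simp
      have hN1 : N (u + v) ≤ N u + N v := map_add_le_add N u v
      have hN2 : N (u - v) ≤ N u + N v := map_sub_le_add N u v
      have h1 := (le_abs_self _).trans (hθb (u + v))
      have h2 := (le_abs_self _).trans (hθb' (u - v))
      rw [map_add] at h1
      rw [map_sub] at h2
      have h3 : θ v - θ' v ≤ 4 * s + 4 * τ ^ q + 2 * ε * N v := by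
        have h5 : (0 : ℝ) ≤ τ ^ q := by positivity
        have h6 : (d + s) * (p (u + v) + p (u - v)) ≤ (d + s) * (2 + 2 * τ ^ q) := by gcongr
        have h7 : ε * N (u + v) ≤ ε * (N u + N v) := by gcongr
        have h8 : ε * N (u - v) ≤ ε * (N u + N v) := by gcongr
        nlinarith
      have h4 : (θ - θ') g = σ / τ * (θ v - θ' v) := by
        rw [hv, map_smul, map_smul, smul_eq_mul, smul_eq_mul, LinearMap.sub_apply]
        field_simp
      have h5 : N v = τ / σ * N g := by
        rw [hv, map_smul_eq_mul, Real.norm_eq_abs, abs_of_pos (by positivity)]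
      rw [h4]
      calc σ / τ * (θ v - θ' v) ≤ σ / τ * (4 * s + 4 * τ ^ q + 2 * ε * (τ / σ * N g)) := by
            rw [← h5]; gcongr
        _ = σ * (4 * s / τ + 4 * τ ^ (q - 1)) + 2 * ε * N g := by
            rw [Real.rpow_sub_one hτ0.ne']; field_simp
    have hlim : (θ - θ') g ≤ p g * (4 * s / τ + 4 * τ ^ (q - 1)) + 2 * ε * N g := by
      have ht : Tendsto (fun σ : ℝ => σ * (4 * s / τ + 4 * τ ^ (q - 1)) + 2 * ε * N g) (𝓝[>] (p g))
          (𝓝 (p g * (4 * s / τ + 4 * τ ^ (q - 1)) + 2 * ε * N g)) :=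
        ((continuous_id.mul continuous_const).add continuous_const).continuousWithinAt
      exact ge_of_tendsto ht (eventually_mem_nhdsWithin.mono fun σ hσ => hbound σ hσ)
    refine hlim.trans ?_
    have h1 : p g * (4 * s / τ + 4 * τ ^ (q - 1)) ≤ A * N g * (4 * s / τ + 4 * τ ^ (q - 1)) := by
      have := hpA g
      gcongr
    have h2 : A * N g * (4 * s / τ + 4 * τ ^ (q - 1)) ≤ ε * N g := by
      have h3 := mul_le_mul_of_nonneg_right hs (hN0 g)
      have h4 := mul_le_mul_of_nonneg_right hτ (hN0 g)
      nlinarith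
    linarith
  have hsmall : ∀ g, θ g ≤ 3 * ε * N g := by
    intro g
    refine le_of_forall_pos_le_add fun ξ hξ => ?_
    obtain ⟨m, hm⟩ := eventually_atTop.1 ((hφ g).eventually (Metric.ball_mem_nhds 0 hξ))
    obtain ⟨θ', hθ', hθb'⟩ := hex (max m n₀)
    have h1 := key _ (le_max_right _ _) θ' hθ' hθb' g
    have h2 : |θ' g| ≤ ξ := abs_le_of_mem_convexHull hθ' (by
      rintro _ ⟨j, hj, rfl⟩
      have := hm j ((le_max_left _ _).trans hj)
      rw [Real.dist_0_eq_abs] at this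
      exact this.le)
    rw [LinearMap.sub_apply] at h1
    have := (abs_le.1 h2).2
    linarith
  have h1 := hsmall g
  have h2 := hsmall (-g)
  rw [map_neg_eq_map N, map_neg θ] at h2
  have h3 := mul_nonneg hε.le (hN0 g)
  rw [abs_le]
  constructor <;> linarith

/-! ### Rosenthal's disjointification and Phillips' lemma -/

/-- Rosenthal's lemma for uniformly bounded superadditive set functions on `ℕ`. -/
theorem exists_infinite_superadditive_le (v : ℕ → Set ℕ → ℝ) (hv0 : ∀ n A, 0 ≤ v n A)
    (hv : ∀ n A B, Disjoint A B → v n A + v n B ≤ v n (A ∪ B)) {C ε : ℝ} (hC : ∀ n A, v n A ≤ C)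
    (hε : 0 < ε) : ∃ M : Set ℕ, M.Infinite ∧ ∀ n ∈ M, v n (M \ {n}) ≤ ε := by
  have hmono : ∀ n A B, A ⊆ B → v n A ≤ v n B := fun n A B h => by
    have := hv n A (B \ A) disjoint_sdiff_right
    rw [union_sdiff_cancel h] at this
    linarith [hv0 n (B \ A)]
  -- Induction on the bound in units of `ε`. The pairing function splits `M₀` into infinitely many
  -- infinite pieces `P p`. If no piece works, each contains a bad point `m p` for which the rest of
  -- its piece carries more than `ε`. The set of bad points meets that rest nowhere, so by
  -- superadditivity passing to it lowers the bound by `ε`.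
  have key : ∀ (k : ℕ) (M₀ : Set ℕ), M₀.Infinite → (∀ n ∈ M₀, v n (M₀ \ {n}) ≤ k * ε) →
      ∃ M : Set ℕ, M.Infinite ∧ ∀ n ∈ M, v n (M \ {n}) ≤ ε := by
    intro k
    induction k with
    | zero =>
      intro M₀ hM₀ h
      exact ⟨M₀, hM₀, fun n hn => (h n hn).trans (by simpa using hε.le)⟩
    | succ k ih =>
      intro M₀ hM₀ h
      set e : ℕ → ℕ := Nat.nth (· ∈ M₀)
      have he : Function.Injective e := Nat.nth_injective hM₀
      have heM : ∀ i, e i ∈ M₀ := Nat.nth_mem_of_infinite hM₀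
      set P : ℕ → Set ℕ := fun p => range fun j => e (Nat.pair p j)
      have hP : ∀ p, (P p).Infinite := fun p => infinite_range_of_injective fun a b hab => by
        have := he hab
        rw [Nat.pair_eq_pair] at this
        exact this.2
      have hPM : ∀ p, P p ⊆ M₀ := by
        rintro p _ ⟨j, rfl⟩; exact heM _
      have hPeq : ∀ {p r x}, x ∈ P p → x ∈ P r → p = r := by
        rintro p r x ⟨j, rfl⟩ ⟨i, hi⟩
        have := he hi
        rw [Nat.pair_eq_pair] at this
        exact this.1.symm
      by_cases hp : ∃ p, ∀ n ∈ P p, v n (P p \ {n}) ≤ ε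
      · obtain ⟨p, hp⟩ := hp
        exact ⟨P p, hP p, hp⟩
      push Not at hp
      choose m hm hmε using hp
      have hminj : Function.Injective m := fun a b hab => hPeq (hm a) (hab ▸ hm b)
      refine ih (range m) (infinite_range_of_injective hminj) ?_
      rintro _ ⟨p, rfl⟩
      have hdisj : Disjoint (range m \ {m p}) (P p \ {m p}) := by
        rw [disjoint_left]
        rintro _ ⟨⟨r, rfl⟩, hr⟩ ⟨hr', -⟩
        exact hr (by rw [hPeq hr' (hm r), mem_singleton_iff])
      have h1 := hv (m p) _ _ hdisj
      have h2 := hmono (m p) ((range m \ {m p}) ∪ (P p \ {m p})) (M₀ \ {m p}) (by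
        rintro x (⟨⟨r, rfl⟩, hx⟩ | ⟨hx, hx'⟩)
        · exact ⟨hPM r (hm r), hx⟩
        · exact ⟨hPM p hx, hx'⟩)
      have h3 := h (m p) (hPM p (hm p))
      have h4 := hmε p
      push_cast at h3
      linarith
  obtain ⟨k, hk⟩ := exists_nat_ge (C / ε)
  exact key k univ infinite_univ fun n _ => (hC n _).trans ((div_le_iff₀ hε).1 hk)

/-- The indicator of `A`, as a bounded sequence. -/
noncomputable def boundedIndicator (A : Set ℕ) : BoundedContinuousFunction ℕ ℝ :=
  BoundedContinuousFunction.ofNormedAddCommGroupDiscrete (A.indicator 1) 1 fun n => by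
    by_cases h : n ∈ A <;> simp [h]

theorem boundedIndicator_apply (A : Set ℕ) (n : ℕ) :
    boundedIndicator A n = A.indicator (1 : ℕ → ℝ) n := rfl

/-- Phillips' lemma: a pointwise null, uniformly bounded sequence of functionals on `ℓ∞` tends to
zero along the unit vectors. -/
theorem not_forall_le_apply_boundedIndicator {C ε : ℝ} (hε : 0 < ε)
    (θ : ℕ → BoundedContinuousFunction ℕ ℝ →ₗ[ℝ] ℝ) (hθ : ∀ n a, θ n a ≤ C * ‖a‖)
    (h0 : ∀ a, Tendsto (fun n => θ n a) atTop (𝓝 0)) :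
    ¬ ∀ n, ε ≤ θ n (boundedIndicator {n}) := by
  intro hn
  -- `sSup (V n A)` is the norm of `θ n` on sequences supported in `A`. It is superadditive because
  -- disjointly supported elements of the unit ball of `ℓ∞` add up to an element of the unit ball.
  -- Rosenthal's lemma then leaves `θ n` at least `ε / 2` on the indicator of `M` for all `n ∈ M`.
  set V : ℕ → Set ℕ → Set ℝ := fun n A =>
    {r | ∃ a : BoundedContinuousFunction ℕ ℝ, ‖a‖ ≤ 1 ∧ (∀ i ∉ A, a i = 0) ∧ θ n a = r} with hV
  have hC : 0 ≤ C := by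
    have h1 := hθ 0 (boundedIndicator {0})
    have h2 := hn 0
    by_contra! hc
    nlinarith [norm_nonneg (boundedIndicator {0})]
  have hVb : ∀ n A, BddAbove (V n A) := by
    refine fun n A => ⟨C, ?_⟩
    rintro _ ⟨a, ha, -, rfl⟩
    exact (hθ n a).trans (by nlinarith)
  have hV0 : ∀ n A, (0 : ℝ) ∈ V n A := fun n A => ⟨0, by simp, by simp, by simp⟩
  obtain ⟨M, hM, hMε⟩ := exists_infinite_superadditive_le (fun n A => sSup (V n A))
    (fun n A => le_csSup (hVb n A) (hV0 n A))
    (by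
      intro n A B hAB
      rw [← csSup_add ⟨0, hV0 n A⟩ (hVb n A) ⟨0, hV0 n B⟩ (hVb n B)]
      refine csSup_le_csSup (hVb n _) (Set.Nonempty.add ⟨0, hV0 n A⟩ ⟨0, hV0 n B⟩) ?_
      rintro _ ⟨_, ⟨a, ha, haA, rfl⟩, _, ⟨b, hb, hbB, rfl⟩, rfl⟩
      refine ⟨a + b, ?_, fun i hi => ?_, map_add _ _ _⟩
      · rw [BoundedContinuousFunction.norm_le zero_le_one] at ha hb ⊢
        intro i
        rw [BoundedContinuousFunction.add_apply]
        by_cases hi : i ∈ A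
        · rw [hbB i (disjoint_left.1 hAB hi), add_zero]; exact ha i
        · rw [haA i hi, zero_add]; exact hb i
      · rw [mem_union, not_or] at hi
        rw [BoundedContinuousFunction.add_apply, haA i hi.1, hbB i hi.2, add_zero])
    (fun n A => csSup_le ⟨0, hV0 n A⟩ (by
      rintro _ ⟨a, ha, -, rfl⟩
      exact (hθ n a).trans (by nlinarith))) (half_pos hε)
  have hlow : ∀ n ∈ M, ε / 2 ≤ θ n (boundedIndicator M) := by
    intro n hnM
    have h1 : -θ n (boundedIndicator (M \ {n})) ≤ ε / 2 := by
      refine (le_csSup (hVb n _) ⟨-boundedIndicator (M \ {n}), ?_, fun i hi => ?_, map_neg _ _⟩).trans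
        (hMε n hnM)
      · rw [norm_neg, BoundedContinuousFunction.norm_le zero_le_one]
        intro i
        rw [boundedIndicator_apply]
        by_cases h : i ∈ M \ {n} <;> simp only [indicator, h, if_true, if_false] <;> simp
      · rw [BoundedContinuousFunction.neg_apply, boundedIndicator_apply,
          indicator_of_notMem hi, neg_zero]
    have h2 : boundedIndicator M = boundedIndicator {n} + boundedIndicator (M \ {n}) := by
      ext i
      rw [BoundedContinuousFunction.add_apply]
      simp only [boundedIndicator_apply]
      by_cases hi : i = n
      · subst hi; simp [hnM]
      · by_cases hiM : i ∈ M
        · rw [indicator_of_mem hiM, indicator_of_notMem (by simpa using hi),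
            indicator_of_mem (show i ∈ M \ {n} from ⟨hiM, hi⟩), zero_add]
        · rw [indicator_of_notMem hiM, indicator_of_notMem (by simpa using hi),
            indicator_of_notMem fun h => hiM h.1, zero_add]
    rw [h2, map_add]
    linarith [hn n]
  obtain ⟨m, hm⟩ := eventually_atTop.1 ((h0 (boundedIndicator M)).eventually
    (gt_mem_nhds (half_pos hε)))
  obtain ⟨n, hnM, hmn⟩ := hM.exists_gt m
  exact absurd (hm n hmn.le) (not_lt.2 (hlow n hnM))

/-! ### Weak and weak-* convergence -/

/-- If weak convergence fails, some `Λ` in the bidual satisfies `|Λ (φ n - φ₀)| ≥ δ` along a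
subsequence. Changes of sign keep the differences pointwise null and bring their whole convex hull
into the half-space `δ ≤ Λ`, which contains no functionals of small norm. -/
theorem tendsto_weak_of_small_convexHull {X : Type*} [NormedAddCommGroup X] [NormedSpace ℝ X]
    (h : ∀ φ : ℕ → StrongDual ℝ X, (∀ x, Tendsto (fun n => φ n x) atTop (𝓝 0)) →
      ∀ ε > 0, ∃ θ ∈ convexHull ℝ (range φ), ‖θ‖ ≤ ε)
    (φ : ℕ → StrongDual ℝ X) (φ₀ : StrongDual ℝ X)
    (hφ : Tendsto (fun n => StrongDual.toWeakDual (φ n)) atTop (𝓝 (StrongDual.toWeakDual φ₀))) :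
    Tendsto (fun n => toWeakSpace ℝ (StrongDual ℝ X) (φ n)) atTop
      (𝓝 (toWeakSpace ℝ (StrongDual ℝ X) φ₀)) := by
  rw [tendsto_iff_forall_eval_tendsto_topDualPairing] at hφ
  have hφ' : ∀ x, Tendsto (fun n => φ n x) atTop (𝓝 (φ₀ x)) := hφ
  refine (WeakBilin.tendsto_iff_forall_eval_tendsto _ ?_).2 fun Λ => ?_
  · intro x y hxy
    by_contra hne
    obtain ⟨Λ, -, hΛ⟩ := exists_dual_vector ℝ (x - y) (norm_ne_zero_iff.2 (sub_ne_zero.2 hne))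
    have h1 : Λ x = Λ y := congrArg (fun L => L Λ) hxy
    rw [map_sub, h1, sub_self] at hΛ
    exact hne (sub_eq_zero.1 (norm_eq_zero.1 (by simpa using hΛ.symm)))
  change Tendsto (fun n => Λ (φ n)) atTop (𝓝 (Λ φ₀))
  by_contra hnot
  rw [Metric.tendsto_atTop] at hnot
  push Not at hnot
  obtain ⟨δ, hδ, hfreq⟩ := hnot
  choose σ hσ hσδ using hfreq
  set c : ℕ → ℝ := fun n => if 0 ≤ Λ (φ (σ n) - φ₀) then 1 else -1 with hc
  have hc1 : ∀ n, |c n| ≤ 1 := fun n => by simp only [hc]; split_ifs <;> simp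
  have hcΛ : ∀ n, δ ≤ Λ (c n • (φ (σ n) - φ₀)) := fun n => by
    have h1 := hσδ n
    rw [Real.dist_eq, ← map_sub] at h1
    rw [map_smul, smul_eq_mul]
    simp only [hc]
    split_ifs with h2
    · rwa [abs_of_nonneg h2, ← one_mul (Λ _)] at h1
    · rw [abs_of_neg (not_le.1 h2)] at h1
      linarith
  have hε : 0 < δ / (2 * (‖Λ‖ + 1)) := by positivity
  obtain ⟨θ, hθ, hθε⟩ := h (fun n => c n • (φ (σ n) - φ₀)) (fun x => by
    have hσt : Tendsto σ atTop atTop := tendsto_atTop_mono hσ tendsto_id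
    have h1 : Tendsto (fun n => |φ (σ n) x - φ₀ x|) atTop (𝓝 0) := by
      have := (((hφ' x).comp hσt).sub_const (φ₀ x)).abs
      simpa using this
    refine squeeze_zero_norm (fun n => ?_) h1
    change ‖c n * (φ (σ n) x - φ₀ x)‖ ≤ _
    rw [Real.norm_eq_abs, abs_mul]
    exact mul_le_of_le_one_left (abs_nonneg _) (hc1 n)) _ hε
  have hge : δ ≤ Λ θ := by
    have hconv : Convex ℝ {θ : StrongDual ℝ X | δ ≤ Λ θ} :=
      (convex_Ici δ).linear_preimage (Λ : StrongDual ℝ X →ₗ[ℝ] ℝ)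
    refine convexHull_min (s := range fun n => c n • (φ (σ n) - φ₀)) ?_ hconv hθ
    rintro _ ⟨n, rfl⟩
    exact hcΛ n
  have h1 : Λ θ ≤ ‖Λ‖ * ‖θ‖ := (le_abs_self _).trans (Λ.le_opNorm θ)
  have h2 : ‖Λ‖ * ‖θ‖ ≤ ‖Λ‖ * (δ / (2 * (‖Λ‖ + 1))) := by gcongr
  have h3 : ‖Λ‖ * (δ / (2 * (‖Λ‖ + 1))) < δ := by
    rw [mul_div_assoc', div_lt_iff₀ (by positivity)]
    nlinarith [norm_nonneg Λ]
  linarith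

/-- Banach–Alaoglu along a free ultrafilter; weak-* convergent subsequences need not exist in
general. -/
theorem exists_hyperfilter_limit {X : Type*} [NormedAddCommGroup X] [NormedSpace ℝ X] {C : ℝ}
    (u : ℕ → StrongDual ℝ X) (hu : ∀ n, ‖u n‖ ≤ C) :
    ∃ T : StrongDual ℝ X, ∀ x, Tendsto (fun n => u n x) (hyperfilter ℕ) (𝓝 (T x)) := by
  have hc := WeakDual.isCompact_closedBall (𝕜 := ℝ) (0 : StrongDual ℝ X) C
  obtain ⟨T, -, hT⟩ := hc.ultrafilter_le_nhds'
    ((hyperfilter ℕ).map fun n => StrongDual.toWeakDual (u n))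
    (by
      refine Ultrafilter.mem_map.2 (univ_mem' fun n => ?_)
      change u n ∈ Metric.closedBall 0 C
      simpa using hu n)
  refine ⟨WeakDual.toStrongDual T, ?_⟩
  have : Tendsto (fun n => StrongDual.toWeakDual (u n)) (hyperfilter ℕ) (𝓝 T) := hT
  rw [tendsto_iff_forall_eval_tendsto_topDualPairing] at this
  exact this

/-- A space with a bounded operator onto `ℓ¹`, with a bounded lifting of the unit vectors, is
not a Grothendieck space. -/
theorem not_isGrothendieckSpace_of_biorthogonal {X : Type*} [NormedAddCommGroup X]
    [NormedSpace ℝ X] {C : ℝ} (T : ℕ → StrongDual ℝ X) (f : ℕ → X) (hf : ∀ j, ‖f j‖ ≤ C)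
    (hT : ∀ x n, ∑ j ∈ Finset.range n, |T j x| ≤ C * ‖x‖)
    (hTf : ∀ i j, T i (f j) = if i = j then 1 else 0) : ¬ IsGrothendieckSpace X := by
  intro hX
  have hsum : ∀ x, Summable fun j => |T j x| := fun x =>
    summable_of_sum_range_le (fun _ => abs_nonneg _) (hT x)
  have hsum' : ∀ k x, Summable fun j => T (j + k) x := fun k x =>
    (summable_nat_add_iff (f := fun j => T j x) k).2 (hsum x).of_abs
  have hbound : ∀ k x, ‖∑' j, T (j + k) x‖ ≤ C * ‖x‖ := by
    intro k x
    have h1 : Summable fun j => ‖T (j + k) x‖ :=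
      (summable_nat_add_iff (f := fun j => |T j x|) k).2 (hsum x)
    refine (norm_tsum_le_tsum_norm h1).trans ?_
    have h2 := (hsum x).sum_add_tsum_nat_add k
    have h3 : ∑' j, |T j x| ≤ C * ‖x‖ :=
      Real.tsum_le_of_sum_range_le (fun _ => abs_nonneg _) (hT x)
    have h4 : 0 ≤ ∑ j ∈ Finset.range k, |T j x| := Finset.sum_nonneg fun _ _ => abs_nonneg _
    simp only [Real.norm_eq_abs]
    linarith
  -- The tails `∑_{j ≥ k} T j` are pointwise null because the series converges at every point. An
  -- ultrafilter limit `Λ` of the `f J` in the bidual nevertheless equals `1` on every tail, since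
  -- `φ k (f J) = 1` for `J ≥ k`.
  set φ : ℕ → StrongDual ℝ X := fun k => LinearMap.mkContinuous
    { toFun := fun x => ∑' j, T (j + k) x
      map_add' := fun x y => by
        simp only [map_add]
        exact (hsum' k x).tsum_add (hsum' k y)
      map_smul' := fun c x => by
        simp only [map_smul, smul_eq_mul, RingHom.id_apply]
        exact tsum_mul_left } C (hbound k) with hφdef
  have hφ : ∀ k x, φ k x = ∑' j, T (j + k) x := fun _ _ => rfl
  have hweak := hX.weak_of_weakStar φ 0 (by
    rw [tendsto_iff_forall_eval_tendsto_topDualPairing]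
    intro x
    exact tendsto_sum_nat_add fun j => T j x)
  obtain ⟨Λ, hΛ⟩ := exists_hyperfilter_limit (C := C)
    (fun J => NormedSpace.inclusionInDoubleDual ℝ X (f J))
    (fun J => (NormedSpace.double_dual_bound ℝ X (f J)).trans (hf J))
  have hΛ1 : ∀ k, Λ (φ k) = 1 := by
    intro k
    refine tendsto_nhds_unique (hΛ (φ k)) (tendsto_const_nhds.congr' ?_)
    have : ∀ᶠ J in (hyperfilter ℕ : Filter ℕ), k ≤ J :=
      (Nat.hyperfilter_le_atTop) (eventually_ge_atTop k)
    filter_upwards [this] with J hJ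
    rw [NormedSpace.dual_def, hφ, tsum_eq_single (J - k)]
    · rw [hTf, if_pos (by omega)]
    · intro j hj
      rw [hTf, if_neg (by omega)]
  have h0 : Tendsto (fun k => Λ (φ k)) atTop (𝓝 (Λ 0)) :=
    ((WeakBilin.eval_continuous _ Λ).tendsto _).comp hweak
  simp only [hΛ1, map_zero] at h0
  exact one_ne_zero (tendsto_nhds_unique tendsto_const_nhds h0)

/-! ### Uniformly bounded families of functions with uniformly bounded `L^q` norms -/

section Grid

variable {ι α : Type*} [MeasurableSpace α]

/-- The larger of the supremum norm of a family of functions and of its `L^q` norms. -/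
noncomputable def gridENorm (μ : ι → Measure α) (q : ℝ) (g : ι → α → ℝ) : ℝ≥0∞ :=
  (⨆ k, ⨆ x, ‖g k x‖ₑ) ⊔ ⨆ k, eLpNorm (g k) (ENNReal.ofReal q) (μ k)

theorem gridENorm_le_iff {μ : ι → Measure α} {q : ℝ} {g : ι → α → ℝ} {c : ℝ≥0∞} :
    gridENorm μ q g ≤ c ↔
      (∀ k x, ‖g k x‖ₑ ≤ c) ∧ ∀ k, eLpNorm (g k) (ENNReal.ofReal q) (μ k) ≤ c := by
  simp [gridENorm]

theorem eLpNorm_ofReal_le_iff {μ : Measure α} {q : ℝ} (hq : 1 ≤ q) {g : α → ℝ} {c : ℝ≥0∞} :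
    eLpNorm g (ENNReal.ofReal q) μ ≤ c ↔ ∫⁻ x, ‖g x‖ₑ ^ q ∂μ ≤ c ^ q := by
  have hq0 : 0 < q := by linarith
  rw [eLpNorm_eq_lintegral_rpow_enorm_toReal (by simpa using hq0) ENNReal.ofReal_ne_top,
    ENNReal.toReal_ofReal hq0.le, one_div, ENNReal.rpow_inv_le_iff hq0]

theorem gridENorm_add_le (μ : ι → Measure α) {q : ℝ} (hq : 1 ≤ q) {f g : ι → α → ℝ}
    (hf : ∀ k, Measurable (f k)) (hg : ∀ k, Measurable (g k)) :
    gridENorm μ q (f + g) ≤ gridENorm μ q f + gridENorm μ q g := by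
  have h1 := gridENorm_le_iff.1 (le_refl (gridENorm μ q f))
  have h2 := gridENorm_le_iff.1 (le_refl (gridENorm μ q g))
  refine gridENorm_le_iff.2 ⟨fun k x => (enorm_add_le _ _).trans (add_le_add (h1.1 k x) (h2.1 k x)),
    fun k => ?_⟩
  exact (eLpNorm_add_le (hf k).aestronglyMeasurable (hg k).aestronglyMeasurable
    (by simpa using hq)).trans (add_le_add (h1.2 k) (h2.2 k))

theorem gridENorm_smul (μ : ι → Measure α) (q : ℝ) (c : ℝ) (g : ι → α → ℝ) :
    gridENorm μ q (c • g) = ‖c‖ₑ * gridENorm μ q g := by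
  have h1 : ∀ k x, ‖(c • g) k x‖ₑ = ‖c‖ₑ * ‖g k x‖ₑ := fun k x => enorm_smul c (g k x)
  have h2 : ∀ k, eLpNorm ((c • g) k) (ENNReal.ofReal q) (μ k)
      = ‖c‖ₑ * eLpNorm (g k) (ENNReal.ofReal q) (μ k) := fun k =>
    eLpNorm_const_smul c (g k) (ENNReal.ofReal q) (μ k)
  simp only [gridENorm, h1, h2, mul_max, ENNReal.mul_iSup]

/-- The families of measurable functions with finite `gridENorm`. -/
noncomputable def gridSpace (μ : ι → Measure α) {q : ℝ} (hq : 1 ≤ q) :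
    Submodule ℝ (ι → α → ℝ) where
  carrier := {g | (∀ k, Measurable (g k)) ∧ gridENorm μ q g < ∞}
  add_mem' := fun {f g} hf hg => ⟨fun k => (hf.1 k).add (hg.1 k),
    (gridENorm_add_le μ hq hf.1 hg.1).trans_lt (ENNReal.add_lt_top.2 ⟨hf.2, hg.2⟩)⟩
  zero_mem' := by
    refine ⟨fun k => measurable_const, ?_⟩
    have h := gridENorm_smul μ q 0 0
    rw [zero_smul, enorm_zero, zero_mul] at h
    rw [h]
    exact ENNReal.zero_lt_top
  smul_mem' := fun c f hf => ⟨fun k => (hf.1 k).const_smul c, by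
    rw [gridENorm_smul]
    exact ENNReal.mul_lt_top enorm_lt_top hf.2⟩

variable {μ : ι → Measure α} {q : ℝ} {hq : 1 ≤ q}

theorem gridSpace.measurable (g : gridSpace μ hq) (k : ι) : Measurable (g.1 k) := g.2.1 k

/-- The norm of `gridSpace`. -/
noncomputable def gridNorm (μ : ι → Measure α) {q : ℝ} (hq : 1 ≤ q) : Seminorm ℝ (gridSpace μ hq) :=
  Seminorm.of (fun g => (gridENorm μ q g.1).toReal)
    (fun f g => by
      rw [← ENNReal.toReal_add f.2.2.ne g.2.2.ne]
      exact ENNReal.toReal_mono (ENNReal.add_lt_top.2 ⟨f.2.2, g.2.2⟩).ne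
        (gridENorm_add_le μ hq f.2.1 g.2.1))
    (fun c g => by
      rw [← toReal_enorm, ← ENNReal.toReal_mul, ← gridENorm_smul]
      rfl)

theorem gridNorm_le_iff {g : gridSpace μ hq} {c : ℝ} (hc : 0 ≤ c) :
    gridNorm μ hq g ≤ c ↔ (∀ k x, |g.1 k x| ≤ c) ∧
      ∀ k, ∫⁻ x, ‖g.1 k x‖ₑ ^ q ∂μ k ≤ ENNReal.ofReal (c ^ q) := by
  have h1 : gridNorm μ hq g ≤ c ↔ gridENorm μ q g.1 ≤ ENNReal.ofReal c :=
    (ENNReal.le_ofReal_iff_toReal_le g.2.2.ne hc).symm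
  rw [h1, gridENorm_le_iff, ← ENNReal.ofReal_rpow_of_nonneg hc (by linarith)]
  simp only [eLpNorm_ofReal_le_iff hq, Real.enorm_eq_ofReal_abs, ENNReal.ofReal_le_ofReal_iff hc]

theorem mem_gridSpace {g : ι → α → ℝ} {c : ℝ} (hc : 0 ≤ c) (hg : ∀ k, Measurable (g k))
    (h : ∀ k x, |g k x| ≤ c) (h' : ∀ k, ∫⁻ x, ‖g k x‖ₑ ^ q ∂μ k ≤ ENNReal.ofReal (c ^ q)) :
    g ∈ gridSpace μ hq := by
  refine ⟨hg, lt_of_le_of_lt (b := ENNReal.ofReal c)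
    (gridENorm_le_iff.2 ⟨fun k x => ?_, fun k => ?_⟩) ENNReal.ofReal_lt_top⟩
  · rw [Real.enorm_eq_ofReal_abs]; exact ENNReal.ofReal_le_ofReal (h k x)
  · rw [eLpNorm_ofReal_le_iff hq, ENNReal.ofReal_rpow_of_nonneg hc (by linarith)]
    exact h' k

theorem abs_le_gridNorm (g : gridSpace μ hq) (k : ι) (x : α) : |g.1 k x| ≤ gridNorm μ hq g :=
  ((gridNorm_le_iff (apply_nonneg _ g)).1 le_rfl).1 k x

theorem lintegral_le_gridNorm (g : gridSpace μ hq) (k : ι) :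
    ∫⁻ x, ‖g.1 k x‖ₑ ^ q ∂μ k ≤ ENNReal.ofReal (gridNorm μ hq g ^ q) :=
  ((gridNorm_le_iff (apply_nonneg _ g)).1 le_rfl).2 k

/-- The `q`-th power of the `L^q` norm of the `k`-th function of a family. -/
noncomputable def gridEnergy (g : gridSpace μ hq) (k : ι) : ℝ := (∫⁻ x, ‖g.1 k x‖ₑ ^ q ∂μ k).toReal

theorem lintegral_ne_top (g : gridSpace μ hq) (k : ι) : ∫⁻ x, ‖g.1 k x‖ₑ ^ q ∂μ k ≠ ∞ :=
  ((lintegral_le_gridNorm g k).trans_lt ENNReal.ofReal_lt_top).ne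

theorem ofReal_gridEnergy (g : gridSpace μ hq) (k : ι) :
    ENNReal.ofReal (gridEnergy g k) = ∫⁻ x, ‖g.1 k x‖ₑ ^ q ∂μ k :=
  ENNReal.ofReal_toReal (lintegral_ne_top g k)

theorem gridEnergy_nonneg (g : gridSpace μ hq) (k : ι) : 0 ≤ gridEnergy g k := ENNReal.toReal_nonneg

theorem gridEnergy_le (g : gridSpace μ hq) (k : ι) : gridEnergy g k ≤ gridNorm μ hq g ^ q :=
  ENNReal.toReal_le_of_le_ofReal (by have := apply_nonneg (gridNorm μ hq) g; positivity)
    (lintegral_le_gridNorm g k)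

theorem gridNorm_le_iff_energy {g : gridSpace μ hq} {c : ℝ} (hc : 0 ≤ c) :
    gridNorm μ hq g ≤ c ↔ (∀ k x, |g.1 k x| ≤ c) ∧ ∀ k, gridEnergy g k ≤ c ^ q := by
  rw [gridNorm_le_iff hc]
  simp only [← ofReal_gridEnergy]
  simp only [ENNReal.ofReal_le_ofReal_iff (show 0 ≤ c ^ q by positivity)]

theorem gridEnergy_le_of_abs_le {f g : gridSpace μ hq} {c : ℝ} (hc : 0 ≤ c) {k : ι}
    (h : ∀ x, |f.1 k x| ≤ c * |g.1 k x|) : gridEnergy f k ≤ c ^ q * gridEnergy g k := by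
  have hq0 : 0 ≤ q := by linarith
  refine ENNReal.toReal_le_of_le_ofReal
    (mul_nonneg (by positivity) (gridEnergy_nonneg g k)) ?_
  rw [ENNReal.ofReal_mul (by positivity), ofReal_gridEnergy,
    ← lintegral_const_mul' _ _ ENNReal.ofReal_ne_top]
  refine lintegral_mono fun x => ?_
  rw [← ENNReal.ofReal_rpow_of_nonneg hc hq0, ← ENNReal.mul_rpow_of_nonneg _ _ hq0]
  refine ENNReal.rpow_le_rpow ?_ hq0
  rw [Real.enorm_eq_ofReal_abs, Real.enorm_eq_ofReal_abs, ← ENNReal.ofReal_mul hc]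
  exact ENNReal.ofReal_le_ofReal (h x)

theorem gridNorm_le_of_abs_le {f g : gridSpace μ hq} {c : ℝ} (hc : 0 ≤ c)
    (h : ∀ k x, |f.1 k x| ≤ c * |g.1 k x|) : gridNorm μ hq f ≤ c * gridNorm μ hq g := by
  have hg : 0 ≤ gridNorm μ hq g := apply_nonneg _ g
  refine (gridNorm_le_iff_energy (by positivity)).2 ⟨fun k x => (h k x).trans ?_, fun k => ?_⟩
  · have := abs_le_gridNorm g k x
    gcongr
  · refine (gridEnergy_le_of_abs_le hc (h k)).trans ?_
    rw [Real.mul_rpow hc hg]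
    have := gridEnergy_le g k
    gcongr

/-- Restriction of a family to a family of measurable sets. -/
noncomputable def gridRestrict (B : ι → Set α) (hB : ∀ k, MeasurableSet (B k))
    (g : gridSpace μ hq) :
    gridSpace μ hq :=
  ⟨fun k => (B k).indicator (g.1 k), mem_gridSpace (apply_nonneg (gridNorm μ hq) g)
    (fun k => (gridSpace.measurable g k).indicator (hB k))
    (fun k x => le_trans (by by_cases h : x ∈ B k <;> simp [h]) (abs_le_gridNorm g k x))
    (fun k => le_trans (lintegral_mono fun x =>
      ENNReal.rpow_le_rpow (by by_cases h : x ∈ B k <;> simp [h]) (by linarith))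
      (lintegral_le_gridNorm g k))⟩

theorem gridRestrict_apply {B : ι → Set α} (hB : ∀ k, MeasurableSet (B k)) (g : gridSpace μ hq)
    (k : ι) (x : α) : (gridRestrict B hB g).1 k x = (B k).indicator (g.1 k) x := rfl

theorem abs_gridRestrict_le {B : ι → Set α} (hB : ∀ k, MeasurableSet (B k)) (g : gridSpace μ hq)
    (k : ι) (x : α) : |(gridRestrict B hB g).1 k x| ≤ 1 * |g.1 k x| := by
  rw [gridRestrict_apply]
  by_cases h : x ∈ B k <;> simp [h]

theorem gridRestrict_add_compl {B : ι → Set α} (hB : ∀ k, MeasurableSet (B k))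
    (g : gridSpace μ hq) :
    gridRestrict B hB g + gridRestrict (fun k => (B k)ᶜ) (fun k => (hB k).compl) g = g := by
  ext k x
  change (B k).indicator (g.1 k) x + (B k)ᶜ.indicator (g.1 k) x = g.1 k x
  by_cases h : x ∈ B k <;> simp [h]

/-! ### A uniformly smooth majorant -/

/-- The parallelogram law, combined with concavity and subadditivity of `x ↦ x ^ (q / 2)`. This is
the source of the smoothness of the majorant. -/
theorem abs_add_rpow_add_abs_sub_rpow_le {q : ℝ} (hq : 1 ≤ q) (hq2 : q ≤ 2) (a b : ℝ) :
    |a + b| ^ q + |a - b| ^ q ≤ 2 * (|a| ^ q + |b| ^ q) := by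
  have hsq : ∀ x : ℝ, |x| ^ q = (x ^ 2) ^ (q / 2) := fun x => by
    rw [← sq_abs, ← Real.rpow_natCast, ← Real.rpow_mul (abs_nonneg x)]
    congr 1; push_cast; ring
  have hc := (Real.concaveOn_rpow (p := q / 2) (by linarith) (by linarith)).2
    (mem_Ici.2 (sq_nonneg (a + b))) (mem_Ici.2 (sq_nonneg (a - b)))
    (show (0 : ℝ) ≤ 2⁻¹ by norm_num) (show (0 : ℝ) ≤ 2⁻¹ by norm_num) (by norm_num)
  simp only [smul_eq_mul] at hc
  have h1 : 2⁻¹ * (a + b) ^ 2 + 2⁻¹ * (a - b) ^ 2 = a ^ 2 + b ^ 2 := by ring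
  have h2 : (a ^ 2 + b ^ 2) ^ (q / 2) ≤ (a ^ 2) ^ (q / 2) + (b ^ 2) ^ (q / 2) :=
    Real.rpow_add_le_add_rpow (sq_nonneg a) (sq_nonneg b) (by linarith) (by linarith)
  rw [h1] at hc
  rw [hsq, hsq, hsq, hsq]
  linarith

theorem gridEnergy_add_add_sub_le (hq2 : q ≤ 2) (f g : gridSpace μ hq) (k : ι) :
    gridEnergy (f + g) k + gridEnergy (f - g) k ≤ 2 * (gridEnergy f k + gridEnergy g k) := by
  have e : ∀ a : ℝ, ‖a‖ₑ ^ q = ENNReal.ofReal (|a| ^ q) := fun a => by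
    rw [Real.enorm_eq_ofReal_abs, ENNReal.ofReal_rpow_of_nonneg (abs_nonneg a) (by linarith)]
  have hm : ∀ f : gridSpace μ hq, Measurable fun x => ‖f.1 k x‖ₑ ^ q := fun f =>
    ((gridSpace.measurable f k).enorm.pow_const q)
  rw [← ENNReal.ofReal_le_ofReal_iff
    (by have := gridEnergy_nonneg f k; have := gridEnergy_nonneg g k; positivity),
    ENNReal.ofReal_add (gridEnergy_nonneg _ k) (gridEnergy_nonneg _ k), ENNReal.ofReal_mul (by norm_num),
    ENNReal.ofReal_add (gridEnergy_nonneg _ k) (gridEnergy_nonneg _ k)]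
  simp only [ofReal_gridEnergy]
  rw [← lintegral_add_left (hm _), ← lintegral_add_left (hm _),
    ← lintegral_const_mul' _ _ ENNReal.ofReal_ne_top]
  refine lintegral_mono fun x => ?_
  simp only [e]
  rw [← ENNReal.ofReal_add (by positivity) (by positivity),
    ← ENNReal.ofReal_add (by positivity) (by positivity), ← ENNReal.ofReal_mul (by norm_num)]
  exact ENNReal.ofReal_le_ofReal (abs_add_rpow_add_abs_sub_rpow_le hq hq2 _ _)

/-- The `q`-th powers of the values of a family and of its `L^q` norms, as a bounded function. -/
noncomputable def gridPower (g : gridSpace μ hq) : lp (fun _ : (ι × α) ⊕ ι => ℝ) ∞ :=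
  ⟨Sum.elim (fun z => |g.1 z.1 z.2| ^ q) (gridEnergy g), memℓp_infty ⟨gridNorm μ hq g ^ q, by
    rintro _ ⟨z | k, rfl⟩
    · simp only [Sum.elim_inl]
      rw [Real.norm_eq_abs, abs_of_nonneg (by positivity)]
      exact Real.rpow_le_rpow (abs_nonneg _) (abs_le_gridNorm g _ _) (by linarith)
    · simp only [Sum.elim_inr]
      rw [Real.norm_eq_abs, abs_of_nonneg (gridEnergy_nonneg g k)]
      exact gridEnergy_le g k⟩⟩

theorem gridPower_inl (g : gridSpace μ hq) (z : ι × α) :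
    gridPower g (Sum.inl z) = |g.1 z.1 z.2| ^ q := rfl

theorem gridPower_nonneg (g : gridSpace μ hq) (j) : 0 ≤ gridPower g j := by
  rcases j with z | k
  · rw [gridPower_inl]; positivity
  · exact gridEnergy_nonneg g k

theorem norm_gridPower_le (g : gridSpace μ hq) : ‖gridPower g‖ ≤ gridNorm μ hq g ^ q := by
  refine lp.norm_le_of_forall_le (by have := apply_nonneg (gridNorm μ hq) g; positivity) fun j => ?_
  rw [Real.norm_eq_abs, abs_of_nonneg (gridPower_nonneg g j)]
  rcases j with z | k
  · exact Real.rpow_le_rpow (abs_nonneg _) (abs_le_gridNorm g _ _) (by linarith)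
  · exact gridEnergy_le g k

theorem gridEnergy_smul (c : ℝ) (g : gridSpace μ hq) (k : ι) :
    gridEnergy (c • g) k = |c| ^ q * gridEnergy g k := by
  have h : ∀ x, ‖(c • g).1 k x‖ₑ ^ q = ENNReal.ofReal (|c| ^ q) * ‖g.1 k x‖ₑ ^ q := fun x => by
    change ‖c • g.1 k x‖ₑ ^ q = _
    rw [enorm_smul, ENNReal.mul_rpow_of_nonneg _ _ (by linarith), Real.enorm_eq_ofReal_abs c,
      ENNReal.ofReal_rpow_of_nonneg (abs_nonneg c) (by linarith)]
  rw [gridEnergy, gridEnergy]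
  simp only [h]
  rw [lintegral_const_mul' _ _ ENNReal.ofReal_ne_top, ENNReal.toReal_mul,
    ENNReal.toReal_ofReal (by positivity)]

theorem gridPower_smul (c : ℝ) (g : gridSpace μ hq) :
    gridPower (c • g) = (|c| ^ q) • gridPower g := by
  ext j
  rw [lp.coeFn_smul, Pi.smul_apply, smul_eq_mul]
  rcases j with z | k
  · rw [gridPower_inl, gridPower_inl]
    change |c * g.1 z.1 z.2| ^ q = _
    rw [abs_mul, Real.mul_rpow (abs_nonneg _) (abs_nonneg _)]
  · exact gridEnergy_smul c g k

theorem gridPower_add_add_sub_le (hq2 : q ≤ 2) (f g : gridSpace μ hq) (j) :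
    gridPower (f + g) j + gridPower (f - g) j ≤ 2 * (gridPower f j + gridPower g j) := by
  rcases j with z | k
  · exact abs_add_rpow_add_abs_sub_rpow_le hq hq2 _ _
  · exact gridEnergy_add_add_sub_le hq2 f g k

end Grid

/-- Hahn–Banach separation of the hull of `G` from the open convex set of functions with supremum
below `η`. That set contains every nonpositive function, so a functional bounded above on it is
positive. -/
theorem exists_positive_functional {J : Type*} (G : Set (lp (fun _ : J => ℝ) ∞)) {η : ℝ}
    (hη : 0 < η)
    (h : ∀ b ∈ convexHull ℝ G, ∃ j, η ≤ b j) :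
    ∃ ν : StrongDual ℝ (lp (fun _ : J => ℝ) ∞),
      (∀ b : lp (fun _ : J => ℝ) ∞, (∀ j, 0 ≤ b j) → 0 ≤ ν b) ∧ ∀ b ∈ G, 1 ≤ ν b := by
  set U : Set (lp (fun _ : J => ℝ) ∞) := {b | ∃ c < η, ∀ j, b j ≤ c} with hU
  have hUc : Convex ℝ U := by
    rintro a ⟨c, hc, ha⟩ b ⟨d, hd, hb⟩ s t hs ht hst
    refine ⟨max c d, max_lt hc hd, fun j => ?_⟩
    rw [lp.coeFn_add, Pi.add_apply, lp.coeFn_smul, lp.coeFn_smul, Pi.smul_apply, Pi.smul_apply,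
      smul_eq_mul, smul_eq_mul]
    have h1 := (ha j).trans (le_max_left c d)
    have h2 := (hb j).trans (le_max_right c d)
    calc s * a j + t * b j ≤ s * max c d + t * max c d := by gcongr
      _ = max c d := by rw [← add_mul, hst, one_mul]
  have hUo : IsOpen U := by
    rw [Metric.isOpen_iff]
    rintro a ⟨c, hc, ha⟩
    refine ⟨(η - c) / 2, by linarith, fun b hb => ⟨(η + c) / 2, by linarith, fun j => ?_⟩⟩
    have h1 := lp.norm_apply_le_norm ENNReal.top_ne_zero (b - a) j
    rw [lp.coeFn_sub, Pi.sub_apply, Real.norm_eq_abs] at h1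
    rw [mem_ball_iff_norm] at hb
    have := (abs_le.1 (h1.trans hb.le)).2
    linarith [ha j]
  obtain ⟨f, u, hfU, hfG⟩ := geometric_hahn_banach_open hUc hUo (convex_convexHull ℝ G) (by
    rw [disjoint_left]
    rintro b ⟨c, hc, hb⟩ hbG
    obtain ⟨j, hj⟩ := h b hbG
    linarith [hb j])
  have hu : 0 < u := by
    have := hfU 0 ⟨0, hη, fun j => by simp⟩
    rwa [map_zero] at this
  refine ⟨u⁻¹ • f, fun b hb => ?_, fun b hb => ?_⟩
  · have hf : 0 ≤ f b := by
      by_contra! hneg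
      have := hfU (-((u / (-f b)) • b)) ⟨0, hη, fun j => by
        rw [lp.coeFn_neg, Pi.neg_apply, lp.coeFn_smul, Pi.smul_apply, smul_eq_mul, neg_nonpos]
        have : 0 < -f b := by linarith
        have := hb j
        positivity⟩
      rw [map_neg, map_smul, smul_eq_mul] at this
      have h2 : u / -f b * f b = -u := by
        have := hneg.ne
        field_simp
      rw [h2] at this
      linarith
    rw [smul_apply, smul_eq_mul]
    positivity
  · have := hfG b (subset_convexHull ℝ G hb)
    rw [smul_apply, smul_eq_mul, inv_mul_eq_div, le_div_iff₀ hu, one_mul]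
    exact this

/-! ### Small families and the removal of large parts -/

section Grid

variable {ι α : Type*} [MeasurableSpace α] {μ : ι → Measure α} {q : ℝ} {hq : 1 ≤ q}

/-- A finite convex combination of pairs `(n, g)` such that the `g` vanish on `D`, the mean of the
`q`-th powers of the `g` is at most `η`, and the mean of the values `φ n g` is at least `e`. -/
structure SmallFamily (φ : ℕ → gridSpace μ hq →ₗ[ℝ] ℝ) (D : ι → Set α) (e η : ℝ) (n₀ : ℕ) where
  /-- The index type. -/
  idx : Type
  /-- The index type is finite. -/
  fintype : Fintype idx
  /-- The weights. -/
  w : idx → ℝ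
  /-- The indices of the functionals. -/
  n : idx → ℕ
  /-- The elements of the space. -/
  g : idx → gridSpace μ hq
  w_nonneg : ∀ i, 0 ≤ w i
  sum_w : ∑ i, w i = 1
  le_n : ∀ i, n₀ ≤ n i
  norm_le : ∀ i, gridNorm μ hq (g i) ≤ 1
  eq_zero : ∀ i k, ∀ x ∈ D k, (g i).1 k x = 0
  sum_rpow_le : ∀ k x, ∑ i, w i * |(g i).1 k x| ^ q ≤ η
  sum_energy_le : ∀ k, ∑ i, w i * gridEnergy (g i) k ≤ η
  le_sum : e ≤ ∑ i, w i * φ (n i) (g i)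

attribute [instance] SmallFamily.fintype

theorem exists_le_of_le_sum_mul {I : Type*} [Fintype I] {w a : I → ℝ} (hw : ∀ i, 0 ≤ w i)
    (hw1 : ∑ i, w i = 1) {c : ℝ} (h : c ≤ ∑ i, w i * a i) : ∃ i, c ≤ a i := by
  by_contra! hc
  have h1 : ∑ i, w i * (a i - c) ≤ 0 :=
    Finset.sum_nonpos fun i _ => mul_nonpos_of_nonneg_of_nonpos (hw i) (by linarith [hc i])
  have h2 : ∑ i, w i * (a i - c) = ∑ i, w i * a i - c := by
    simp only [mul_sub, Finset.sum_sub_distrib, ← Finset.sum_mul, hw1, one_mul]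
  have h3 : ∀ i ∈ Finset.univ, w i * (a i - c) = 0 := by
    rw [← Finset.sum_eq_zero_iff_of_nonpos fun i _ =>
      mul_nonpos_of_nonneg_of_nonpos (hw i) (by linarith [hc i])]
    linarith
  have h4 : ∀ i, w i = 0 := fun i =>
    (mul_eq_zero.1 (h3 i (Finset.mem_univ i))).resolve_right (by linarith [hc i])
  simp [h4] at hw1

open Classical in
/-- The part of the grid where the family `g` is large, in value or in energy. -/
noncomputable def largePart (g : gridSpace μ hq) (r : ℝ) (k : ι) : Set α :=
  if r < gridEnergy g k then univ else {x | r < |g.1 k x| ^ q}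

theorem measurableSet_largePart (g : gridSpace μ hq) (r : ℝ) (k : ι) :
    MeasurableSet (largePart g r k) := by
  unfold largePart
  split_ifs
  · exact MeasurableSet.univ
  · exact measurableSet_lt measurable_const
      ((measurable_norm.comp (gridSpace.measurable g k)).pow_const q)

theorem le_of_mem_largePart {g : gridSpace μ hq} {r : ℝ} {k : ι} {x : α}
    (h : x ∈ largePart g r k) : r ≤ |g.1 k x| ^ q + gridEnergy g k := by
  unfold largePart at h
  have h1 : 0 ≤ |g.1 k x| ^ q := by positivity
  have h2 := gridEnergy_nonneg g k
  split_ifs at h with h'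
  · linarith
  · have : r < |g.1 k x| ^ q := h
    linarith

theorem largePart_eq_univ_or (g : gridSpace μ hq) (r : ℝ) (k : ι) :
    largePart g r k = univ ∨ gridEnergy g k ≤ r := by
  unfold largePart
  split_ifs with h
  · exact Or.inl rfl
  · exact Or.inr (not_lt.1 h)

/-- On the complement values are cut at `r ^ q⁻¹`, and coordinates of energy above `r` have been
removed altogether. -/
theorem gridNorm_restrict_largePart_compl_le (g : gridSpace μ hq) {r : ℝ} (hr : 0 ≤ r) :
    gridNorm μ hq (gridRestrict (fun k => (largePart g r k)ᶜ)
      (fun k => (measurableSet_largePart g r k).compl) g) ≤ r ^ q⁻¹ := by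
  have hq0 : 0 < q := by linarith
  have hrq : (r ^ q⁻¹) ^ q = r := Real.rpow_inv_rpow hr hq0.ne'
  refine (gridNorm_le_iff_energy (by positivity)).2 ⟨fun k x => ?_, fun k => ?_⟩
  · rw [gridRestrict_apply]
    by_cases h : x ∈ (largePart g r k)ᶜ
    · rw [indicator_of_mem h]
      unfold largePart at h
      split_ifs at h
      · simp at h
      · have h' : |g.1 k x| ^ q ≤ r := not_lt.1 h
        exact (Real.le_rpow_inv_iff_of_pos (abs_nonneg _) hr hq0).2 h'
    · rw [indicator_of_notMem h, abs_zero]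
      positivity
  · rw [hrq]
    rcases largePart_eq_univ_or g r k with h | h
    · have h0 : gridEnergy (gridRestrict (fun k => (largePart g r k)ᶜ)
          (fun k => (measurableSet_largePart g r k).compl) g) k
          ≤ 0 ^ q * gridEnergy g k := gridEnergy_le_of_abs_le le_rfl fun x => by
        rw [gridRestrict_apply, indicator_of_notMem (by simp [h])]
        simp
      rw [Real.zero_rpow hq0.ne', zero_mul] at h0
      exact h0.trans hr
    · have h0 := gridEnergy_le_of_abs_le zero_le_one (abs_gridRestrict_le (μ := μ) (hq := hq)
        (B := fun k => (largePart g r k)ᶜ) (fun k => (measurableSet_largePart g r k).compl) g k)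
      rw [Real.one_rpow, one_mul] at h0
      exact h0.trans h

/-- Removing the large part of one member of a small family: the remaining small families
persist. -/
theorem exists_removal_largePart (φ : ℕ → gridSpace μ hq →ₗ[ℝ] ℝ)
    (hφ : ∀ n g, |φ n g| ≤ gridNorm μ hq g) {D : ι → Set α} {e δ : ℝ} (he : 0 ≤ e) (hδ : 0 < δ)
    (hδ1 : δ ≤ 1) (hD : ∀ η > 0, ∀ n₀, Nonempty (SmallFamily φ D e η n₀)) (n₀ : ℕ) :
    ∃ (n : ℕ) (f : gridSpace μ hq) (B : ι → Set α), n₀ ≤ n ∧ gridNorm μ hq f ≤ 1 ∧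
      (∀ k x, x ∉ B k → f.1 k x = 0) ∧ (∀ k, ∀ x ∈ D k, f.1 k x = 0) ∧ e - δ ≤ φ n f ∧
      (∀ k, B k = univ ∨ gridEnergy f k ≤ δ) ∧
      ∀ η > 0, ∀ n₁, Nonempty (SmallFamily φ (fun k => D k ∪ B k) (e - δ) η n₁) := by
  have hq0 : 0 < q := by linarith
  -- `r ^ q⁻¹ ≤ δ / 4` controls the loss when a member is cut down to its large part; `(4 / δ) * (2
  -- * r) ≤ δ / 4` controls the penalty in the choice of the member below.
  obtain ⟨r, hr0, hrδ, hr1, hr2⟩ : ∃ r : ℝ, 0 < r ∧ r ≤ δ ∧ r ^ q⁻¹ ≤ δ / 4 ∧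
      (4 / δ) * (2 * r) ≤ δ / 4 := by
    refine ⟨min ((δ / 4) ^ q) (δ ^ 2 / 32), by positivity, ?_, ?_, ?_⟩
    · refine (min_le_right _ _).trans ?_
      nlinarith
    · calc (min ((δ / 4) ^ q) (δ ^ 2 / 32)) ^ q⁻¹ ≤ ((δ / 4) ^ q) ^ q⁻¹ :=
            Real.rpow_le_rpow (by positivity) (min_le_left _ _) (by positivity)
        _ = δ / 4 := Real.rpow_rpow_inv (by positivity) hq0.ne'
    · calc (4 / δ) * (2 * min ((δ / 4) ^ q) (δ ^ 2 / 32)) ≤ (4 / δ) * (2 * (δ ^ 2 / 32)) := by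
            gcongr; exact min_le_right _ _
        _ = δ / 4 := by field_simp; ring
  -- With both means at most `r ^ 2`, Markov's inequality bounds by `2 * r` the total weight of the
  -- members whose large part contains a given point.
  obtain ⟨F⟩ := hD (r ^ 2) (by positivity) n₀
  set B : F.idx → ι → Set α := fun i => largePart (F.g i) r with hBdef
  have hB : ∀ i k, MeasurableSet (B i k) := fun i => measurableSet_largePart (F.g i) r
  have hmult : ∀ k x, ∑ i, F.w i * (B i k).indicator 1 x ≤ 2 * r := by
    intro k x
    have h1 : ∑ i, r * (F.w i * (B i k).indicator 1 x)
        ≤ ∑ i, (F.w i * |(F.g i).1 k x| ^ q + F.w i * gridEnergy (F.g i) k) := by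
      refine Finset.sum_le_sum fun i _ => ?_
      rw [← mul_add, mul_left_comm]
      refine mul_le_mul_of_nonneg_left ?_ (F.w_nonneg i)
      by_cases h : x ∈ B i k
      · rw [indicator_of_mem h, Pi.one_apply, mul_one]
        exact le_of_mem_largePart h
      · rw [indicator_of_notMem h, mul_zero]
        have := gridEnergy_nonneg (F.g i) k
        positivity
    rw [← Finset.mul_sum, Finset.sum_add_distrib] at h1
    have h2 := F.sum_rpow_le k x
    have h3 := F.sum_energy_le k
    nlinarith
  set f : F.idx → gridSpace μ hq := fun i => gridRestrict (B i) (hB i) (F.g i) with hf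
  have hφf : ∀ i, φ (F.n i) (F.g i) - δ / 4 ≤ φ (F.n i) (f i) := by
    intro i
    have h1 := congrArg (φ (F.n i)) (gridRestrict_add_compl (hB i) (F.g i))
    rw [map_add] at h1
    have h2 := (le_abs_self _).trans ((hφ (F.n i) _).trans
      ((gridNorm_restrict_largePart_compl_le (F.g i) hr0.le).trans hr1))
    change φ (F.n i) (f i) + _ = _ at h1
    linarith
  have hfam : ∀ s : ℕ, Nonempty (SmallFamily φ D e (1 / ((s : ℝ) + 1)) s) := fun s =>
    hD _ (by positivity) s
  set E : ∀ s : ℕ, SmallFamily φ D e (1 / ((s : ℝ) + 1)) s := fun s => (hfam s).some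
  -- `err i s` is what the `s`-th family loses when the large part of the `i`-th member of `F` is
  -- removed. The `F.w`-mean of `|err i s|` is at most `2 * r`: by the multiplicity bound, the
  -- signed weighted sum of the restrictions of one `g` has norm at most `2 * r`.
  set err : F.idx → ℕ → ℝ := fun i s =>
    ∑ l, (E s).w l * φ ((E s).n l) (gridRestrict (B i) (hB i) ((E s).g l)) with herr
  have hsum_err : ∀ s, ∑ i, F.w i * |err i s| ≤ 2 * r := by
    intro s
    set σ : F.idx → ℝ := fun i => SignType.sign (err i s) with hσ
    have hσ1 : ∀ i, |σ i| ≤ 1 := fun i => by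
      simp only [hσ]
      rcases lt_trichotomy (err i s) 0 with h | h | h <;> simp [h]
    have h1 : ∑ i, F.w i * |err i s| = ∑ l, (E s).w l * φ ((E s).n l)
        (∑ i, (F.w i * σ i) • gridRestrict (B i) (hB i) ((E s).g l)) := by
      have h2 : ∀ i, F.w i * |err i s| = ∑ l, (F.w i * σ i) *
          ((E s).w l * φ ((E s).n l) (gridRestrict (B i) (hB i) ((E s).g l))) := fun i => by
        rw [← Finset.mul_sum, mul_assoc]
        congr 1
        exact (sign_mul_self (err i s)).symm
      simp only [h2, map_sum, map_smul, smul_eq_mul, Finset.mul_sum]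
      rw [Finset.sum_comm]
      refine Finset.sum_congr rfl fun l _ => Finset.sum_congr rfl fun i _ => by ring
    have h3 : ∀ l, φ ((E s).n l)
        (∑ i, (F.w i * σ i) • gridRestrict (B i) (hB i) ((E s).g l)) ≤ 2 * r := by
      intro l
      refine (le_abs_self _).trans ((hφ _ _).trans ?_)
      refine (gridNorm_le_of_abs_le (c := 2 * r) (g := (E s).g l) (by positivity)
        fun k x => ?_).trans (mul_le_of_le_one_right (by positivity) ((E s).norm_le l))
      have h4 : (∑ i, (F.w i * σ i) • gridRestrict (B i) (hB i) ((E s).g l)).1 k x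
          = ∑ i, (F.w i * σ i) * (B i k).indicator (((E s).g l).1 k) x := by
        rw [Submodule.coe_sum, Finset.sum_apply, Finset.sum_apply]
        rfl
      rw [h4]
      refine (Finset.abs_sum_le_sum_abs _ _).trans ?_
      calc ∑ i, |F.w i * σ i * (B i k).indicator (((E s).g l).1 k) x|
          ≤ ∑ i, F.w i * (B i k).indicator 1 x * |((E s).g l).1 k x| := by
            refine Finset.sum_le_sum fun i _ => ?_
            rw [abs_mul, abs_mul, abs_of_nonneg (F.w_nonneg i), mul_assoc, mul_assoc]
            refine mul_le_mul_of_nonneg_left ?_ (F.w_nonneg i)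
            by_cases h : x ∈ B i k
            · rw [indicator_of_mem h, indicator_of_mem h, Pi.one_apply]
              exact mul_le_mul_of_nonneg_right (hσ1 i) (abs_nonneg _)
            · rw [indicator_of_notMem h, indicator_of_notMem h]; simp
        _ = (∑ i, F.w i * (B i k).indicator 1 x) * |((E s).g l).1 k x| := by
            rw [Finset.sum_mul]
        _ ≤ 2 * r * |((E s).g l).1 k x| :=
            mul_le_mul_of_nonneg_right (hmult k x) (abs_nonneg _)
    rw [h1]
    calc _ ≤ ∑ l, (E s).w l * (2 * r) :=
          Finset.sum_le_sum fun l _ => mul_le_mul_of_nonneg_left (h3 l) ((E s).w_nonneg l)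
      _ = 2 * r := by rw [← Finset.sum_mul, (E s).sum_w, one_mul]
  -- Averaging with the penalty `4 / δ` finds, for each `s`, a member with both a large value and a
  -- small loss. `F` being finite, one `i` serves infinitely many `s`, hence arbitrarily small `η`
  -- and arbitrarily late `n₁`.
  have hpick : ∀ s, ∃ i, e - δ / 2 ≤ φ (F.n i) (f i) - (4 / δ) * |err i s| := by
    intro s
    refine exists_le_of_le_sum_mul F.w_nonneg F.sum_w ?_
    have h1 : ∑ i, F.w i * (φ (F.n i) (F.g i) - δ / 4) ≤ ∑ i, F.w i * φ (F.n i) (f i) :=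
      Finset.sum_le_sum fun i _ => mul_le_mul_of_nonneg_left (hφf i) (F.w_nonneg i)
    have h2 : ∑ i, F.w i * (φ (F.n i) (F.g i) - δ / 4)
        = ∑ i, F.w i * φ (F.n i) (F.g i) - δ / 4 := by
      simp only [mul_sub, Finset.sum_sub_distrib, ← Finset.sum_mul, F.sum_w, one_mul]
    have h3 : ∑ i, F.w i * (φ (F.n i) (f i) - (4 / δ) * |err i s|)
        = ∑ i, F.w i * φ (F.n i) (f i) - (4 / δ) * ∑ i, F.w i * |err i s| := by
      rw [Finset.mul_sum, ← Finset.sum_sub_distrib]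
      exact Finset.sum_congr rfl fun i _ => by ring
    have h4 : (4 / δ) * ∑ i, F.w i * |err i s| ≤ (4 / δ) * (2 * r) := by
      have := hsum_err s
      gcongr
    have h5 := F.le_sum
    linarith
  choose pick hpick using hpick
  obtain ⟨i, hi⟩ := Finite.exists_infinite_fiber pick
  rw [infinite_coe_iff] at hi
  have hfn : gridNorm μ hq (f i) ≤ 1 := by
    have := gridNorm_le_of_abs_le zero_le_one (abs_gridRestrict_le (hB i) (F.g i))
    rw [one_mul] at this
    exact this.trans (F.norm_le i)
  refine ⟨F.n i, f i, B i, F.le_n i, hfn, fun k x hx => indicator_of_notMem hx _, fun k x hx => ?_,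
    ?_, fun k => ?_, fun η hη n₁ => ?_⟩
  · have h0 := F.eq_zero i k x hx
    change (B i k).indicator ((F.g i).1 k) x = 0
    by_cases h : x ∈ B i k
    · rw [indicator_of_mem h, h0]
    · rw [indicator_of_notMem h]
  · obtain ⟨s, hs⟩ := hi.nonempty
    have h1 := hpick s
    rw [show pick s = i from hs] at h1
    have h2 : 0 ≤ (4 / δ) * |err i s| := by positivity
    linarith
  · refine (largePart_eq_univ_or (F.g i) r k).imp_right fun h => ?_
    have h0 := gridEnergy_le_of_abs_le zero_le_one (abs_gridRestrict_le (hB i) (F.g i) k)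
    rw [Real.one_rpow, one_mul] at h0
    exact (h0.trans h).trans hrδ
  · obtain ⟨m, hm⟩ := exists_nat_gt (max (1 / η) n₁)
    obtain ⟨s, hs, hms⟩ := hi.exists_gt m
    have hms' : (m : ℝ) < s := by exact_mod_cast hms
    have hsη : 1 / ((s : ℝ) + 1) ≤ η := by
      have h1 : 1 / η < s := (le_max_left _ _).trans_lt (hm.trans hms')
      rw [div_le_iff₀ (by positivity)]
      rw [div_lt_iff₀ hη] at h1
      linarith
    have hsn : n₁ ≤ s := by
      have : (n₁ : ℝ) < s := (le_max_right _ _).trans_lt (hm.trans hms')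
      exact_mod_cast this.le
    have herr_le : err i s ≤ δ := by
      have h1 := hpick s
      rw [show pick s = i from hs] at h1
      have h2 := (le_abs_self _).trans ((hφ (F.n i) (f i)).trans hfn)
      have h3 : (4 / δ) * |err i s| ≤ 2 := by linarith
      have h4 : |err i s| ≤ δ := by
        rw [div_mul_eq_mul_div, div_le_iff₀ hδ] at h3
        linarith [abs_nonneg (err i s)]
      exact (le_abs_self _).trans h4
    set g' : (E s).idx → gridSpace μ hq := fun l =>
      gridRestrict (fun k => (B i k)ᶜ) (fun k => (hB i k).compl) ((E s).g l) with hg'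
    have habs : ∀ l k x, |(g' l).1 k x| ≤ 1 * |((E s).g l).1 k x| := fun l =>
      abs_gridRestrict_le (fun k => (hB i k).compl) ((E s).g l)
    refine ⟨⟨(E s).idx, (E s).fintype, (E s).w, (E s).n, g', (E s).w_nonneg, (E s).sum_w,
      fun l => hsn.trans ((E s).le_n l), fun l => ?_, fun l k x hx => ?_, fun k x => ?_, fun k => ?_,
      ?_⟩⟩
    · have := gridNorm_le_of_abs_le zero_le_one (habs l)
      rw [one_mul] at this
      exact this.trans ((E s).norm_le l)
    · change (B i k)ᶜ.indicator (((E s).g l).1 k) x = 0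
      rcases hx with hx | hx
      · by_cases h : x ∈ (B i k)ᶜ
        · rw [indicator_of_mem h, (E s).eq_zero l k x hx]
        · rw [indicator_of_notMem h]
      · exact indicator_of_notMem (by simpa using hx) _
    · refine (Finset.sum_le_sum fun l _ => mul_le_mul_of_nonneg_left ?_ ((E s).w_nonneg l)).trans
        (((E s).sum_rpow_le k x).trans hsη)
      have := habs l k x
      rw [one_mul] at this
      exact Real.rpow_le_rpow (abs_nonneg _) this hq0.le
    · refine (Finset.sum_le_sum fun l _ => mul_le_mul_of_nonneg_left ?_ ((E s).w_nonneg l)).trans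
        (((E s).sum_energy_le k).trans hsη)
      have := gridEnergy_le_of_abs_le zero_le_one (habs l k)
      rwa [Real.one_rpow, one_mul] at this
    · have h1 : ∀ l, φ ((E s).n l) (g' l) = φ ((E s).n l) ((E s).g l)
          - φ ((E s).n l) (gridRestrict (B i) (hB i) ((E s).g l)) := fun l => by
        have h2 := congrArg (φ ((E s).n l)) (gridRestrict_add_compl (hB i) ((E s).g l))
        rw [map_add] at h2
        change _ + φ ((E s).n l) (g' l) = _ at h2
        linarith
      simp only [h1, mul_sub, Finset.sum_sub_distrib]
      have h2 := (E s).le_sum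
      change _ ≤ _ - err i s
      linarith

end Grid

/-! ### The dichotomy: disjoint vectors or a smooth majorant -/

section Grid

variable {ι α : Type*} [MeasurableSpace α] {μ : ι → Measure α} {q : ℝ} {hq : 1 ≤ q}

theorem exists_forall_ne_eq_zero {u : ℕ → ℝ} (hu : ∀ i j, i ≠ j → u i = 0 ∨ u j = 0) :
    ∃ i, ∀ j, j ≠ i → u j = 0 := by
  by_cases h : ∃ i, u i ≠ 0
  · obtain ⟨i, hi⟩ := h
    exact ⟨i, fun j hj => (hu j i hj).resolve_right hi⟩
  · push Not at h
    exact ⟨0, fun j _ => h j⟩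

/-- Bounded sequences act on a disjoint sequence with uniformly bounded total energies. -/
theorem exists_disjoint_sum (f : ℕ → gridSpace μ hq) (hf : ∀ j, gridNorm μ hq (f j) ≤ 1)
    (hdisj : ∀ k x i j, i ≠ j → (f i).1 k x = 0 ∨ (f j).1 k x = 0)
    (hen : ∀ k n, ∑ j ∈ Finset.range n, gridEnergy (f j) k ≤ 2) :
    ∃ S : BoundedContinuousFunction ℕ ℝ →ₗ[ℝ] gridSpace μ hq,
      (∀ a, gridNorm μ hq (S a) ≤ 2 * ‖a‖) ∧ ∀ j, S (boundedIndicator {j}) = f j := by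
  have hq0 : 0 < q := by linarith
  have hsumm : ∀ (a : BoundedContinuousFunction ℕ ℝ) k x,
      Summable fun j => a j * (f j).1 k x := by
    intro a k x
    obtain ⟨i, hi⟩ := exists_forall_ne_eq_zero (hdisj k x)
    refine summable_of_ne_finset_zero (s := {i}) fun j hj => ?_
    rw [hi j (by simpa using hj), mul_zero]
  have hsingle : ∀ (a : BoundedContinuousFunction ℕ ℝ) k x, ∃ i,
      ∑' j, a j * (f j).1 k x = a i * (f i).1 k x := by
    intro a k x
    obtain ⟨i, hi⟩ := exists_forall_ne_eq_zero (hdisj k x)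
    exact ⟨i, tsum_eq_single i fun j hj => by rw [hi j hj, mul_zero]⟩
  have hmeas : ∀ (a : BoundedContinuousFunction ℕ ℝ) k,
      Measurable fun x => ∑' j, a j * (f j).1 k x := by
    intro a k
    refine measurable_of_tendsto_metrizable (f := fun n x => ∑ j ∈ Finset.range n, a j * (f j).1 k x)
      (fun n => Finset.measurable_fun_sum _ fun j _ => (gridSpace.measurable (f j) k).const_mul _) ?_
    rw [tendsto_pi_nhds]
    exact fun x => (hsumm a k x).hasSum.tendsto_sum_nat
  have habs : ∀ (a : BoundedContinuousFunction ℕ ℝ) k x,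
      |∑' j, a j * (f j).1 k x| ≤ 2 * ‖a‖ := by
    intro a k x
    obtain ⟨i, hi⟩ := hsingle a k x
    rw [hi, abs_mul]
    have h1 : |a i| ≤ ‖a‖ := a.norm_coe_le_norm i
    have h2 := (abs_le_gridNorm (f i) k x).trans (hf i)
    nlinarith [abs_nonneg (a i), abs_nonneg ((f i).1 k x), norm_nonneg a]
  have hint : ∀ (a : BoundedContinuousFunction ℕ ℝ) k,
      ∫⁻ x, ‖∑' j, a j * (f j).1 k x‖ₑ ^ q ∂μ k ≤ ENNReal.ofReal ((2 * ‖a‖) ^ q) := by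
    intro a k
    -- At each point at most one summand is nonzero, so the `q`-th power of the sum is at most the
    -- sum of the `q`-th powers; the total energy `2` is absorbed by `2 ≤ 2 ^ q`.
    calc ∫⁻ x, ‖∑' j, a j * (f j).1 k x‖ₑ ^ q ∂μ k
        ≤ ∫⁻ x, ∑' j, ENNReal.ofReal (‖a‖ ^ q) * ‖(f j).1 k x‖ₑ ^ q ∂μ k := by
          refine lintegral_mono fun x => ?_
          obtain ⟨i, hi⟩ := hsingle a k x
          simp only [hi]
          refine le_trans ?_ (ENNReal.le_tsum i)
          rw [enorm_mul, ENNReal.mul_rpow_of_nonneg _ _ hq0.le,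
            ← ENNReal.ofReal_rpow_of_nonneg (norm_nonneg a) hq0.le]
          gcongr
          rw [Real.enorm_eq_ofReal_abs]
          exact ENNReal.ofReal_le_ofReal (a.norm_coe_le_norm i)
      _ = ∑' j, ENNReal.ofReal (‖a‖ ^ q) * ENNReal.ofReal (gridEnergy (f j) k) := by
          rw [lintegral_tsum fun j =>
            (((gridSpace.measurable (f j) k).enorm.pow_const q).const_mul _).aemeasurable]
          simp only [ofReal_gridEnergy, lintegral_const_mul' _ _ ENNReal.ofReal_ne_top]
      _ ≤ ENNReal.ofReal (‖a‖ ^ q) * ENNReal.ofReal 2 := by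
          rw [ENNReal.tsum_mul_left]
          gcongr
          refine ENNReal.tsum_le_of_sum_range_le fun n => ?_
          rw [← ENNReal.ofReal_sum_of_nonneg fun j _ => gridEnergy_nonneg (f j) k]
          exact ENNReal.ofReal_le_ofReal (hen k n)
      _ ≤ ENNReal.ofReal ((2 * ‖a‖) ^ q) := by
          rw [← ENNReal.ofReal_mul (by positivity)]
          refine ENNReal.ofReal_le_ofReal ?_
          rw [Real.mul_rpow (by norm_num) (norm_nonneg a), mul_comm]
          gcongr
          calc (2 : ℝ) = 2 ^ (1 : ℝ) := (Real.rpow_one 2).symm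
            _ ≤ 2 ^ q := Real.rpow_le_rpow_of_exponent_le (by norm_num) hq
  refine ⟨{ toFun := fun a => ⟨fun k x => ∑' j, a j * (f j).1 k x,
              mem_gridSpace (by positivity) (hmeas a) (habs a) (hint a)⟩
            map_add' := fun a b => ?_
            map_smul' := fun c a => ?_ }, fun a => ?_, fun j => ?_⟩
  · ext k x
    change ∑' j, (a j + b j) * (f j).1 k x = ∑' j, a j * (f j).1 k x + ∑' j, b j * (f j).1 k x
    simp only [add_mul]
    exact (hsumm a k x).tsum_add (hsumm b k x)
  · ext k x
    change ∑' j, (c * a j) * (f j).1 k x = c * ∑' j, a j * (f j).1 k x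
    simp only [mul_assoc]
    exact tsum_mul_left
  · exact (gridNorm_le_iff (by positivity)).2 ⟨habs a, hint a⟩
  · ext k x
    change ∑' i, boundedIndicator {j} i * (f i).1 k x = (f j).1 k x
    rw [tsum_eq_single j]
    · simp [boundedIndicator_apply]
    · intro i hi
      simp [boundedIndicator_apply, hi]

/-- A sliding hump: large parts are removed one after the other while small families persist on what
is left. This yields disjoint vectors on which the functionals are at least `ε / 2`. In a coordinate
`k`, the `j`-th energy is at most `δ j` until the first large part that fills the coordinate; that
vector has energy at most `1` and all later ones vanish there. So the total energy is at most `2`,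
`ℓ∞` acts on the sequence, and Phillips' lemma is contradicted. -/
theorem not_forall_nonempty_smallFamily (φ : ℕ → gridSpace μ hq →ₗ[ℝ] ℝ)
    (hφ : ∀ n g, |φ n g| ≤ gridNorm μ hq g) (hφ0 : ∀ g, Tendsto (fun n => φ n g) atTop (𝓝 0))
    {ε : ℝ} (hε : 0 < ε) (hε1 : ε ≤ 1) :
    ¬ ∀ η > 0, ∀ n₀, Nonempty (SmallFamily φ (fun _ => ∅) ε η n₀) := by
  intro hfam
  -- The thresholds decrease from `ε` towards `ε / 2`, step `j` costing `δ j = e j - e (j + 1)`.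
  set e : ℕ → ℝ := fun j => ε / 2 + ε / 2 * (1 / 2) ^ j with he
  set δ : ℕ → ℝ := fun j => ε / 4 * (1 / 2) ^ j with hδ
  have hδ0 : ∀ j, 0 < δ j := fun j => by positivity
  have hpow1 : ∀ j : ℕ, ((1 : ℝ) / 2) ^ j ≤ 1 := fun j => pow_le_one₀ (by norm_num) (by norm_num)
  have hδ1 : ∀ j, δ j ≤ 1 := fun j => by
    have := hpow1 j
    have : 0 ≤ ((1 : ℝ) / 2) ^ j := by positivity
    simp only [hδ]
    nlinarith
  have hesucc : ∀ j, e j - δ j = e (j + 1) := fun j => by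
    simp only [he, hδ, pow_succ]; ring
  have hstep := fun (j : ℕ) (D : {D : ι → Set α //
      ∀ η > 0, ∀ n₀, Nonempty (SmallFamily φ D (e j) η n₀)}) =>
    exists_removal_largePart φ hφ (show 0 ≤ e j by positivity) (hδ0 j) (hδ1 j) D.2 j
  choose n f B hn hfn hfB hfD hφf hBE hnext using hstep
  have hnext' : ∀ j D, ∀ η > 0, ∀ n₁,
      Nonempty (SmallFamily φ (fun k => D.1 k ∪ B j D k) (e (j + 1)) η n₁) := fun j D => by
    rw [← hesucc]; exact hnext j D
  set st : ∀ j : ℕ, {D : ι → Set α // ∀ η > 0, ∀ n₀, Nonempty (SmallFamily φ D (e j) η n₀)} :=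
    fun j => Nat.rec ⟨fun _ => ∅, by
      have : e 0 = ε := by simp only [he, pow_zero]; ring
      rw [this]; exact hfam⟩ (fun j D => ⟨fun k => D.1 k ∪ B j D k, hnext' j D⟩) j with hst
  have hst_succ : ∀ j k, (st (j + 1)).1 k = (st j).1 k ∪ B j (st j) k := fun j k => rfl
  have hst_mono : ∀ k, Monotone fun j => (st j).1 k := fun k =>
    monotone_nat_of_le_succ fun j => by rw [hst_succ]; exact subset_union_left
  have hBst : ∀ {i j} k, i < j → B i (st i) k ⊆ (st j).1 k := fun {i j} k hij =>
    (subset_union_right.trans (hst_succ i k).ge).trans (hst_mono k hij)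
  set F : ℕ → gridSpace μ hq := fun j => f j (st j) with hF
  have hlt : ∀ k x i j, i < j → (F i).1 k x = 0 ∨ (F j).1 k x = 0 := by
    intro k x i j hij
    by_cases hx : x ∈ B i (st i) k
    · exact Or.inr (hfD j (st j) k x (hBst k hij hx))
    · exact Or.inl (hfB i (st i) k x hx)
  have hdisj : ∀ k x i j, i ≠ j → (F i).1 k x = 0 ∨ (F j).1 k x = 0 := by
    intro k x i j hij
    rcases hij.lt_or_gt with h | h
    · exact hlt k x i j h
    · exact (hlt k x j i h).symm
  have hzero : ∀ k i j, i < j → B i (st i) k = univ → gridEnergy (F j) k ≤ 0 := by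
    intro k i j hij hB
    have h0 : gridEnergy (F j) k ≤ 0 ^ q * gridEnergy (F j) k :=
      gridEnergy_le_of_abs_le le_rfl fun x => by
        rw [hfD j (st j) k x (hBst k hij (hB ▸ mem_univ x))]; simp
    rwa [Real.zero_rpow (by linarith), zero_mul] at h0
  have hEone : ∀ k j, gridEnergy (F j) k ≤ 1 := fun k j =>
    (gridEnergy_le (F j) k).trans (Real.rpow_le_one (apply_nonneg _ _) (hfn j (st j)) (by linarith))
  have hgeom : ∀ m : ℕ, ∑ j ∈ Finset.range m, δ j ≤ 1 := by
    intro m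
    simp only [hδ, ← Finset.mul_sum]
    have h1 : ∑ j ∈ Finset.range m, ((1 : ℝ) / 2) ^ j ≤ 2 := by
      have := sum_geometric_two_le m
      simpa using this
    nlinarith
  have hen : ∀ k m, ∑ j ∈ Finset.range m, gridEnergy (F j) k ≤ 2 := by
    intro k m
    by_cases hex : ∃ i, B i (st i) k = univ
    · classical
      set i₀ := Nat.find hex
      have hi₀ : B i₀ (st i₀) k = univ := Nat.find_spec hex
      have hterm : ∀ j ∈ Finset.range m, gridEnergy (F j) k ≤ δ j + if j = i₀ then 1 else 0 := by
        intro j _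
        rcases lt_trichotomy j i₀ with h | h | h
        · rw [if_neg h.ne, add_zero]
          exact (hBE j (st j) k).resolve_left (Nat.find_min hex h)
        · rw [if_pos h]
          linarith [hEone k j, hδ0 j]
        · rw [if_neg h.ne', add_zero]
          exact (hzero k i₀ j h hi₀).trans (hδ0 j).le
      refine (Finset.sum_le_sum hterm).trans ?_
      rw [Finset.sum_add_distrib, Finset.sum_ite_eq']
      have := hgeom m
      split_ifs <;> linarith
    · push Not at hex
      refine (Finset.sum_le_sum fun j _ => (hBE j (st j) k).resolve_left (hex j)).trans ?_
      linarith [hgeom m]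
  obtain ⟨S, hS, hSe⟩ := exists_disjoint_sum F (fun j => hfn j (st j)) hdisj hen
  refine not_forall_le_apply_boundedIndicator (C := 2) (half_pos hε)
    (fun j => (φ (n j (st j))).comp S)
    (fun j a => (le_abs_self _).trans ((hφ _ _).trans (hS a))) (fun a => ?_) (fun j => ?_)
  · exact (hφ0 (S a)).comp (tendsto_atTop_mono (fun j => hn j (st j)) tendsto_id)
  · rw [LinearMap.comp_apply, hSe]
    refine le_trans ?_ (hφf j (st j))
    rw [hesucc]
    simp only [he]
    have : 0 ≤ ε / 2 * (1 / 2) ^ (j + 1) := by positivity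
    linarith

/-- If small families fail to exist for some `η` and `n₀`, every convex combination of powers
`gridPower g`, over unit vectors with `φ n g ≥ ε'` and `n ≥ n₀`, is at least `η` somewhere.
Separation gives `ν` and the smooth majorant `p`. For a vector `g` of nonzero norm, either `φ n g ≤
ε' N g`, or the normalised vector has `p ≥ 1`, so that `φ n g ≤ N g ≤ p g`. -/
theorem exists_mem_convexHull_le_gridNorm (hq1 : 1 < q) (hq2 : q ≤ 2)
    (φ : ℕ → gridSpace μ hq →ₗ[ℝ] ℝ)
    (hφ : ∀ n g, |φ n g| ≤ gridNorm μ hq g) (hφ0 : ∀ g, Tendsto (fun n => φ n g) atTop (𝓝 0))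
    {ε : ℝ} (hε : 0 < ε) :
    ∃ θ ∈ convexHull ℝ (range φ), ∀ g, |θ g| ≤ ε * gridNorm μ hq g := by
  have hq0 : 0 < q := by linarith
  -- The division by `4` offsets the factor `4 * ε` of `exists_mem_convexHull_small_of_smooth`; the
  -- cap at `1` is needed for the extraction of disjoint vectors.
  set ε' := min (ε / 4) 1 with hε'
  have hε'0 : 0 < ε' := by positivity
  have hnot := not_forall_nonempty_smallFamily φ hφ hφ0 hε'0 (min_le_right _ _)
  push Not at hnot
  obtain ⟨η, hη, n₀, hemp⟩ := hnot
  set G : Set (lp (fun _ : (ι × α) ⊕ ι => ℝ) ∞) :=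
    {b | ∃ n ≥ n₀, ∃ g : gridSpace μ hq, gridNorm μ hq g ≤ 1 ∧ ε' ≤ φ n g ∧ gridPower g = b} with hG
  obtain ⟨ν, hν0, hνG⟩ := exists_positive_functional G hη (by
    intro b hb
    by_contra! hlt
    obtain ⟨I, hI, w, z, hw, hw1, hz, rfl⟩ := mem_convexHull_iff_exists_fintype.1 hb
    choose n hn g hg hφg hgz using hz
    have hcoe : ∀ j, (∑ i, w i • z i : lp (fun _ : (ι × α) ⊕ ι => ℝ) ∞) j
        = ∑ i, w i * gridPower (g i) j := fun j => by
      rw [lp.coeFn_sum, Finset.sum_apply]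
      refine Finset.sum_congr rfl fun i _ => ?_
      rw [hgz, lp.coeFn_smul, Pi.smul_apply, smul_eq_mul]
    refine hemp.false ⟨I, hI, w, n, g, hw, hw1, hn, hg, fun _ _ _ h => absurd h (notMem_empty _),
      fun k x => ?_, fun k => ?_, ?_⟩
    · have := (hlt (Sum.inl (k, x))).le
      rwa [hcoe] at this
    · have := (hlt (Sum.inr k)).le
      rwa [hcoe] at this
    · calc ε' = ∑ i, w i * ε' := by rw [← Finset.sum_mul, hw1, one_mul]
        _ ≤ _ := Finset.sum_le_sum fun i _ => mul_le_mul_of_nonneg_left (hφg i) (hw i))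
  have hνp : ∀ g : gridSpace μ hq, 0 ≤ ν (gridPower g) := fun g => hν0 _ (gridPower_nonneg g)
  set p : gridSpace μ hq → ℝ := fun g => ν (gridPower g) ^ q⁻¹ with hp
  have hp0 : ∀ g, 0 ≤ p g := fun g => Real.rpow_nonneg (hνp g) _
  have hpq : ∀ g, p g ^ q = ν (gridPower g) := fun g => Real.rpow_inv_rpow (hνp g) hq0.ne'
  have hps : ∀ (c : ℝ) g, p (c • g) = |c| * p g := fun c g => by
    simp only [hp, gridPower_smul, map_smul, smul_eq_mul]
    rw [Real.mul_rpow (by positivity) (hνp g), Real.rpow_rpow_inv (abs_nonneg c) hq0.ne']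
  have hN0 : ∀ g, 0 ≤ gridNorm μ hq g := fun g => apply_nonneg _ g
  have hdom : ∀ n ≥ n₀, ∀ g, |φ n g| ≤ p g + ε' * gridNorm μ hq g := by
    intro n hn g
    have hpos : ∀ g, φ n g ≤ p g + ε' * gridNorm μ hq g := by
      intro g
      rcases (hN0 g).eq_or_lt with h0 | h0
      · have := (le_abs_self _).trans (hφ n g)
        rw [← h0] at this ⊢
        linarith [hp0 g]
      rcases le_or_gt (φ n g) (ε' * gridNorm μ hq g) with h | h
      · linarith [hp0 g]
      set c := (gridNorm μ hq g)⁻¹ with hc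
      have hc0 : 0 < c := by positivity
      have hN1 : gridNorm μ hq (c • g) = 1 := by
        rw [map_smul_eq_mul, Real.norm_eq_abs, abs_of_pos hc0, hc, inv_mul_cancel₀ h0.ne']
      have h1 : 1 ≤ ν (gridPower (c • g)) := hνG _ ⟨n, hn, c • g, hN1.le, by
        rw [map_smul, smul_eq_mul, hc, inv_mul_eq_div, le_div_iff₀ h0]
        exact h.le, rfl⟩
      have h2 : 1 ≤ p (c • g) := Real.one_le_rpow h1 (by positivity)
      rw [hps, abs_of_pos hc0, hc, inv_mul_eq_div, le_div_iff₀ h0, one_mul] at h2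
      have h3 := (le_abs_self _).trans (hφ n g)
      have : 0 ≤ ε' * gridNorm μ hq g := by positivity
      linarith
    rw [abs_le']
    refine ⟨hpos g, ?_⟩
    have h1 := hpos (-g)
    have h2 : p (-g) = p g := by
      have h3 : (-1 : ℝ) • g = -g := Subtype.ext (neg_one_smul ℝ g.1)
      have := hps (-1) g
      rwa [h3, abs_neg, abs_one, one_mul] at this
    rwa [map_neg (φ n), h2, map_neg_eq_map (gridNorm μ hq)] at h1
  obtain ⟨θ, hθ, hθb⟩ := exists_mem_convexHull_small_of_smooth (gridNorm μ hq) p hq1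
    (show 0 < ‖ν‖ ^ q⁻¹ + 1 by positivity) hε'0 hp0
    (fun g => by
      calc p g ≤ (‖ν‖ * gridNorm μ hq g ^ q) ^ q⁻¹ := by
            refine Real.rpow_le_rpow (hνp g) ?_ (by positivity)
            refine (le_abs_self _).trans ((ν.le_opNorm _).trans ?_)
            have := norm_gridPower_le g
            gcongr
        _ = ‖ν‖ ^ q⁻¹ * gridNorm μ hq g := by
            rw [Real.mul_rpow (norm_nonneg _) (by have := hN0 g; positivity),
              Real.rpow_rpow_inv (hN0 g) hq0.ne']
        _ ≤ _ := by
            have := hN0 g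
            gcongr
            linarith)
    hps
    (fun f g => by
      rw [hpq, hpq, hpq, hpq, ← map_add, ← map_add, ← sub_nonneg]
      have : 2 * ν (gridPower f + gridPower g) = ν ((2 : ℝ) • (gridPower f + gridPower g)) := by
        rw [map_smul, smul_eq_mul]
      rw [this, ← map_sub]
      refine hν0 _ fun j => ?_
      have := gridPower_add_add_sub_le hq2 f g j
      rw [lp.coeFn_sub, Pi.sub_apply, lp.coeFn_smul, Pi.smul_apply, lp.coeFn_add, lp.coeFn_add,
        Pi.add_apply, Pi.add_apply, smul_eq_mul]
      linarith)
    (fun n => φ (n + n₀)) (fun g => (hφ0 g).comp (tendsto_add_atTop_nat n₀))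
    (fun n g => hdom _ (Nat.le_add_left _ _) g)
  refine ⟨θ, convexHull_mono (range_comp_subset_range (fun n => n + n₀) φ) hθ, fun g => (hθb g).trans ?_⟩
  have h1 : 4 * ε' ≤ ε := by
    have := min_le_left (ε / 4) 1
    linarith
  exact mul_le_mul_of_nonneg_right h1 (hN0 g)

end Grid

/-- Weak-* convergent sequences converge weakly in the dual of a quotient of `gridSpace`. -/
theorem tendsto_weak_of_grid_quotient {ι α : Type*} [MeasurableSpace α] {μ : ι → Measure α} {q : ℝ}
    {hq : 1 ≤ q} (hq1 : 1 < q) (hq2 : q ≤ 2) {X : Type*} [NormedAddCommGroup X] [NormedSpace ℝ X]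
    [CompleteSpace X] (Q : gridSpace μ hq →ₗ[ℝ] X) {C : ℝ}
    (hQ : ∀ g, ‖Q g‖ ≤ C * gridNorm μ hq g)
    (hsurj : ∀ x : X, ‖x‖ ≤ 1 → ∃ g, gridNorm μ hq g ≤ 1 ∧ Q g = x)
    (φ : ℕ → StrongDual ℝ X) (φ₀ : StrongDual ℝ X)
    (hφ : Tendsto (fun n => StrongDual.toWeakDual (φ n)) atTop (𝓝 (StrongDual.toWeakDual φ₀))) :
    Tendsto (fun n => toWeakSpace ℝ (StrongDual ℝ X) (φ n)) atTop
      (𝓝 (toWeakSpace ℝ (StrongDual ℝ X) φ₀)) := by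
  refine tendsto_weak_of_small_convexHull (fun φ hφ ε hε => ?_) φ φ₀ hφ
  obtain ⟨K₀, hK₀⟩ := banach_steinhaus (g := φ) fun x => by
    obtain ⟨c, hc⟩ := (hφ x).norm.bddAbove_range
    exact ⟨c, fun n => hc ⟨n, rfl⟩⟩
  -- After division by `K` the functionals pulled back along `Q` are dominated by the grid norm.
  -- Small combinations descend to `X` because unit vectors lift to the unit ball.
  set K := |K₀| * |C| + 1 with hK
  have hKpos : 0 < K := by positivity
  set T : StrongDual ℝ X →ₗ[ℝ] (gridSpace μ hq →ₗ[ℝ] ℝ) :=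
    { toFun := fun φ => K⁻¹ • (φ : X →ₗ[ℝ] ℝ).comp Q
      map_add' := fun a b => by ext; simp; ring
      map_smul' := fun c a => by ext; simp; ring } with hT
  have hTφ : ∀ φ g, T φ g = K⁻¹ * φ (Q g) := fun φ g => rfl
  obtain ⟨θ', hθ', hθb⟩ := exists_mem_convexHull_le_gridNorm hq1 hq2 (fun n => T (φ n))
    (fun n g => by
      have hN : 0 ≤ gridNorm μ hq g := apply_nonneg _ g
      rw [hTφ, abs_mul, abs_of_pos (by positivity), inv_mul_eq_div, div_le_iff₀ hKpos]
      calc |φ n (Q g)| ≤ ‖φ n‖ * ‖Q g‖ := (φ n).le_opNorm _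
        _ ≤ |K₀| * (|C| * gridNorm μ hq g) := by
            refine mul_le_mul ((hK₀ n).trans (le_abs_self _)) ((hQ g).trans ?_) (norm_nonneg _)
              (abs_nonneg _)
            gcongr
            exact le_abs_self C
        _ ≤ gridNorm μ hq g * K := by rw [hK]; nlinarith)
    (fun g => by
      have := (hφ (Q g)).const_mul K⁻¹
      rwa [mul_zero] at this)
    (show 0 < ε / K by positivity)
  rw [show (range fun n => T (φ n)) = T '' range φ from range_comp T φ,
    ← LinearMap.image_convexHull] at hθ'
  obtain ⟨θ, hθ, rfl⟩ := hθ'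
  refine ⟨θ, hθ, ContinuousLinearMap.opNorm_le_of_unit_norm hε.le fun x hx => ?_⟩
  obtain ⟨g, hg, rfl⟩ := hsurj x hx.le
  have h1 := hθb g
  rw [hTφ, abs_mul, abs_of_pos (by positivity), inv_mul_eq_div, div_le_iff₀ hKpos] at h1
  rw [Real.norm_eq_abs]
  refine h1.trans ?_
  calc ε / K * gridNorm μ hq g * K = ε * gridNorm μ hq g := by field_simp
    _ ≤ ε := mul_le_of_le_one_right hε.le hg

/-! ### Countable subadditivity of `f ↦ ∫₀ᵗ f*(s) ds` -/

section Rearrangement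

variable {α : Type*} [MeasurableSpace α] {μ : Measure α}

theorem ofReal_abs_sub (a : ℝ) {s : ℝ} (hs : 0 ≤ s) :
    ENNReal.ofReal (|a| - s) = ‖a‖ₑ - ENNReal.ofReal s := by
  rw [Real.enorm_eq_ofReal_abs, ENNReal.ofReal_sub _ hs]

/-- A splitting of the sum `∑ k, ∫₀ᵗ (f k)*`. -/
theorem exists_split_of_tsum_ne_top {κ : Type*} [Countable κ] {f : κ → α → ℝ}
    (hf : ∀ k, AEMeasurable (f k) μ) {t : ℝ} (ht : 0 < t)
    (h : ∑' k, ∫⁻ u in Ioo 0 t, rearrangement μ (f k) u ≠ ∞) :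
    ∃ s : κ → ℝ, (∀ k, 0 ≤ s k) ∧ ∑' k, ENNReal.ofReal (s k) ≠ ∞ ∧
      ∑' k, ∫⁻ u in Ioo 0 t, rearrangement μ (f k) u
        = ENNReal.ofReal t * ∑' k, ENNReal.ofReal (s k)
          + ∫⁻ x, ∑' k, (‖f k x‖ₑ - ENNReal.ofReal (s k)) ∂μ := by
  have hne : ∀ k, rearrangement μ (f k) t ≠ ∞ := fun k hk =>
    ENNReal.ne_top_of_tsum_ne_top h k (lintegral_rearrangement_eq_top ht hk)
  have heq : ∀ k, ∫⁻ u in Ioo 0 t, rearrangement μ (f k) u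
      = ENNReal.ofReal t * ENNReal.ofReal (rearrangement μ (f k) t).toReal
        + ∫⁻ x, (‖f k x‖ₑ - ENNReal.ofReal (rearrangement μ (f k) t).toReal) ∂μ := fun k => by
    rw [lintegral_rearrangement_eq (hf k) t (hne k), ENNReal.ofReal_toReal (hne k)]
    simp only [ofReal_abs_sub _ ENNReal.toReal_nonneg, ENNReal.ofReal_toReal (hne k)]
  have hsum : ∑' k, ∫⁻ u in Ioo 0 t, rearrangement μ (f k) u
      = ENNReal.ofReal t * ∑' k, ENNReal.ofReal (rearrangement μ (f k) t).toReal
        + ∫⁻ x, ∑' k, (‖f k x‖ₑ - ENNReal.ofReal (rearrangement μ (f k) t).toReal) ∂μ := by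
    rw [lintegral_tsum fun k => (hf k).enorm.sub_const _, ← ENNReal.tsum_mul_left,
      ← ENNReal.tsum_add]
    exact tsum_congr heq
  refine ⟨fun k => (rearrangement μ (f k) t).toReal, fun k => ENNReal.toReal_nonneg, ?_, hsum⟩
  intro htop
  rw [hsum, htop, ENNReal.mul_top (by simpa using ht), top_add] at h
  exact h rfl

theorem tsum_le_tsum_add_tsum_sub {κ : Type*} (a b : κ → ℝ≥0∞) :
    ∑' k, a k ≤ ∑' k, b k + ∑' k, (a k - b k) := by
  rw [← ENNReal.tsum_add]
  exact ENNReal.tsum_le_tsum fun k => le_add_tsub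

/-- `∫₀ᵗ h*` is the minimum over `s ≥ 0` of `t s + ∫ (|h| - s)₊`, attained at `s = h*(t)` when this
is finite. Take the optimal level for each `f k` and test `h` with the sum of these levels. -/
theorem lintegral_rearrangement_le_tsum {κ : Type*} [Countable κ] {f : κ → α → ℝ} {h : α → ℝ}
    (hf : ∀ k, AEMeasurable (f k) μ) (hh : AEMeasurable h μ) {t : ℝ} (ht : 0 < t)
    (hle : ∀ᵐ x ∂μ, ‖h x‖ₑ ≤ ∑' k, ‖f k x‖ₑ) :
    ∫⁻ u in Ioo 0 t, rearrangement μ h u ≤ ∑' k, ∫⁻ u in Ioo 0 t, rearrangement μ (f k) u := by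
  by_cases hfin : ∑' k, ∫⁻ u in Ioo 0 t, rearrangement μ (f k) u = ∞
  · rw [hfin]; exact le_top
  obtain ⟨s, hs0, hs, hsum⟩ := exists_split_of_tsum_ne_top hf ht hfin
  rw [hsum]
  set S := (∑' k, ENNReal.ofReal (s k)).toReal with hS
  have hS' : ENNReal.ofReal S = ∑' k, ENNReal.ofReal (s k) := ENNReal.ofReal_toReal hs
  refine (lintegral_rearrangement_le hh t
    (ENNReal.toReal_nonneg (a := ∑' k, ENNReal.ofReal (s k)))).trans ?_
  rw [← hS, hS']
  refine add_le_add_right (lintegral_mono_ae ?_) _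
  filter_upwards [hle] with x hx
  rw [ofReal_abs_sub _ ENNReal.toReal_nonneg, hS', tsub_le_iff_left]
  exact hx.trans (tsum_le_tsum_add_tsum_sub _ _)

theorem ae_tsum_enorm_lt_top {κ : Type*} [Countable κ] {f : κ → α → ℝ}
    (hf : ∀ k, AEMeasurable (f k) μ) {t : ℝ} (ht : 0 < t)
    (h : ∑' k, ∫⁻ u in Ioo 0 t, rearrangement μ (f k) u ≠ ∞) :
    ∀ᵐ x ∂μ, ∑' k, ‖f k x‖ₑ < ∞ := by
  obtain ⟨s, hs0, hs, hsum⟩ := exists_split_of_tsum_ne_top hf ht h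
  have h1 : ∫⁻ x, ∑' k, (‖f k x‖ₑ - ENNReal.ofReal (s k)) ∂μ ≠ ∞ := fun htop => by
    rw [hsum, htop, add_top] at h; exact h rfl
  filter_upwards [ae_lt_top' (AEMeasurable.tsum fun k => (hf k).enorm.sub_const _) h1]
    with x hx
  exact (tsum_le_tsum_add_tsum_sub _ _).trans_lt (ENNReal.add_lt_top.2 ⟨hs.lt_top, hx⟩)

/-- The bound `|f| ≤ s + (|f| - s)₊` at `s = f*(t)`, integrated over `S`. -/
theorem setLIntegral_enorm_le_lintegral_rearrangement {f : α → ℝ} (hf : AEMeasurable f μ) {S : Set α}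
    {t : ℝ} (ht : 0 < t) (hS : μ S ≤ ENNReal.ofReal t) :
    ∫⁻ x in S, ‖f x‖ₑ ∂μ ≤ ∫⁻ u in Ioo 0 t, rearrangement μ f u := by
  by_cases h : rearrangement μ f t = ∞
  · rw [lintegral_rearrangement_eq_top ht h]; exact le_top
  rw [lintegral_rearrangement_eq hf t h]
  set s := rearrangement μ f t
  have hle : ∀ x, ‖f x‖ₑ ≤ s + ENNReal.ofReal (|f x| - s.toReal) := fun x => by
    rw [ofReal_abs_sub _ ENNReal.toReal_nonneg, ENNReal.ofReal_toReal h]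
    exact le_add_tsub
  calc ∫⁻ x in S, ‖f x‖ₑ ∂μ ≤ ∫⁻ x in S, (s + ENNReal.ofReal (|f x| - s.toReal)) ∂μ :=
        lintegral_mono hle
    _ = s * μ S + ∫⁻ x in S, ENNReal.ofReal (|f x| - s.toReal) ∂μ := by
        rw [lintegral_add_left measurable_const, setLIntegral_const]
    _ ≤ _ := by
        rw [mul_comm]
        exact add_le_add (mul_le_mul_left hS _) (setLIntegral_le_lintegral _ _)

end Rearrangement

/-! ### The norm of the Marcinkiewicz space -/

section Marcinkiewicz

variable {ψ : ℝ → ℝ} {γ : ℝ≥0∞}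

theorem marcinkiewiczENorm_le_iff (hpos : ∀ t ∈ intervalIoo γ, 0 < ψ t) {f : LZero γ} {c : ℝ≥0∞} :
    marcinkiewiczENorm ψ γ f ≤ c ↔ ∀ t ∈ intervalIoo γ,
      ∫⁻ s in Ioo 0 t, rearrangement (volume.restrict (intervalIoo γ)) f s
        ≤ c * ENNReal.ofReal (ψ t) := by
  rw [marcinkiewiczENorm, iSup₂_le_iff]
  refine forall₂_congr fun t ht => ?_
  rw [ENNReal.div_le_iff (by simpa using hpos t ht) ENNReal.ofReal_ne_top]

theorem marcinkiewiczSpace.norm_le_iff (hpos : ∀ t ∈ intervalIoo γ, 0 < ψ t)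
    {f : marcinkiewiczSpace ψ γ} {c : ℝ} (hc : 0 ≤ c) :
    ‖f‖ ≤ c ↔ ∀ t ∈ intervalIoo γ,
      ∫⁻ s in Ioo 0 t, rearrangement (volume.restrict (intervalIoo γ)) f.1 s
        ≤ ENNReal.ofReal (c * ψ t) := by
  have h1 : ‖f‖ ≤ c ↔ marcinkiewiczENorm ψ γ f.1 ≤ ENNReal.ofReal c :=
    (ENNReal.le_ofReal_iff_toReal_le (ne_of_lt f.2) hc).symm
  rw [h1, marcinkiewiczENorm_le_iff hpos]
  simp only [ENNReal.ofReal_mul hc]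

theorem mem_marcinkiewiczSpace (hpos : ∀ t ∈ intervalIoo γ, 0 < ψ t)
    {f : LZero γ} {c : ℝ} (hc : 0 ≤ c) (h : ∀ t ∈ intervalIoo γ,
      ∫⁻ s in Ioo 0 t, rearrangement (volume.restrict (intervalIoo γ)) f s
        ≤ ENNReal.ofReal (c * ψ t)) : f ∈ marcinkiewiczSpace ψ γ := by
  refine lt_of_le_of_lt (b := ENNReal.ofReal c) ((marcinkiewiczENorm_le_iff hpos).2 fun t ht => ?_)
    ENNReal.ofReal_lt_top
  rw [← ENNReal.ofReal_mul hc]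
  exact h t ht

theorem marcinkiewiczSpace.lintegral_le (hpos : ∀ t ∈ intervalIoo γ, 0 < ψ t)
    (f : marcinkiewiczSpace ψ γ) {t : ℝ} (ht : t ∈ intervalIoo γ) :
    ∫⁻ s in Ioo 0 t, rearrangement (volume.restrict (intervalIoo γ)) f.1 s
      ≤ ENNReal.ofReal (‖f‖ * ψ t) :=
  (marcinkiewiczSpace.norm_le_iff hpos (norm_nonneg f)).1 le_rfl t ht

theorem intervalIoo_nonempty (hγ : 0 < γ) : (intervalIoo γ).Nonempty := by
  obtain ⟨r, hr0, hr⟩ := ENNReal.lt_iff_exists_nnreal_btwn.1 hγ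
  exact ⟨r, by simpa using hr0, by simpa using hr⟩

/-- Marcinkiewicz spaces are complete: a series with summable norms can be summed almost
everywhere. -/
theorem marcinkiewiczSpace.completeSpace (hγ : 0 < γ) (hpos : ∀ t ∈ intervalIoo γ, 0 < ψ t) :
    CompleteSpace (marcinkiewiczSpace ψ γ) := by
  refine NormedAddCommGroup.completeSpace_of_summable_imp_tendsto fun u hu => ?_
  set m := volume.restrict (intervalIoo γ) with hm
  have hK : ∀ t ∈ intervalIoo γ, ∀ n, ∑' k, ∫⁻ s in Ioo 0 t, rearrangement m (u (k + n)).1 s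
      ≤ ENNReal.ofReal ((∑' k, ‖u (k + n)‖) * ψ t) := by
    intro t ht n
    have hs : Summable fun k => ‖u (k + n)‖ := (summable_nat_add_iff n).2 hu
    rw [← tsum_mul_right, ENNReal.ofReal_tsum_of_nonneg
      (fun k => mul_nonneg (norm_nonneg _) (hpos t ht).le) (hs.mul_right _)]
    exact ENNReal.tsum_le_tsum fun k => marcinkiewiczSpace.lintegral_le hpos _ ht
  obtain ⟨t₀, ht₀⟩ := intervalIoo_nonempty hγ
  have hae : ∀ᵐ x ∂m, ∑' k, ‖(u k).1 x‖ₑ < ∞ :=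
    ae_tsum_enorm_lt_top (fun k => (u k).1.aemeasurable) ht₀.1
      ((hK t₀ ht₀ 0).trans_lt ENNReal.ofReal_lt_top).ne
  have hsummable : ∀ᵐ x ∂m, Summable fun k => (u k).1 x := by
    filter_upwards [hae] with x hx
    refine Summable.of_norm ?_
    have := ENNReal.summable_toReal hx.ne
    simpa using this
  set h : ℝ → ℝ := fun x => ∑' k, (u k).1 x with hh
  have hpart : ∀ n, AEStronglyMeasurable (fun x => ∑ k ∈ Finset.range n, (u k).1 x) m := fun n =>
    Finset.aestronglyMeasurable_fun_sum _ fun k _ => (u k).1.aestronglyMeasurable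
  have hmeas : AEStronglyMeasurable h m := by
    refine aestronglyMeasurable_of_tendsto_ae atTop hpart ?_
    filter_upwards [hsummable] with x hx
    exact hx.hasSum.tendsto_sum_nat
  set H : LZero γ := AEEqFun.mk h hmeas with hH
  have hsumae : ∀ n, ((∑ k ∈ Finset.range n, u k : marcinkiewiczSpace ψ γ).1 : ℝ → ℝ)
      =ᵐ[m] fun x => ∑ k ∈ Finset.range n, (u k).1 x := by
    intro n
    induction n with
    | zero =>
      simp only [Finset.range_zero, Finset.sum_empty]
      exact AEEqFun.coeFn_zero
    | succ n ih =>
      simp only [Finset.sum_range_succ]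
      filter_upwards [ih, AEEqFun.coeFn_add (∑ k ∈ Finset.range n, u k : marcinkiewiczSpace ψ γ).1
        (u n).1] with x hx hx'
      change ((∑ k ∈ Finset.range n, u k : marcinkiewiczSpace ψ γ).1 + (u n).1 : LZero γ) x = _
      rw [hx', Pi.add_apply, hx]
  have hdiff : ∀ n, ∀ t ∈ intervalIoo γ, ∫⁻ s in Ioo 0 t, rearrangement m
      ((H - (∑ k ∈ Finset.range n, u k : marcinkiewiczSpace ψ γ).1 : LZero γ) : ℝ → ℝ) s
      ≤ ENNReal.ofReal ((∑' k, ‖u (k + n)‖) * ψ t) := by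
    intro n t ht
    refine le_trans (lintegral_rearrangement_le_tsum (f := fun k => (u (k + n)).1)
      (fun k => (u (k + n)).1.aemeasurable) (AEEqFun.aemeasurable _) ht.1 ?_) (hK t ht n)
    filter_upwards [hsummable, hsumae n, AEEqFun.coeFn_sub H
      (∑ k ∈ Finset.range n, u k : marcinkiewiczSpace ψ γ).1, AEEqFun.coeFn_mk h hmeas, hae]
      with x h1 h2 h3 h4 h5
    rw [h3, Pi.sub_apply, h2, h4]
    have h6 : h x - ∑ k ∈ Finset.range n, (u k).1 x = ∑' k, (u (k + n)).1 x := by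
      have := h1.sum_add_tsum_nat_add n
      simp only [hh]
      linarith
    rw [h6]
    exact enorm_tsum_le_tsum_enorm
  have hHmem : H ∈ marcinkiewiczSpace ψ γ := by
    have h0 := mem_marcinkiewiczSpace hpos (tsum_nonneg fun k => norm_nonneg (u (k + 0))) (hdiff 0)
    simpa using h0
  refine ⟨⟨H, hHmem⟩, ?_⟩
  rw [tendsto_iff_norm_sub_tendsto_zero]
  refine squeeze_zero (fun n => norm_nonneg _) (fun n => ?_) (tendsto_sum_nat_add fun k => ‖u k‖)
  rw [norm_sub_rev]
  exact (marcinkiewiczSpace.norm_le_iff hpos (tsum_nonneg fun k => norm_nonneg _)).2 (hdiff n)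

end Marcinkiewicz

/-! ### Concave weights -/

theorem intervalIoo_of_le {γ : ℝ≥0∞} {s t : ℝ} (ht : t ∈ intervalIoo γ) (hs : 0 < s) (hst : s ≤ t) :
    s ∈ intervalIoo γ :=
  ⟨hs, (ENNReal.ofReal_le_ofReal hst).trans_lt ht.2⟩

theorem intervalIoo_subset_intervalIco (γ : ℝ≥0∞) : intervalIoo γ ⊆ intervalIco γ :=
  fun _ ht => ⟨ht.1.le, ht.2⟩

/-- A non-decreasing concave function on `[0, γ)` that vanishes at `0` and is positive on
`(0, γ)`. -/
structure IsConcaveWeight (ψ : ℝ → ℝ) (γ : ℝ≥0∞) : Prop where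
  pos : ∀ t ∈ intervalIoo γ, 0 < ψ t
  mono : MonotoneOn ψ (intervalIco γ)
  concave : ConcaveOn ℝ (intervalIco γ) ψ
  zero : ψ 0 = 0

namespace IsConcaveWeight

variable {ψ : ℝ → ℝ} {γ : ℝ≥0∞}

theorem mul_le_of_concave {s t : ℝ} (hconc : ConcaveOn ℝ (intervalIco γ) ψ) (h0 : ψ 0 = 0)
    (ht : t ∈ intervalIoo γ) (hs : 0 ≤ s) (hst : s ≤ t) : s * ψ t ≤ t * ψ s := by
  have ht0 := ht.1
  have h := hconc.2 (intervalIoo_subset_intervalIco γ ht)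
    (show (0 : ℝ) ∈ intervalIco γ from ⟨le_rfl, by simpa using pos_of_gt ht.2⟩)
    (show 0 ≤ s / t by positivity) (show 0 ≤ 1 - s / t by
      rw [sub_nonneg, div_le_one ht0]; exact hst) (by ring)
  rw [smul_zero, add_zero, smul_eq_mul, smul_eq_mul, smul_eq_mul, h0, mul_zero, add_zero,
    div_mul_cancel₀ _ ht0.ne', div_mul_eq_mul_div, div_le_iff₀ ht0] at h
  linarith

theorem of_ne_zero (hψ_nonneg : ∀ t ∈ intervalIco γ, 0 ≤ ψ t)
    (hψ_ne : ∃ t ∈ intervalIco γ, ψ t ≠ 0) (hψ_mono : MonotoneOn ψ (intervalIco γ))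
    (hψ_concave : ConcaveOn ℝ (intervalIco γ) ψ) (hψ_zero : ψ 0 = 0) : IsConcaveWeight ψ γ := by
  refine ⟨fun t ht => ?_, hψ_mono, hψ_concave, hψ_zero⟩
  obtain ⟨s, hs, hs0⟩ := hψ_ne
  have hspos : 0 < ψ s := lt_of_le_of_ne (hψ_nonneg s hs) hs0.symm
  have hs' : 0 < s := lt_of_le_of_ne hs.1 fun h => hs0 (h ▸ hψ_zero)
  rcases le_total s t with h | h
  · exact hspos.trans_le (hψ_mono hs (intervalIoo_subset_intervalIco γ ht) h)
  · have h1 := mul_le_of_concave hψ_concave hψ_zero ⟨hs', hs.2⟩ ht.1.le h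
    have h2 : 0 < t * ψ s := mul_pos ht.1 hspos
    exact pos_of_mul_pos_right (h2.trans_le h1) hs'.le

theorem le (W : IsConcaveWeight ψ γ) {s t : ℝ} (ht : t ∈ intervalIoo γ) (hs : 0 < s)
    (hst : s ≤ t) : ψ s ≤ ψ t :=
  W.mono (intervalIoo_subset_intervalIco γ (intervalIoo_of_le ht hs hst))
    (intervalIoo_subset_intervalIco γ ht) hst

theorem mul_le (W : IsConcaveWeight ψ γ) {s t : ℝ} (ht : t ∈ intervalIoo γ) (hs : 0 ≤ s)
    (hst : s ≤ t) : s * ψ t ≤ t * ψ s := mul_le_of_concave W.concave W.zero ht hs hst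

theorem div_le_div (W : IsConcaveWeight ψ γ) {s t : ℝ} (ht : t ∈ intervalIoo γ) (hs : 0 < s)
    (hst : s ≤ t) : ψ t / t ≤ ψ s / s := by
  rw [div_le_div_iff₀ ht.1 hs]
  have := W.mul_le ht hs.le hst
  linarith

/-- The chord from `t` to `c t` is no steeper than the chord from `t` to `2 t`. A ratio `ψ (2 t) / ψ
t` close to `1` therefore keeps `ψ` flat up to `c t`. -/
theorem sub_le_mul_sub (W : IsConcaveWeight ψ γ) {t c : ℝ} (ht : 0 < t) (hc : 2 ≤ c)
    (hct : c * t ∈ intervalIoo γ) :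
    ψ (c * t) - ψ t ≤ (c - 1) * (ψ (2 * t) - ψ t) := by
  have h2 : 2 * t ≤ c * t := by gcongr
  have hmem := fun s (hs : 0 < s) hst => intervalIoo_subset_intervalIco γ
    (intervalIoo_of_le (s := s) hct hs hst)
  have h := W.concave.neg.secant_mono (hmem t ht (by nlinarith)) (hmem (2 * t) (by positivity) h2)
    (hmem (c * t) hct.1 le_rfl) (by linarith) (by nlinarith) h2
  simp only [Pi.neg_apply] at h
  have e1 : 2 * t - t = t := by ring
  have e2 : c * t - t = (c - 1) * t := by ring
  have hc1 : 0 < c - 1 := by linarith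
  rw [e1, e2, div_le_div_iff₀ ht (by positivity)] at h
  have h3 : t * ((c - 1) * (ψ (2 * t) - ψ t)) ≥ t * (ψ (c * t) - ψ t) := by nlinarith
  exact le_of_mul_le_mul_left h3 ht

/-- Both the chord over `[t, 2 t]` and the chord over `[b, 2 b]` are compared with the chord over
`[t, 2 b]`. Strict growth at `b` thus passes to all smaller `t`. -/
theorem mul_sub_le_mul_sub (W : IsConcaveWeight ψ γ) {t b : ℝ} (ht : 0 < t) (htb : t ≤ b)
    (hb : 2 * b ∈ intervalIoo γ) :
    t * (ψ (2 * b) - ψ b) ≤ b * (ψ (2 * t) - ψ t) := by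
  have hb0 : 0 < b := ht.trans_le htb
  have hmem := fun s (hs : 0 < s) hst => intervalIoo_subset_intervalIco γ
    (intervalIoo_of_le (s := s) hb hs hst)
  have h1 := W.concave.neg.secant_mono (hmem t ht (by linarith)) (hmem (2 * t) (by positivity)
    (by linarith)) (hmem (2 * b) (by positivity) le_rfl) (by linarith) (by linarith) (by linarith)
  have h2 := W.concave.neg.secant_mono (hmem (2 * b) (by positivity) le_rfl)
    (hmem t ht (by linarith)) (hmem b hb0 (by linarith)) (by linarith) (by linarith) htb
  simp only [Pi.neg_apply] at h1 h2
  have e1 : 2 * t - t = t := by ring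
  have e2 : b - 2 * b = -b := by ring
  rw [e1, div_le_iff₀ ht] at h1
  rw [e2, le_div_iff_of_neg (by linarith)] at h2
  have e3 : (-ψ t - -ψ (2 * b)) / (t - 2 * b) = (-ψ (2 * b) - -ψ t) / (2 * b - t) := by
    rw [← neg_sub (2 * b) t, div_neg, ← neg_div]; ring
  rw [e3] at h2
  set S := (-ψ (2 * b) - -ψ t) / (2 * b - t)
  have h3 : -ψ b + ψ (2 * b) ≤ S * -b := by linarith
  have h4 : -ψ (2 * t) + ψ t ≤ S * t := by linarith
  nlinarith

end IsConcaveWeight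

/-! ### Power decay of weights -/

theorem exists_real_of_one_lt_liminf {F : Filter ℝ} {u : ℝ → ℝ}
    (h : 1 < liminf (fun t => ((u t : ℝ) : EReal)) F) : ∃ r : ℝ, 1 < r ∧ ∀ᶠ t in F, r < u t := by
  obtain ⟨r, hr1, hr⟩ := EReal.lt_iff_exists_real_btwn.1 h
  refine ⟨r, by exact_mod_cast hr1, (eventually_lt_of_lt_liminf hr).mono fun t ht => ?_⟩
  exact_mod_cast ht

theorem IsConcaveWeight.exists_decay_of_doubling {ψ : ℝ → ℝ} {γ : ℝ≥0∞} (W : IsConcaveWeight ψ γ)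
    {r : ℝ} (hr : 1 < r) (n₀ : ℕ)
    (h : ∀ t ∈ intervalIoo γ, ∀ j ≥ n₀, r * ψ (t / 2 ^ (j + 1)) ≤ ψ (t / 2 ^ j)) :
    ∃ C > 0, ∃ κ > 1, ∀ t ∈ intervalIoo γ, ∀ j : ℕ, κ ^ j * ψ (t / 2 ^ j) ≤ C * ψ t := by
  refine ⟨r ^ n₀, by positivity, r, hr, fun t ht j => ?_⟩
  have hle : ∀ j : ℕ, ψ (t / 2 ^ j) ≤ ψ t := fun j =>
    W.le ht (div_pos ht.1 (by positivity)) (div_le_self ht.1.le (one_le_pow₀ (by norm_num)))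
  have hpos : ∀ j : ℕ, 0 < ψ (t / 2 ^ j) := fun j => W.pos _
    (intervalIoo_of_le ht (div_pos ht.1 (by positivity))
      (div_le_self ht.1.le (one_le_pow₀ (by norm_num))))
  have hsmall : ∀ j ≤ n₀, r ^ j * ψ (t / 2 ^ j) ≤ r ^ n₀ * ψ t := fun j hj =>
    mul_le_mul (pow_le_pow_right₀ hr.le hj) (hle j) (hpos j).le (by positivity)
  induction j with
  | zero => exact hsmall 0 (Nat.zero_le _)
  | succ j ih =>
    rcases Nat.lt_or_ge j n₀ with hj | hj
    · exact hsmall (j + 1) hj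
    · calc r ^ (j + 1) * ψ (t / 2 ^ (j + 1)) = r ^ j * (r * ψ (t / 2 ^ (j + 1))) := by ring
        _ ≤ r ^ j * ψ (t / 2 ^ j) := by
            have := h t ht j hj
            gcongr
        _ ≤ _ := ih

/-- Doubling with a uniform factor above `1` holds near `0` and near `∞` by the lower limits, and in
between by concavity. When `γ < ∞`, only finitely many scales `t / 2 ^ j` lie outside the range
where the limit at `0` applies. Their number is bounded uniformly because `t < γ`, and the constant
absorbs them. -/
theorem IsConcaveWeight.exists_decay {ψ : ℝ → ℝ} {γ : ℝ≥0∞} (W : IsConcaveWeight ψ γ)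
    (h : ConditionA ψ γ ∨ ConditionB ψ γ) :
    ∃ C > 0, ∃ κ > 1, ∀ t ∈ intervalIoo γ, ∀ j : ℕ, κ ^ j * ψ (t / 2 ^ j) ≤ C * ψ t := by
  have hhalf : ∀ (t : ℝ) (j : ℕ), 2 * (t / 2 ^ (j + 1)) = t / 2 ^ j := fun t j => by
    rw [pow_succ]; field_simp
  have hmem : ∀ t ∈ intervalIoo γ, ∀ j : ℕ, t / 2 ^ j ∈ intervalIoo γ := fun t ht j =>
    intervalIoo_of_le ht (div_pos ht.1 (by positivity))
      (div_le_self ht.1.le (one_le_pow₀ (by norm_num)))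
  rcases h with ⟨rfl, h0, hinf⟩ | ⟨hγ, h0⟩
  · obtain ⟨r₀, hr₀, h0⟩ := exists_real_of_one_lt_liminf h0
    obtain ⟨r₁, hr₁, hinf⟩ := exists_real_of_one_lt_liminf hinf
    obtain ⟨a, ha, h0⟩ := mem_nhdsGT_iff_exists_Ioo_subset.1 h0
    obtain ⟨b₀, hinf⟩ := eventually_atTop.1 hinf
    have hall : ∀ t : ℝ, 0 < t → t ∈ intervalIoo ∞ := fun t ht => ⟨ht, ENNReal.ofReal_lt_top⟩
    have ha' : (0 : ℝ) < a := ha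
    set b := max b₀ a with hb
    have hb0 : 0 < b := ha'.trans_le (le_max_right _ _)
    have hψb := W.pos b (hall b hb0)
    have hslope : 0 < ψ (2 * b) - ψ b := by
      have := hinf b (le_max_left _ _)
      rw [lt_div_iff₀ hψb] at this
      nlinarith
    -- On `[a, b]` the increment `ψ (2 * t) - ψ t` is at least `(a / b) * (ψ (2 * b) - ψ b)`, while
    -- `ψ t ≤ ψ b`.
    set r₂ := 1 + a * (ψ (2 * b) - ψ b) / (b * ψ b) with hr₂
    have hr₂1 : 1 < r₂ := by
      have : 0 < a * (ψ (2 * b) - ψ b) / (b * ψ b) := by positivity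
      linarith
    have hdoub : ∀ t : ℝ, 0 < t → min r₀ (min r₁ r₂) * ψ t ≤ ψ (2 * t) := by
      intro t ht
      have hψt := W.pos t (hall t ht)
      rcases lt_or_ge t a with hta | hta
      · have h1 : r₀ < ψ (2 * t) / ψ t := h0 ⟨ht, hta⟩
        rw [lt_div_iff₀ hψt] at h1
        refine le_trans ?_ h1.le
        gcongr
        exact min_le_left _ _
      rcases le_or_gt t b with htb | htb
      · have h1 := W.mul_sub_le_mul_sub ht htb (hall (2 * b) (by positivity))
        have h2 : ψ t ≤ ψ b := W.le (hall b hb0) ht htb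
        have h3 : r₂ * ψ t ≤ ψ (2 * t) := by
          have h4 : a * (ψ (2 * b) - ψ b) / (b * ψ b) * ψ t ≤ ψ (2 * t) - ψ t := by
            rw [div_mul_eq_mul_div, div_le_iff₀ (by positivity)]
            have h5 : 0 ≤ ψ (2 * t) - ψ t := by
              have := W.le (hall (2 * t) (by positivity)) ht (by linarith)
              linarith
            calc a * (ψ (2 * b) - ψ b) * ψ t ≤ t * (ψ (2 * b) - ψ b) * ψ b := by gcongr
              _ ≤ b * (ψ (2 * t) - ψ t) * ψ b := by gcongr
              _ = (ψ (2 * t) - ψ t) * (b * ψ b) := by ring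
          rw [hr₂]
          linarith
        refine le_trans ?_ h3
        gcongr
        exact (min_le_right _ _).trans (min_le_right _ _)
      · have h1 : r₁ < ψ (2 * t) / ψ t := hinf t ((le_max_left _ _).trans htb.le)
        rw [lt_div_iff₀ hψt] at h1
        refine le_trans ?_ h1.le
        gcongr
        exact (min_le_right _ _).trans (min_le_left _ _)
    refine W.exists_decay_of_doubling (lt_min hr₀ (lt_min hr₁ hr₂1)) 0 fun t ht j _ => ?_
    rw [← hhalf t j]
    exact hdoub _ (div_pos ht.1 (by positivity))
  · obtain ⟨r₀, hr₀, h0⟩ := exists_real_of_one_lt_liminf h0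
    obtain ⟨a, ha, h0⟩ := mem_nhdsGT_iff_exists_Ioo_subset.1 h0
    have ha' : (0 : ℝ) < a := ha
    obtain ⟨n₀, hn₀⟩ := pow_unbounded_of_one_lt (γ.toReal / a) (show (1 : ℝ) < 2 by norm_num)
    refine W.exists_decay_of_doubling hr₀ n₀ fun t ht j hj => ?_
    have htγ : t < γ.toReal := by
      rw [← ENNReal.ofReal_lt_iff_lt_toReal ht.1.le hγ.ne]; exact ht.2
    have hlt : t / 2 ^ (j + 1) < a := by
      rw [div_lt_iff₀ (by positivity)]
      rw [div_lt_iff₀ ha'] at hn₀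
      have h2 : (2 : ℝ) ^ n₀ ≤ 2 ^ (j + 1) := pow_le_pow_right₀ (by norm_num) (by omega)
      nlinarith
    have h1 : r₀ < ψ (2 * (t / 2 ^ (j + 1))) / ψ (t / 2 ^ (j + 1)) :=
      h0 ⟨div_pos ht.1 (by positivity), hlt⟩
    rw [lt_div_iff₀ (W.pos _ (hmem t ht _)), hhalf] at h1
    exact h1.le

/-! ### Geometric sums over levels -/

theorem tsum_zpow_le (c : ℝ) (hc : 0 < c) :
    ∑' k : ℤ, (if (2 : ℝ) ^ k ≤ c then ENNReal.ofReal ((2 : ℝ) ^ k) else 0)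
      ≤ ENNReal.ofReal (2 * c) := by
  set l := Int.log 2 c with hl
  have hiff : ∀ k : ℤ, (2 : ℝ) ^ k ≤ c ↔ k ≤ l := fun k => by
    have := Int.zpow_le_iff_le_log (R := ℝ) (b := 2) (by norm_num) (x := k) hc
    exact_mod_cast this
  have hinj : Function.Injective fun n : ℕ => l - n := fun a b h => by
    simpa using h
  rw [← hinj.tsum_eq]
  · have h1 : ∀ n : ℕ, (if (2 : ℝ) ^ (l - n : ℤ) ≤ c then ENNReal.ofReal ((2 : ℝ) ^ (l - n : ℤ)) else 0)
        = ENNReal.ofReal ((2 : ℝ) ^ l * (1 / 2) ^ n) := fun n => by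
      rw [if_pos ((hiff _).2 (by omega)), zpow_sub₀ (by norm_num), zpow_natCast, one_div, inv_pow,
        div_eq_mul_inv]
    simp only [h1]
    rw [← ENNReal.ofReal_tsum_of_nonneg (fun n => by positivity)
      (summable_geometric_two.mul_left _), tsum_mul_left, tsum_geometric_two]
    refine ENNReal.ofReal_le_ofReal ?_
    have := (hiff l).2 le_rfl
    linarith
  · intro k hk
    have hkl : k ≤ l := by
      by_contra hcon
      refine hk ?_
      change (if _ then _ else _) = _
      rw [if_neg (fun h => hcon ((hiff k).1 h))]
    exact ⟨(l - k).toNat, by simp [Int.toNat_of_nonneg (sub_nonneg.2 hkl)]⟩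

/-! ### The Marcinkiewicz space as a quotient of a grid space -/

section Quotient

variable {ψ : ℝ → ℝ} {γ : ℝ≥0∞}

/-- The largest measure of the level set `{2 ^ k < |f|}` for `f` in the unit ball. -/
noncomputable def levelMeasure (ψ : ℝ → ℝ) (γ : ℝ≥0∞) (k : ℤ) : ℝ≥0∞ :=
  ⨆ t ∈ {t | t ∈ intervalIoo γ ∧ (2 : ℝ) ^ k * t ≤ ψ t}, ENNReal.ofReal t

/-- Lebesgue measure on `(0, γ)`, divided by `levelMeasure`. -/
noncomputable def levelScaledMeasure (ψ : ℝ → ℝ) (γ : ℝ≥0∞) (k : ℤ) : Measure ℝ :=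
  (levelMeasure ψ γ k)⁻¹ • volume.restrict (intervalIoo γ)

theorem volume_intervalIoo_le (γ : ℝ≥0∞) : volume (intervalIoo γ) ≤ γ := by
  have h : intervalIoo γ = {s : ℝ | ENNReal.ofReal s < γ} ∩ Ioi 0 := by
    ext s; exact and_comm
  rw [h, volume_ofReal_lt]

/-- For `0 < t < |{2 ^ k < |f|}|` one has `2 ^ k * t ≤ ∫₀ᵗ f* ≤ ψ t`, so `t` is one of the numbers
in the supremum. -/
theorem distribFun_le_levelMeasure (W : IsConcaveWeight ψ γ) {f : marcinkiewiczSpace ψ γ}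
    (hf : ‖f‖ ≤ 1) (k : ℤ) :
    distribFun (volume.restrict (intervalIoo γ)) f.1 ((2 : ℝ) ^ k) ≤ levelMeasure ψ γ k := by
  by_contra! hlt
  obtain ⟨t, ht1, ht2⟩ := ENNReal.lt_iff_exists_nnreal_btwn.1 hlt
  have hk : (0 : ℝ) < 2 ^ k := by positivity
  have ht0 : (0 : ℝ) < t := by
    have := pos_of_gt ht1
    simpa using this
  have htγ : (t : ℝ) ∈ intervalIoo γ := by
    refine ⟨ht0, ?_⟩
    rw [ENNReal.ofReal_coe_nnreal]
    refine ht2.trans_le ((measure_mono (subset_univ _)).trans ?_)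
    rw [Measure.restrict_apply_univ]
    exact volume_intervalIoo_le γ
  have hK := (marcinkiewiczSpace.norm_le_iff W.pos zero_le_one).1 hf t htγ
  have hlow : ENNReal.ofReal ((2 : ℝ) ^ k * t)
      ≤ ∫⁻ s in Ioo 0 (t : ℝ), rearrangement (volume.restrict (intervalIoo γ)) f.1 s := by
    calc ENNReal.ofReal ((2 : ℝ) ^ k * t)
        = ∫⁻ _ in Ioo 0 (t : ℝ), ENNReal.ofReal ((2 : ℝ) ^ k) := by
          rw [setLIntegral_const, Real.volume_Ioo, sub_zero, ENNReal.ofReal_mul hk.le]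
      _ ≤ _ := by
          refine setLIntegral_mono' measurableSet_Ioo fun s hs => ?_
          refine ((lt_rearrangement_iff hk.le).2 ?_).le
          refine lt_of_le_of_lt (ENNReal.ofReal_le_ofReal hs.2.le) ?_
          rwa [ENNReal.ofReal_coe_nnreal]
  have hle : (2 : ℝ) ^ k * t ≤ ψ t := by
    have := hlow.trans hK
    rwa [one_mul, ENNReal.ofReal_le_ofReal_iff (W.pos _ htγ).le] at this
  have : ENNReal.ofReal (t : ℝ) ≤ levelMeasure ψ γ k :=
    le_iSup₂ (f := fun (t : ℝ) (_ : t ∈ {t | t ∈ intervalIoo γ ∧ (2 : ℝ) ^ k * t ≤ ψ t}) =>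
      ENNReal.ofReal t) (t : ℝ) ⟨htγ, hle⟩
  rw [ENNReal.ofReal_coe_nnreal] at this
  exact absurd ht1 (not_lt.2 this)

theorem lintegral_rearrangement_le_mul {α : Type*} [MeasurableSpace α] {μ : Measure α} {g : α → ℝ}
    (hg : AEMeasurable g μ) {M t : ℝ} (hM : 0 ≤ M) (h : ∀ x, |g x| ≤ M) :
    ∫⁻ u in Ioo 0 t, rearrangement μ g u ≤ ENNReal.ofReal t * ENNReal.ofReal M := by
  refine (lintegral_rearrangement_le hg t hM).trans ?_
  have h0 : ∀ x, ENNReal.ofReal (|g x| - M) = 0 := fun x =>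
    ENNReal.ofReal_of_nonpos (by linarith [h x])
  simp [h0]

/-- Truncation at `s = M (m / t) ^ q⁻¹`: since `(|g| - s)₊ ≤ s ^ (1 - q) |g| ^ q`, this level bounds
both the truncated part and the excess by `t s`, whence the factor `2`. -/
theorem lintegral_rearrangement_le_rpow {α : Type*} [MeasurableSpace α] {μ : Measure α} {g : α → ℝ}
    (hg : AEMeasurable g μ) {q M m t : ℝ} (hq : 1 ≤ q) (hM : 0 < M) (hm : 0 < m) (ht : 0 < t)
    (h : ∫⁻ x, ‖g x‖ₑ ^ q ∂μ ≤ ENNReal.ofReal (m * M ^ q)) :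
    ∫⁻ u in Ioo 0 t, rearrangement μ g u ≤ ENNReal.ofReal (2 * M * t * (m / t) ^ q⁻¹) := by
  have hq0 : 0 < q := by linarith
  set a := (m / t) ^ q⁻¹ with ha
  have ha0 : 0 < a := by positivity
  have haq : a ^ q = m / t := Real.rpow_inv_rpow (by positivity) hq0.ne'
  set s := M * a with hs
  have hs0 : 0 < s := by positivity
  have hpt : ∀ x, ENNReal.ofReal (|g x| - s) ≤ ENNReal.ofReal (s ^ (1 - q)) * ‖g x‖ₑ ^ q := by
    intro x
    rcases le_or_gt (|g x|) s with hx | hx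
    · rw [ENNReal.ofReal_of_nonpos (by linarith)]; exact zero_le
    · have hgx : 0 < |g x| := hs0.trans hx
      rw [Real.enorm_eq_ofReal_abs, ENNReal.ofReal_rpow_of_nonneg (abs_nonneg _) hq0.le,
        ← ENNReal.ofReal_mul (by positivity)]
      refine ENNReal.ofReal_le_ofReal ?_
      calc |g x| - s ≤ |g x| := by linarith
        _ = |g x| ^ (1 - q) * |g x| ^ q := by
            rw [← Real.rpow_add hgx, sub_add_cancel, Real.rpow_one]
        _ ≤ s ^ (1 - q) * |g x| ^ q := by
            exact mul_le_mul_of_nonneg_right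
              (Real.rpow_le_rpow_of_nonpos hs0 hx.le (by linarith)) (by positivity)
  calc ∫⁻ u in Ioo 0 t, rearrangement μ g u
      ≤ ENNReal.ofReal t * ENNReal.ofReal s + ∫⁻ x, ENNReal.ofReal (|g x| - s) ∂μ :=
        lintegral_rearrangement_le hg t hs0.le
    _ ≤ ENNReal.ofReal t * ENNReal.ofReal s
        + ENNReal.ofReal (s ^ (1 - q)) * ENNReal.ofReal (m * M ^ q) := by
        gcongr
        refine (lintegral_mono hpt).trans ?_
        rw [lintegral_const_mul' _ _ ENNReal.ofReal_ne_top]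
        gcongr
    _ = ENNReal.ofReal (2 * M * t * a) := by
        rw [← ENNReal.ofReal_mul ht.le, ← ENNReal.ofReal_mul (by positivity),
          ← ENNReal.ofReal_add (by positivity) (by positivity)]
        congr 1
        have h1 : s ^ (1 - q) * (m * M ^ q) = t * s := by
          have h2 : m * M ^ q = t * s ^ q := by
            rw [hs, Real.mul_rpow hM.le ha0.le, haq]; field_simp
          rw [h2, mul_left_comm, ← Real.rpow_add hs0, sub_add_cancel, Real.rpow_one]
        rw [h1, hs]; ring

/-- The bound for the contribution of one level of a grid. -/
theorem lintegral_rearrangement_le_level {q : ℝ} (hq : 1 ≤ q) {k : ℤ} {g : ℝ → ℝ}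
    (hg : Measurable g) {M t : ℝ} (hM : 0 < M) (ht : 0 < t)
    (hm : levelMeasure ψ γ k ≠ ∞)
    (h : ∫⁻ x, ‖g x‖ₑ ^ q ∂levelScaledMeasure ψ γ k ≤ ENNReal.ofReal (M ^ q)) :
    ∫⁻ u in Ioo 0 t, rearrangement (volume.restrict (intervalIoo γ)) g u
      ≤ ENNReal.ofReal (2 * M * t * ((levelMeasure ψ γ k).toReal / t) ^ q⁻¹) := by
  have hq0 : 0 < q := by linarith
  rw [levelScaledMeasure, lintegral_smul_measure, smul_eq_mul] at h
  -- In this case the scaled measure is `∞` times Lebesgue measure, and finite energy forces `g = 0`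
  -- almost everywhere.
  by_cases h0 : levelMeasure ψ γ k = 0
  · rw [h0, ENNReal.inv_zero] at h
    have h1 : ∫⁻ x, ‖g x‖ₑ ^ q ∂volume.restrict (intervalIoo γ) = 0 := by
      by_contra hne
      rw [ENNReal.top_mul hne] at h
      exact absurd h (not_le.2 ENNReal.ofReal_lt_top)
    rw [lintegral_eq_zero_iff (hg.enorm.pow_const q)] at h1
    refine (lintegral_rearrangement_le hg.aemeasurable t le_rfl).trans ?_
    have h2 : ∫⁻ x, ENNReal.ofReal (|g x| - 0) ∂volume.restrict (intervalIoo γ) = 0 := by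
      rw [lintegral_eq_zero_iff (by fun_prop)]
      filter_upwards [h1] with x hx
      have hx' : ‖g x‖ₑ ^ q = 0 := hx
      rw [ENNReal.rpow_eq_zero_iff_of_pos hq0, enorm_eq_zero] at hx'
      simp [hx']
    rw [h2]
    simp
  · refine lintegral_rearrangement_le_rpow hg.aemeasurable hq hM (ENNReal.toReal_pos h0 hm) ht ?_
    rw [ENNReal.inv_mul_le_iff h0 hm] at h
    rwa [ENNReal.ofReal_mul ENNReal.toReal_nonneg, ENNReal.ofReal_toReal hm]

/-- `ψ s / s` does not increase, so `2 ^ k * s ≤ ψ s` fails for every `s` beyond `t`. -/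
theorem levelMeasure_le (W : IsConcaveWeight ψ γ) {k : ℤ} {t : ℝ} (ht : t ∈ intervalIoo γ)
    (hk : ψ t / t < (2 : ℝ) ^ k) : levelMeasure ψ γ k ≤ ENNReal.ofReal t := by
  refine iSup₂_le fun s hs => ENNReal.ofReal_le_ofReal ?_
  by_contra! hts
  have h1 := W.div_le_div hs.1 ht.1 hts.le
  have h2 : (2 : ℝ) ^ k ≤ ψ s / s := (le_div_iff₀ hs.1.1).2 hs.2
  linarith

/-- Dyadic bound for a power of `levelMeasure`. -/
theorem rpow_levelMeasure_le (W : IsConcaveWeight ψ γ) {p : ℝ} (hp : 0 < p) {k : ℤ} {t : ℝ}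
    (ht : t ∈ intervalIoo γ) (hk : ψ t / t < (2 : ℝ) ^ k) :
    ENNReal.ofReal (((levelMeasure ψ γ k).toReal / t) ^ p)
      ≤ ∑' j : ℕ, if (2 : ℝ) ^ k ≤ ψ (t / 2 ^ (j + 1)) / (t / 2 ^ (j + 1))
          then ENNReal.ofReal ((1 / 2 ^ j : ℝ) ^ p) else 0 := by
  have hm := levelMeasure_le W ht hk
  have hmtop : levelMeasure ψ γ k ≠ ∞ := (hm.trans_lt ENNReal.ofReal_lt_top).ne
  set m := (levelMeasure ψ γ k).toReal with hmdef
  have hm' : m ≤ t := ENNReal.toReal_le_of_le_ofReal ht.1.le hm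
  have ht0 := ht.1
  rcases (ENNReal.toReal_nonneg (a := levelMeasure ψ γ k)).eq_or_lt with h0 | h0
  · rw [hmdef, ← h0, zero_div, Real.zero_rpow hp.ne']
    simp
  -- With `2⁻⁽ʲ⁺¹⁾ < m / t ≤ 2⁻ʲ`, the point `t / 2 ^ (j + 1)` lies below the supremum `m`, so the
  -- `j`-th condition holds. The bound is stated as a sum over all `j` so that it can be
  -- interchanged with the sum over the levels `k`.
  obtain ⟨j, hj1, hj2⟩ := exists_nat_pow_near_of_lt_one (x := m / t) (y := 1 / 2)
    (div_pos h0 ht0) ((div_le_one ht0).2 hm') (by norm_num) (by norm_num)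
  refine le_trans ?_ (ENNReal.le_tsum j)
  have hlt : t / 2 ^ (j + 1) < m := by
    rw [lt_div_iff₀ ht0, one_div, inv_pow, inv_mul_eq_div] at hj1
    exact hj1
  have hlt' : ENNReal.ofReal (t / 2 ^ (j + 1)) < levelMeasure ψ γ k := by
    rw [← ENNReal.ofReal_toReal hmtop]
    exact (ENNReal.ofReal_lt_ofReal_iff h0).2 hlt
  obtain ⟨s, hs⟩ := lt_iSup_iff.1 hlt'
  obtain ⟨hsS, hs⟩ := lt_iSup_iff.1 hs
  have hst : t / 2 ^ (j + 1) < s := (ENNReal.ofReal_lt_ofReal_iff hsS.1.1).1 hs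
  have hpos : 0 < t / 2 ^ (j + 1) := by positivity
  have h1 := W.div_le_div hsS.1 hpos hst.le
  have h2 : (2 : ℝ) ^ k ≤ ψ s / s := (le_div_iff₀ hsS.1.1).2 hsS.2
  rw [if_pos (h2.trans h1)]
  refine ENNReal.ofReal_le_ofReal (Real.rpow_le_rpow (by positivity) ?_ hp.le)
  rwa [one_div_pow] at hj2

/-- The sum of the contributions of all levels is controlled by the weight. -/
theorem exists_tsum_level_le (W : IsConcaveWeight ψ γ) {C κ q : ℝ} (hC : 0 < C) (hκ : 1 < κ)
    (hdecay : ∀ t ∈ intervalIoo γ, ∀ j : ℕ, κ ^ j * ψ (t / 2 ^ j) ≤ C * ψ t) (hq : 1 ≤ q)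
    (hqκ : (2 : ℝ) ^ (1 - q⁻¹) < κ) :
    ∃ A > 0, ∀ M > 0, ∀ g : ℤ → ℝ → ℝ, (∀ k, Measurable (g k)) → (∀ k x, |g k x| ≤ M) →
      (∀ k, ∫⁻ x, ‖g k x‖ₑ ^ q ∂levelScaledMeasure ψ γ k ≤ ENNReal.ofReal (M ^ q)) →
      ∀ t ∈ intervalIoo γ, ∑' k : ℤ, ∫⁻ u in Ioo 0 t,
        rearrangement (volume.restrict (intervalIoo γ)) (fun x => (2 : ℝ) ^ (k + 1) * g k x) u
          ≤ ENNReal.ofReal (A * M * ψ t) := by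
  have hq0 : 0 < q := by linarith
  have hκ0 : 0 < κ := by linarith
  set ρ := (2 : ℝ) ^ (1 - q⁻¹) / κ with hρ
  have hρ0 : 0 < ρ := by positivity
  have hρ1 : ρ < 1 := (div_lt_one hκ0).2 hqκ
  have h1ρ : 0 < 1 - ρ := by linarith
  refine ⟨4 + 16 * C * (1 - ρ)⁻¹, by positivity, ?_⟩
  intro M hM g hg hgM hgq t ht
  have ht0 := ht.1
  have hψt := W.pos t ht
  set m := volume.restrict (intervalIoo γ) with hmdef
  set w := ψ t / t with hw
  have hw0 : 0 < w := by positivity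
  set v : ℕ → ℝ := fun j => ψ (t / 2 ^ (j + 1)) / (t / 2 ^ (j + 1)) with hv
  have hv0 : ∀ j, 0 < v j := fun j => by
    have := W.pos _ (intervalIoo_of_le ht (s := t / 2 ^ (j + 1)) (by positivity)
      (div_le_self ht0.le (one_le_pow₀ (by norm_num))))
    positivity
  -- Levels with `2 ^ k ≤ ψ t / t` are estimated by the supremum norm and sum geometrically to a
  -- multiple of `ψ t`. Higher levels have `levelMeasure` at most `t`, and the `L^q` bound gains the
  -- factor `(levelMeasure / t) ^ q⁻¹`.
  have hterm : ∀ k : ℤ, ∫⁻ u in Ioo 0 t, rearrangement m (fun x => (2 : ℝ) ^ (k + 1) * g k x) u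
      ≤ ENNReal.ofReal (2 * M * t) * (if (2 : ℝ) ^ k ≤ w then ENNReal.ofReal ((2 : ℝ) ^ k) else 0)
        + ENNReal.ofReal (4 * M * t) * ∑' j : ℕ, ENNReal.ofReal ((1 / 2 ^ j : ℝ) ^ q⁻¹) *
          (if (2 : ℝ) ^ k ≤ v j then ENNReal.ofReal ((2 : ℝ) ^ k) else 0) := by
    intro k
    have hk0 : (0 : ℝ) < 2 ^ (k + 1) := by positivity
    have hsm : ∫⁻ u in Ioo 0 t, rearrangement m (fun x => (2 : ℝ) ^ (k + 1) * g k x) u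
        = ENNReal.ofReal ((2 : ℝ) ^ (k + 1)) * ∫⁻ u in Ioo 0 t, rearrangement m (g k) u := by
      rw [← lintegral_const_mul' _ _ ENNReal.ofReal_ne_top]
      refine lintegral_congr fun u => ?_
      have := rearrangement_smul (μ := m) ((2 : ℝ) ^ (k + 1)) (g k) u
      rw [abs_of_pos hk0] at this
      exact this
    rw [hsm]
    have h2k : (2 : ℝ) ^ (k + 1) = 2 * 2 ^ k := by rw [zpow_add_one₀ (by norm_num)]; ring
    rcases le_or_gt ((2 : ℝ) ^ k) w with hkw | hkw
    · refine le_trans ?_ le_self_add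
      rw [if_pos hkw]
      refine (mul_le_mul_right (lintegral_rearrangement_le_mul (hg k).aemeasurable hM.le (hgM k))
        _).trans (le_of_eq ?_)
      rw [← ENNReal.ofReal_mul ht0.le, ← ENNReal.ofReal_mul hk0.le,
        ← ENNReal.ofReal_mul (by positivity), h2k]
      congr 1; ring
    · refine le_trans ?_ le_add_self
      have hmtop : levelMeasure ψ γ k ≠ ∞ :=
        ((levelMeasure_le W ht hkw).trans_lt ENNReal.ofReal_lt_top).ne
      refine (mul_le_mul_right (lintegral_rearrangement_le_level hq (hg k) hM ht0 hmtop (hgq k))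
        _).trans ?_
      rw [ENNReal.ofReal_mul (by positivity : 0 ≤ 2 * M * t), ← mul_assoc,
        ← ENNReal.ofReal_mul hk0.le]
      have hd := rpow_levelMeasure_le W (inv_pos.2 hq0) ht hkw
      calc ENNReal.ofReal (2 ^ (k + 1) * (2 * M * t))
            * ENNReal.ofReal (((levelMeasure ψ γ k).toReal / t) ^ q⁻¹)
          ≤ ENNReal.ofReal (2 ^ (k + 1) * (2 * M * t)) * ∑' j : ℕ, if (2 : ℝ) ^ k ≤ v j
              then ENNReal.ofReal ((1 / 2 ^ j : ℝ) ^ q⁻¹) else 0 := mul_le_mul_right hd _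
        _ = ENNReal.ofReal (4 * M * t) * (ENNReal.ofReal (2 ^ k) * ∑' j : ℕ, if (2 : ℝ) ^ k ≤ v j
              then ENNReal.ofReal ((1 / 2 ^ j : ℝ) ^ q⁻¹) else 0) := by
            rw [← mul_assoc (ENNReal.ofReal (4 * M * t)), ← ENNReal.ofReal_mul (by positivity), h2k]
            congr 2; ring
        _ = _ := by
            rw [← ENNReal.tsum_mul_left]
            congr 1
            refine tsum_congr fun j => ?_
            split_ifs
            · rw [mul_comm]
            · simp
  have hfirst : ∑' k : ℤ, (if (2 : ℝ) ^ k ≤ w then ENNReal.ofReal ((2 : ℝ) ^ k) else 0)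
      ≤ ENNReal.ofReal (2 * w) := tsum_zpow_le w hw0
  -- The decay lets `v j` grow at most like `(2 / κ) ^ j`. The gain `2 ^ (-j / q)` turns this into
  -- the convergent ratio `ρ = 2 ^ (1 - q⁻¹) / κ`.
  have hvle : ∀ j, v j * (1 / 2 ^ j : ℝ) ^ q⁻¹ ≤ 2 * C * w * ρ ^ j := by
    intro j
    have h1 := hdecay t ht (j + 1)
    have h2 : v j ≤ 2 * C * w * (2 / κ) ^ j := by
      have h3 : ψ (t / 2 ^ (j + 1)) ≤ C * ψ t / κ ^ (j + 1) := by
        rw [le_div_iff₀ (by positivity)]; linarith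
      have h4 : κ ^ j ≤ κ ^ (j + 1) := pow_le_pow_right₀ hκ.le (by omega)
      calc v j ≤ (C * ψ t / κ ^ (j + 1)) / (t / 2 ^ (j + 1)) := by
            simp only [hv]; gcongr
        _ ≤ (C * ψ t / κ ^ j) / (t / 2 ^ (j + 1)) := by gcongr
        _ = 2 * C * w * (2 / κ) ^ j := by
            rw [hw, div_pow, pow_succ]; field_simp
    have h5 : ρ ^ j = (2 / κ) ^ j * (1 / 2 ^ j : ℝ) ^ q⁻¹ := by
      have h6 : (1 / 2 ^ j : ℝ) ^ q⁻¹ = ((2 : ℝ) ^ (-q⁻¹)) ^ j := by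
        rw [← Real.rpow_natCast ((2 : ℝ) ^ (-q⁻¹)) j, ← Real.rpow_mul (by norm_num), one_div,
          Real.inv_rpow (by positivity), ← Real.rpow_natCast (2 : ℝ) j,
          ← Real.rpow_mul (by norm_num), ← Real.rpow_neg (by norm_num)]
        congr 1; ring
      rw [h6, ← mul_pow, hρ, sub_eq_add_neg, Real.rpow_add (by norm_num), Real.rpow_one]
      congr 1; ring
    rw [h5, ← mul_assoc]
    gcongr
  have hsecond : ∑' k : ℤ, ∑' j : ℕ, ENNReal.ofReal ((1 / 2 ^ j : ℝ) ^ q⁻¹) *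
      (if (2 : ℝ) ^ k ≤ v j then ENNReal.ofReal ((2 : ℝ) ^ k) else 0)
      ≤ ENNReal.ofReal (4 * C * w * (1 - ρ)⁻¹) := by
    rw [ENNReal.tsum_comm]
    have hgeo : Summable fun j : ℕ => 4 * C * w * ρ ^ j :=
      (summable_geometric_of_lt_one hρ0.le hρ1).mul_left _
    calc ∑' j : ℕ, ∑' k : ℤ, ENNReal.ofReal ((1 / 2 ^ j : ℝ) ^ q⁻¹) *
          (if (2 : ℝ) ^ k ≤ v j then ENNReal.ofReal ((2 : ℝ) ^ k) else 0)
        ≤ ∑' j : ℕ, ENNReal.ofReal (4 * C * w * ρ ^ j) := by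
          refine ENNReal.tsum_le_tsum fun j => ?_
          rw [ENNReal.tsum_mul_left]
          refine (mul_le_mul_right (tsum_zpow_le (v j) (hv0 j)) _).trans ?_
          rw [← ENNReal.ofReal_mul (by positivity)]
          refine ENNReal.ofReal_le_ofReal ?_
          have := hvle j
          linarith
      _ = ENNReal.ofReal (4 * C * w * (1 - ρ)⁻¹) := by
          rw [← ENNReal.ofReal_tsum_of_nonneg (fun j => by positivity) hgeo, tsum_mul_left,
            tsum_geometric_of_lt_one hρ0.le hρ1]
  calc ∑' k : ℤ, ∫⁻ u in Ioo 0 t, rearrangement m (fun x => (2 : ℝ) ^ (k + 1) * g k x) u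
      ≤ ∑' k : ℤ, (ENNReal.ofReal (2 * M * t) *
            (if (2 : ℝ) ^ k ≤ w then ENNReal.ofReal ((2 : ℝ) ^ k) else 0)
          + ENNReal.ofReal (4 * M * t) * ∑' j : ℕ, ENNReal.ofReal ((1 / 2 ^ j : ℝ) ^ q⁻¹) *
            (if (2 : ℝ) ^ k ≤ v j then ENNReal.ofReal ((2 : ℝ) ^ k) else 0)) :=
        ENNReal.tsum_le_tsum hterm
    _ ≤ ENNReal.ofReal (2 * M * t) * ENNReal.ofReal (2 * w)
        + ENNReal.ofReal (4 * M * t) * ENNReal.ofReal (4 * C * w * (1 - ρ)⁻¹) := by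
        rw [ENNReal.tsum_add, ENNReal.tsum_mul_left, ENNReal.tsum_mul_left]
        gcongr
    _ = ENNReal.ofReal ((4 + 16 * C * (1 - ρ)⁻¹) * M * ψ t) := by
        rw [← ENNReal.ofReal_mul (by positivity), ← ENNReal.ofReal_mul (by positivity),
          ← ENNReal.ofReal_add (by positivity) (by positivity)]
        congr 1
        rw [hw]; field_simp; ring

end Quotient

/-! ### Dyadic layers and the quotient map -/

section Sufficiency

variable {ψ : ℝ → ℝ} {γ : ℝ≥0∞}

/-- Set `1 - q⁻¹ = s` with `s < log₂ κ`; the cap `s ≤ 1 / 2` gives `q ≤ 2`, as the smoothness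
inequality requires. -/
theorem exists_exponent {κ : ℝ} (hκ : 1 < κ) :
    ∃ q : ℝ, 1 < q ∧ q ≤ 2 ∧ (2 : ℝ) ^ (1 - q⁻¹) < κ := by
  have hlog : 0 < Real.logb 2 κ := Real.logb_pos (by norm_num) hκ
  set s := min (1 / 2) (Real.logb 2 κ / 2) with hs
  have hs0 : 0 < s := lt_min (by norm_num) (by positivity)
  have hs1 : s ≤ 1 / 2 := min_le_left _ _
  have hs2 : s < Real.logb 2 κ := (min_le_right _ _).trans_lt (half_lt_self hlog)
  refine ⟨(1 - s)⁻¹, ?_, ?_, ?_⟩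
  · rw [one_lt_inv₀ (by linarith)]; linarith
  · rw [inv_le_comm₀ (by linarith) (by norm_num)]; linarith
  · rw [inv_inv, sub_sub_cancel]
    calc (2 : ℝ) ^ s < 2 ^ Real.logb 2 κ := Real.rpow_lt_rpow_of_exponent_lt (by norm_num) hs2
      _ = κ := Real.rpow_logb (by norm_num) (by norm_num) (by linarith)

/-- The part of `f` with values in the dyadic layer `(2 ^ k, 2 ^ (k + 1)]`, normalised. -/
noncomputable def dyadicLayer (f : ℝ → ℝ) (k : ℤ) : ℝ → ℝ :=
  {x | (2 : ℝ) ^ k < |f x| ∧ |f x| ≤ 2 ^ (k + 1)}.indicator fun x => f x / 2 ^ (k + 1)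

theorem measurable_dyadicLayer {f : ℝ → ℝ} (hf : Measurable f) (k : ℤ) :
    Measurable (dyadicLayer f k) :=
  (hf.div_const _).indicator ((measurableSet_lt measurable_const hf.abs).inter
    (measurableSet_le hf.abs measurable_const))

theorem abs_dyadicLayer_le (f : ℝ → ℝ) (k : ℤ) (x : ℝ) :
    |dyadicLayer f k x| ≤ {x | (2 : ℝ) ^ k < |f x|}.indicator 1 x := by
  have h2 : (0 : ℝ) < 2 ^ (k + 1) := by positivity
  by_cases hx : (2 : ℝ) ^ k < |f x| ∧ |f x| ≤ 2 ^ (k + 1)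
  · rw [dyadicLayer, indicator_of_mem (by exact hx), indicator_of_mem (by exact hx.1), abs_div,
      abs_of_pos h2]
    exact (div_le_one h2).2 hx.2
  · rw [dyadicLayer, indicator_of_notMem (by exact hx), abs_zero]
    exact indicator_nonneg (fun _ _ => zero_le_one) _

theorem tsum_dyadicLayer (f : ℝ → ℝ) (x : ℝ) :
    ∑' k : ℤ, (2 : ℝ) ^ (k + 1) * dyadicLayer f k x = f x := by
  rcases eq_or_ne (f x) 0 with h0 | h0
  · rw [h0]
    refine (tsum_congr fun k => ?_).trans tsum_zero
    simp [dyadicLayer, indicator, h0]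
  obtain ⟨k, hk⟩ := exists_mem_Ioc_zpow (abs_pos.2 h0) (one_lt_two (α := ℝ))
  rw [tsum_eq_single k]
  · rw [dyadicLayer, indicator_of_mem (by exact hk), mul_div_cancel₀ _ (by positivity)]
  · intro j hj
    rw [dyadicLayer, indicator_of_notMem, mul_zero]
    rintro ⟨h1, h2⟩
    have h3 : j < k + 1 := (zpow_lt_zpow_iff_right₀ (one_lt_two (α := ℝ))).1 (h1.trans_le hk.2)
    have h4 : k < j + 1 := (zpow_lt_zpow_iff_right₀ (one_lt_two (α := ℝ))).1 (hk.1.trans_le h2)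
    omega

/-- If the weight decays geometrically at `0` then the Marcinkiewicz space is a quotient of a grid
space. -/
theorem exists_grid_quotient (W : IsConcaveWeight ψ γ) (hγ : 0 < γ) {C κ q : ℝ} (hC : 0 < C)
    (hκ : 1 < κ)
    (hdecay : ∀ t ∈ intervalIoo γ, ∀ j : ℕ, κ ^ j * ψ (t / 2 ^ j) ≤ C * ψ t) (hq : 1 ≤ q)
    (hqκ : (2 : ℝ) ^ (1 - q⁻¹) < κ) :
    ∃ (Q : gridSpace (levelScaledMeasure ψ γ) hq →ₗ[ℝ] marcinkiewiczSpace ψ γ) (A : ℝ),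
      (∀ g, ‖Q g‖ ≤ A * gridNorm (levelScaledMeasure ψ γ) hq g) ∧
      ∀ f, ‖f‖ ≤ 1 → ∃ g, gridNorm (levelScaledMeasure ψ γ) hq g ≤ 1 ∧ Q g = f := by
  obtain ⟨A, hA, hsum⟩ := exists_tsum_level_le W hC hκ hdecay hq hqκ
  set m := volume.restrict (intervalIoo γ) with hm
  set N := gridNorm (levelScaledMeasure ψ γ) hq with hN
  have hN0 : ∀ g, 0 ≤ N g := fun g => apply_nonneg N g
  have hK : ∀ g : gridSpace (levelScaledMeasure ψ γ) hq, ∀ M, 0 < M → N g ≤ M →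
      ∀ t ∈ intervalIoo γ, ∑' k : ℤ, ∫⁻ u in Ioo 0 t,
        rearrangement m (fun x => (2 : ℝ) ^ (k + 1) * g.1 k x) u ≤ ENNReal.ofReal (A * M * ψ t) := by
    intro g M hM hgM
    obtain ⟨h1, h2⟩ := (gridNorm_le_iff hM.le).1 hgM
    exact hsum M hM g.1 (gridSpace.measurable g) h1 h2
  have hmeas : ∀ (g : gridSpace (levelScaledMeasure ψ γ) hq) (k : ℤ),
      AEMeasurable (fun x => (2 : ℝ) ^ (k + 1) * g.1 k x) m := fun g k =>
    ((gridSpace.measurable g k).const_mul _).aemeasurable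
  obtain ⟨t₀, ht₀⟩ := intervalIoo_nonempty hγ
  have hfin : ∀ g : gridSpace (levelScaledMeasure ψ γ) hq, ∀ᵐ x ∂m,
      ∑' k : ℤ, ‖(2 : ℝ) ^ (k + 1) * g.1 k x‖ₑ < ∞ := fun g =>
    ae_tsum_enorm_lt_top (hmeas g) ht₀.1
      ((hK g (N g + 1) (by linarith [hN0 g]) (by linarith) t₀ ht₀).trans_lt ENNReal.ofReal_lt_top).ne
  have hsummable : ∀ g : gridSpace (levelScaledMeasure ψ γ) hq, ∀ᵐ x ∂m,
      Summable fun k : ℤ => (2 : ℝ) ^ (k + 1) * g.1 k x := by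
    intro g
    filter_upwards [hfin g] with x hx
    refine Summable.of_norm ?_
    simpa only [toReal_enorm] using ENNReal.summable_toReal hx.ne
  have hSmeas : ∀ g : gridSpace (levelScaledMeasure ψ γ) hq,
      AEStronglyMeasurable (fun x => ∑' k : ℤ, (2 : ℝ) ^ (k + 1) * g.1 k x) m := by
    intro g
    refine aestronglyMeasurable_of_tendsto_ae (atTop : Filter (Finset ℤ))
      (f := fun s x => ∑ k ∈ s, (2 : ℝ) ^ (k + 1) * g.1 k x)
      (fun s => Finset.aestronglyMeasurable_fun_sum _ fun k _ => (hmeas g k).aestronglyMeasurable) ?_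
    filter_upwards [hsummable g] with x hx using hx.hasSum
  have hbound : ∀ g : gridSpace (levelScaledMeasure ψ γ) hq, ∀ M, 0 < M → N g ≤ M →
      ∀ t ∈ intervalIoo γ, ∫⁻ u in Ioo 0 t, rearrangement m (AEEqFun.mk _ (hSmeas g)) u
        ≤ ENNReal.ofReal (A * M * ψ t) := by
    intro g M hM hgM t ht
    rw [rearrangement_congr (AEEqFun.coeFn_mk _ (hSmeas g))]
    refine (lintegral_rearrangement_le_tsum (hmeas g) (hSmeas g).aemeasurable ht.1 ?_).trans
      (hK g M hM hgM t ht)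
    exact Eventually.of_forall fun x => enorm_tsum_le_tsum_enorm
  set Q : gridSpace (levelScaledMeasure ψ γ) hq →ₗ[ℝ] marcinkiewiczSpace ψ γ :=
    { toFun := fun g => ⟨AEEqFun.mk _ (hSmeas g), mem_marcinkiewiczSpace W.pos
        (by have := hN0 g; positivity) (hbound g (N g + 1) (by linarith [hN0 g]) (by linarith))⟩
      map_add' := fun f g => by
        refine Subtype.ext ?_
        change AEEqFun.mk _ (hSmeas (f + g)) = AEEqFun.mk _ (hSmeas f) + AEEqFun.mk _ (hSmeas g)
        rw [AEEqFun.mk_add_mk, AEEqFun.mk_eq_mk]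
        filter_upwards [hsummable f, hsummable g] with x hf hg
        change ∑' k : ℤ, (2 : ℝ) ^ (k + 1) * (f.1 k x + g.1 k x) = _
        simp only [mul_add]
        exact hf.tsum_add hg
      map_smul' := fun c g => by
        refine Subtype.ext ?_
        change AEEqFun.mk _ (hSmeas (c • g)) = c • AEEqFun.mk _ (hSmeas g)
        rw [AEEqFun.smul_mk, AEEqFun.mk_eq_mk]
        refine Eventually.of_forall fun x => ?_
        change ∑' k : ℤ, (2 : ℝ) ^ (k + 1) * (c * g.1 k x) = c * ∑' k : ℤ, _
        rw [← tsum_mul_left]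
        exact tsum_congr fun k => by ring } with hQ
  have hQ1 : ∀ g, (Q g).1 = AEEqFun.mk _ (hSmeas g) := fun g => rfl
  refine ⟨Q, A, fun g => ?_, fun f hf => ?_⟩
  -- `hbound` needs a positive bound, whereas `N g` may be `0`.
  · refine le_of_forall_pos_le_add fun ε hε => ?_
    have h1 : ‖Q g‖ ≤ A * (N g + ε / A) := by
      have h2 : 0 < N g + ε / A := by have := hN0 g; positivity
      exact (marcinkiewiczSpace.norm_le_iff W.pos (by positivity)).2
        (hbound g _ h2 (by linarith [div_pos hε hA]))
    rwa [mul_add, mul_div_cancel₀ _ hA.ne'] at h1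
  -- The lift of `f` is its family of dyadic layers: the scaling of the measures is exactly what
  -- makes their energies at most `1`.
  · have hf0 : Measurable f.1 := f.1.measurable
    have hlayer : ∀ k x, |dyadicLayer f.1 k x| ≤ 1 := fun k x =>
      (abs_dyadicLayer_le _ k x).trans (indicator_le_self' (fun _ _ => zero_le_one) _)
    have henergy : ∀ k, ∫⁻ x, ‖dyadicLayer f.1 k x‖ₑ ^ q ∂levelScaledMeasure ψ γ k
        ≤ ENNReal.ofReal (1 ^ q) := by
      intro k
      have hS : MeasurableSet {x | (2 : ℝ) ^ k < |f.1 x|} :=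
        measurableSet_lt measurable_const hf0.abs
      calc ∫⁻ x, ‖dyadicLayer f.1 k x‖ₑ ^ q ∂levelScaledMeasure ψ γ k
          ≤ ∫⁻ x, {x | (2 : ℝ) ^ k < |f.1 x|}.indicator 1 x ∂levelScaledMeasure ψ γ k := by
            refine lintegral_mono fun x => ?_
            have h := abs_dyadicLayer_le f.1 k x
            by_cases hx : x ∈ {x | (2 : ℝ) ^ k < |f.1 x|}
            · rw [indicator_of_mem hx] at h ⊢
              refine ENNReal.rpow_le_one ?_ (by linarith)
              rw [Real.enorm_eq_ofReal_abs]
              exact ENNReal.ofReal_le_one.2 h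
            · rw [indicator_of_notMem hx] at h ⊢
              rw [abs_nonpos_iff.1 h, enorm_zero, ENNReal.zero_rpow_of_pos (by linarith)]
        _ = (levelMeasure ψ γ k)⁻¹ * distribFun m f.1 ((2 : ℝ) ^ k) := by
            rw [lintegral_indicator_one hS]; rfl
        _ ≤ (levelMeasure ψ γ k)⁻¹ * levelMeasure ψ γ k :=
            mul_le_mul_right (distribFun_le_levelMeasure W hf k) _
        _ ≤ ENNReal.ofReal (1 ^ q) := by
            rw [Real.one_rpow, ENNReal.ofReal_one]
            exact ENNReal.inv_mul_le_one _
    refine ⟨⟨fun k => dyadicLayer f.1 k, mem_gridSpace zero_le_one (measurable_dyadicLayer hf0)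
      hlayer henergy⟩, (gridNorm_le_iff zero_le_one).2 ⟨hlayer, henergy⟩, Subtype.ext ?_⟩
    rw [hQ1]
    refine AEEqFun.ext ((AEEqFun.coeFn_mk _ _).trans (Eventually.of_forall fun x => ?_))
    exact tsum_dyadicLayer f.1 x

theorem isGrothendieckSpace_of_condition (W : IsConcaveWeight ψ γ) (hγ : 0 < γ)
    (h : ConditionA ψ γ ∨ ConditionB ψ γ) : IsGrothendieckSpace (marcinkiewiczSpace ψ γ) := by
  obtain ⟨C, hC, κ, hκ, hdecay⟩ := W.exists_decay h
  obtain ⟨q, hq1, hq2, hqκ⟩ := exists_exponent hκ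
  obtain ⟨Q, A, hQ, hsurj⟩ := exists_grid_quotient W hγ hC hκ hdecay hq1.le hqκ
  have := marcinkiewiczSpace.completeSpace hγ W.pos
  exact ⟨this, tendsto_weak_of_grid_quotient hq1 hq2 Q hQ hsurj⟩

end Sufficiency

/-! ### Copies of the summing basis in Marcinkiewicz spaces -/

section Necessity

variable {ψ : ℝ → ℝ} {γ : ℝ≥0∞}

theorem lintegral_rearrangement_indicator_le {μ : Measure ℝ} {S : Set ℝ} (hS : MeasurableSet S)
    {a c t : ℝ} (hc : 0 ≤ c) (ht : 0 ≤ t) (hμ : μ S ≤ ENNReal.ofReal a) :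
    ∫⁻ u in Ioo 0 t, rearrangement μ (S.indicator fun _ => c) u ≤ ENNReal.ofReal (min t a * c) := by
  have hmeas : AEMeasurable (S.indicator fun _ => c) μ :=
    (measurable_const.indicator hS).aemeasurable
  rcases le_total t a with h | h
  · rw [min_eq_left h, ENNReal.ofReal_mul ht]
    refine lintegral_rearrangement_le_mul hmeas hc fun x => ?_
    rw [abs_of_nonneg (indicator_nonneg (fun _ _ => hc) x)]
    exact indicator_le_self' (fun _ _ => hc) x
  · rw [min_eq_right h, mul_comm, ENNReal.ofReal_mul hc]
    refine (lintegral_rearrangement_le hmeas t le_rfl).trans ?_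
    have h1 : ∀ x, ENNReal.ofReal (|S.indicator (fun _ => c) x| - 0)
        = S.indicator (fun _ => ENNReal.ofReal c) x := fun x => by
      by_cases hx : x ∈ S <;> simp [hx, abs_of_nonneg hc]
    simp only [h1, ENNReal.ofReal_zero, mul_zero, zero_add, lintegral_indicator_const hS]
    gcongr

/-- A sum of multiples of indicator functions, as an element of the Marcinkiewicz space. -/
theorem exists_indicator_sum (W : IsConcaveWeight ψ γ) {κ : Type*} [Countable κ] {A : κ → Set ℝ}
    (hA : ∀ k, MeasurableSet (A k)) {a c : κ → ℝ} (hc : ∀ k, 0 ≤ c k)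
    (hvol : ∀ k, volume.restrict (intervalIoo γ) (A k) ≤ ENNReal.ofReal (a k)) {C : ℝ} (hC : 0 ≤ C)
    (hsum : ∀ t ∈ intervalIoo γ, ∑' k, ENNReal.ofReal (min t (a k) * c k)
      ≤ ENNReal.ofReal (C * ψ t)) :
    ∃ f : marcinkiewiczSpace ψ γ, ‖f‖ ≤ C ∧ f.1 =ᵐ[volume.restrict (intervalIoo γ)]
      fun x => (∑' k, ‖(A k).indicator (fun _ => c k) x‖ₑ).toReal := by
  set m := volume.restrict (intervalIoo γ) with hm
  have hmeas : ∀ k, Measurable ((A k).indicator fun _ => c k) := fun k =>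
    measurable_const.indicator (hA k)
  have hF : Measurable fun x => (∑' k, ‖(A k).indicator (fun _ => c k) x‖ₑ).toReal :=
    (Measurable.tsum fun k => (hmeas k).enorm).ennreal_toReal
  have hb : ∀ t ∈ intervalIoo γ, ∫⁻ u in Ioo 0 t,
      rearrangement m (AEEqFun.mk _ (hF.aestronglyMeasurable (μ := m))) u ≤ ENNReal.ofReal (C * ψ t) := by
    intro t ht
    rw [rearrangement_congr (AEEqFun.coeFn_mk _ _)]
    refine (lintegral_rearrangement_le_tsum (fun k => (hmeas k).aemeasurable) hF.aemeasurable ht.1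
      (Eventually.of_forall fun x => ?_)).trans ((ENNReal.tsum_le_tsum fun k => ?_).trans (hsum t ht))
    · rw [Real.enorm_of_nonneg ENNReal.toReal_nonneg]
      exact ENNReal.ofReal_toReal_le
    · exact lintegral_rearrangement_indicator_le (hA k) (hc k) ht.1.le (hvol k)
  exact ⟨⟨_, mem_marcinkiewiczSpace W.pos hC hb⟩, (marcinkiewiczSpace.norm_le_iff W.pos hC).2 hb,
    AEEqFun.coeFn_mk _ _⟩

theorem setLIntegral_enorm_le_norm (W : IsConcaveWeight ψ γ) (f : marcinkiewiczSpace ψ γ) {S : Set ℝ}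
    {a : ℝ} (ha : a ∈ intervalIoo γ)
    (hS : volume.restrict (intervalIoo γ) S ≤ ENNReal.ofReal a) :
    ∫⁻ x in S, ‖f.1 x‖ₑ ∂volume.restrict (intervalIoo γ) ≤ ENNReal.ofReal (‖f‖ * ψ a) :=
  (setLIntegral_enorm_le_lintegral_rearrangement f.1.aemeasurable ha.1 hS).trans
    (marcinkiewiczSpace.lintegral_le W.pos f ha)

theorem integrableOn_marcinkiewiczSpace (W : IsConcaveWeight ψ γ) (f : marcinkiewiczSpace ψ γ)
    {S : Set ℝ} {a : ℝ} (ha : a ∈ intervalIoo γ)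
    (hS : volume.restrict (intervalIoo γ) S ≤ ENNReal.ofReal a) :
    IntegrableOn f.1 S (volume.restrict (intervalIoo γ)) :=
  ⟨f.1.aestronglyMeasurable.restrict,
    (setLIntegral_enorm_le_norm W f ha hS).trans_lt ENNReal.ofReal_lt_top⟩

/-- The sum is at most `∫ |f|` over the union, hence at most `∫₀ᵃ f*`. This supplies the `ℓ¹` bound
for the coordinate functionals. -/
theorem sum_abs_setIntegral_le (W : IsConcaveWeight ψ γ) (f : marcinkiewiczSpace ψ γ) (n : ℕ)
    {A : ℕ → Set ℝ} (hA : ∀ j, MeasurableSet (A j)) (hdisj : Pairwise (Function.onFun Disjoint A))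
    {a : ℝ} (ha : a ∈ intervalIoo γ)
    (hS : volume.restrict (intervalIoo γ) (⋃ j ∈ Finset.range n, A j) ≤ ENNReal.ofReal a) :
    ∑ j ∈ Finset.range n, |∫ x in A j, f.1 x ∂volume.restrict (intervalIoo γ)| ≤ ψ a * ‖f‖ := by
  have h0 : 0 ≤ ‖f‖ * ψ a := mul_nonneg (norm_nonneg f) (W.pos a ha).le
  rw [mul_comm (ψ a), ← ENNReal.ofReal_le_ofReal_iff h0,
    ENNReal.ofReal_sum_of_nonneg fun _ _ => abs_nonneg _]
  refine le_trans ?_ (setLIntegral_enorm_le_norm W f ha hS)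
  rw [lintegral_biUnion_finset (fun i _ j _ hij => hdisj hij) fun j _ => hA j]
  refine Finset.sum_le_sum fun j _ => ?_
  rw [← Real.enorm_eq_ofReal_abs]
  exact enorm_integral_le_lintegral_enorm _

/-- The functional `f ↦ (ψ a)⁻¹ * ∫ x in S, f x`. -/
theorem exists_setIntegral_functional (W : IsConcaveWeight ψ γ) {S : Set ℝ} {a : ℝ}
    (ha : a ∈ intervalIoo γ) (hS : volume.restrict (intervalIoo γ) S ≤ ENNReal.ofReal a) :
    ∃ T : StrongDual ℝ (marcinkiewiczSpace ψ γ), ‖T‖ ≤ 1 ∧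
      ∀ f, T f = (ψ a)⁻¹ * ∫ x in S, f.1 x ∂volume.restrict (intervalIoo γ) := by
  set m := volume.restrict (intervalIoo γ) with hm
  have hψ := W.pos a ha
  have hint := fun f => integrableOn_marcinkiewiczSpace W f ha hS
  let L : marcinkiewiczSpace ψ γ →ₗ[ℝ] ℝ :=
    { toFun := fun f => (ψ a)⁻¹ * ∫ x in S, f.1 x ∂m
      map_add' := fun f g => by
        rw [← mul_add, ← integral_add (hint f) (hint g)]
        congr 1
        exact integral_congr_ae (ae_restrict_of_ae (AEEqFun.coeFn_add f.1 g.1))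
      map_smul' := fun c f => by
        have h : ∫ x in S, (c • f).1 x ∂m = ∫ x in S, c * f.1 x ∂m :=
          integral_congr_ae (ae_restrict_of_ae (AEEqFun.coeFn_smul c f.1))
        rw [h, integral_const_mul, RingHom.id_apply, smul_eq_mul]
        ring }
  have hL : ∀ f, ‖L f‖ ≤ 1 * ‖f‖ := fun f => by
    have h : |∫ x in S, f.1 x ∂m| ≤ ‖f‖ * ψ a := by
      rw [← ENNReal.ofReal_le_ofReal_iff (by positivity), ← Real.enorm_eq_ofReal_abs]
      exact (enorm_integral_le_lintegral_enorm _).trans (setLIntegral_enorm_le_norm W f ha hS)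
    change |(ψ a)⁻¹ * ∫ x in S, f.1 x ∂m| ≤ _
    rw [abs_mul, abs_of_pos (inv_pos.2 hψ), one_mul, inv_mul_le_iff₀ hψ, mul_comm]
    exact h
  exact ⟨L.mkContinuous 1 hL, L.mkContinuous_norm_le zero_le_one hL, fun f => rfl⟩

/-- This bounds by `1` the norm of `ψ a / a` times the indicator of a set of measure `a`. -/
theorem IsConcaveWeight.min_mul_div_le (W : IsConcaveWeight ψ γ) {a t : ℝ} (ha : a ∈ intervalIoo γ)
    (ht : t ∈ intervalIoo γ) : min t a * (ψ a / a) ≤ ψ t := by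
  have ha0 := ha.1
  rcases le_total t a with h | h
  · rw [min_eq_left h, mul_div_assoc', div_le_iff₀ ha0, mul_comm (ψ t)]
    exact W.mul_le ha ht.1.le h
  · rw [min_eq_right h, mul_div_cancel₀ _ ha0.ne']
    exact W.le ht ha0 h

/-- Disjoint sets on which the weight is almost constant yield a copy of the summing basis. -/
theorem not_isGrothendieckSpace_of_disjoint (W : IsConcaveWeight ψ γ) {A : ℕ → Set ℝ} {a : ℕ → ℝ}
    (hA : ∀ j, MeasurableSet (A j)) (hdisj : Pairwise (Function.onFun Disjoint A))
    (ha : ∀ j, a j ∈ intervalIoo γ)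
    (hvol : ∀ j, volume.restrict (intervalIoo γ) (A j) = ENNReal.ofReal (a j)) {C : ℝ} (hC : 1 ≤ C)
    {s : ℕ → ℝ} (hs : ∀ n, s n ∈ intervalIoo γ)
    (hU : ∀ n, volume.restrict (intervalIoo γ) (⋃ j ∈ Finset.range n, A j) ≤ ENNReal.ofReal (s n))
    (hψ : ∀ n j, ψ (s n) ≤ C * ψ (a j)) : ¬ IsGrothendieckSpace (marcinkiewiczSpace ψ γ) := by
  set m := volume.restrict (intervalIoo γ) with hm
  have hpos := fun j => W.pos _ (ha j)
  choose T hT1 hT using fun j => exists_setIntegral_functional W (ha j) (hvol j).le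
  have hf : ∀ j, ∃ f : marcinkiewiczSpace ψ γ, ‖f‖ ≤ 1 ∧
      f.1 =ᵐ[m] (A j).indicator fun _ => ψ (a j) / a j := by
    intro j
    have hc : 0 ≤ ψ (a j) / a j := div_nonneg (hpos j).le (ha j).1.le
    obtain ⟨f, hf1, hf2⟩ := exists_indicator_sum W (κ := Unit) (fun _ => hA j) (fun _ => hc)
      (fun _ => (hvol j).le) zero_le_one (fun t ht => by
        rw [tsum_fintype, Finset.univ_unique, Finset.sum_singleton, one_mul]
        exact ENNReal.ofReal_le_ofReal (W.min_mul_div_le (ha j) ht))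
    refine ⟨f, hf1, hf2.trans (Eventually.of_forall fun x => ?_)⟩
    beta_reduce
    rw [tsum_fintype, Finset.univ_unique, Finset.sum_singleton, toReal_enorm,
      Real.norm_of_nonneg (indicator_nonneg (fun _ _ => hc) x)]
  choose f hf1 hf2 using hf
  refine not_isGrothendieckSpace_of_biorthogonal T f (fun j => (hf1 j).trans hC) (fun g n => ?_)
    fun i j => ?_
  · have h1 := sum_abs_setIntegral_le W g n hA hdisj (hs n) (hU n)
    have h2 := W.pos _ (hs n)
    have h3 : ∀ j, |T j g| ≤ C * (ψ (s n))⁻¹ * |∫ x in A j, g.1 x ∂m| := by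
      intro j
      rw [hT, abs_mul, abs_of_pos (inv_pos.2 (hpos j))]
      gcongr
      rw [← div_eq_mul_inv, le_div_iff₀ h2, inv_mul_le_iff₀ (hpos j), mul_comm]
      exact hψ n j
    calc ∑ j ∈ Finset.range n, |T j g|
        ≤ ∑ j ∈ Finset.range n, C * (ψ (s n))⁻¹ * |∫ x in A j, g.1 x ∂m| :=
          Finset.sum_le_sum fun j _ => h3 j
      _ = C * (ψ (s n))⁻¹ * ∑ j ∈ Finset.range n, |∫ x in A j, g.1 x ∂m| := by
          rw [Finset.mul_sum]
      _ ≤ C * (ψ (s n))⁻¹ * (ψ (s n) * ‖g‖) := by gcongr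
      _ = C * ‖g‖ := by field_simp
  · have h1 : ∫ x in A i, (f j).1 x ∂m = ∫ x in A i, (A j).indicator (fun _ => ψ (a j) / a j) x ∂m :=
      integral_congr_ae (ae_restrict_of_ae (hf2 j))
    have h2 := (hpos j).ne'
    have h3 := (ha j).1.ne'
    rw [hT, h1, setIntegral_indicator (hA j), setIntegral_const]
    split_ifs with hij
    · subst hij
      rw [inter_self, Measure.real, hvol, ENNReal.toReal_ofReal (ha i).1.le, smul_eq_mul]
      field_simp
    · rw [(hdisj hij).inter_eq, measureReal_empty, zero_smul, mul_zero]

end Necessity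

/-! ### Sparse sequences of flat blocks -/

section Sparse

variable {ψ : ℝ → ℝ} {γ : ℝ≥0∞}

theorem volume_restrict_Ico_le (γ : ℝ≥0∞) (a b : ℝ) :
    volume.restrict (intervalIoo γ) (Ico a b) ≤ ENNReal.ofReal (b - a) :=
  (Measure.restrict_apply_le _ _).trans_eq Real.volume_Ico

theorem volume_restrict_Ico {a b : ℝ} (ha : 0 < a) (hb : b ∈ intervalIoo γ) :
    volume.restrict (intervalIoo γ) (Ico a b) = ENNReal.ofReal (b - a) := by
  rw [Measure.restrict_apply measurableSet_Ico, inter_eq_left.2, Real.volume_Ico]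
  exact fun x hx => intervalIoo_of_le hb (ha.trans_le hx.1) hx.2.le

/-- If the weight is flat on a sparse sequence of blocks then the dual contains a sequence that
converges weak-* but not weakly. -/
theorem not_isGrothendieckSpace_of_sparse (W : IsConcaveWeight ψ γ) {t : ℕ → ℝ} (ht : ∀ n, 0 < t n)
    (htγ : ∀ n : ℕ, (n + 4) * t n ∈ intervalIoo γ)
    (hflat : ∀ n : ℕ, ψ ((n + 4) * t n) ≤ 2 * ψ (t n))
    (hdisj : Pairwise (Function.onFun Disjoint fun n : ℕ => Ico (t n) ((n + 4) * t n))) {C : ℝ}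
    (hC : 2 ≤ C) (hsum : ∀ s ∈ intervalIoo γ,
      ∑' n, ENNReal.ofReal (min s (t n) * (ψ (t n) / t n)) ≤ ENNReal.ofReal (C * ψ s)) :
    ¬ IsGrothendieckSpace (marcinkiewiczSpace ψ γ) := by
  set m := volume.restrict (intervalIoo γ) with hm
  have htγ' : ∀ n, t n ∈ intervalIoo γ := fun n => intervalIoo_of_le (htγ n) (ht n) (by
    have : (0 : ℝ) ≤ n := n.cast_nonneg
    nlinarith [ht n])
  have hpos := fun n => W.pos _ (htγ' n)
  -- The `n`-th block contains the consecutive intervals `A n 0, …, A n n` of length `t n`. As `ψ`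
  -- at most doubles over the block, the normalised integrals over them have absolute sum at most `2
  -- ‖g‖`, whatever their number.
  let A : ℕ → ℕ → Set ℝ := fun n j => Ico ((j + 1) * t n) ((j + 2) * t n)
  have hAmeas : ∀ n j, MeasurableSet (A n j) := fun n j => measurableSet_Ico
  have hAvol : ∀ n j, m (A n j) ≤ ENNReal.ofReal (t n) := fun n j =>
    (volume_restrict_Ico_le γ _ _).trans (ENNReal.ofReal_le_ofReal (by ring_nf; rfl))
  have hAsub : ∀ n j, j ≤ n → A n j ⊆ Ico (t n) ((n + 4) * t n) := by
    intro n j hj x hx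
    have h1 : (j : ℝ) ≤ n := by exact_mod_cast hj
    have h2 : (0 : ℝ) ≤ j := j.cast_nonneg
    exact ⟨le_trans (by nlinarith [ht n]) hx.1, hx.2.trans_le (by nlinarith [ht n])⟩
  have hAdisj : ∀ n, Pairwise (Function.onFun Disjoint (A n)) := by
    intro n
    refine (pairwise_disjoint_on _).2 fun i j hij => ?_
    refine Set.disjoint_left.2 fun x hx hx' => ?_
    have h1 : (i : ℝ) + 1 ≤ j := by exact_mod_cast hij
    have h2 := hx.2
    have h3 := hx'.1
    nlinarith [ht n]
  choose u hu1 hu using fun n j => exists_setIntegral_functional W (htγ' n) (hAvol n j)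
  -- A single block has only finitely many intervals. The limit along the blocks makes infinitely
  -- many coordinates, and to lift them `f J` collects the `J`-th intervals of all blocks `n ≥ J`.
  choose T hT using fun j => exists_hyperfilter_limit (fun n => u n j) fun n => hu1 n j
  have hf : ∀ J, ∃ f : marcinkiewiczSpace ψ γ, ‖f‖ ≤ C ∧ f.1 =ᵐ[m] fun x =>
      (∑' n, ‖(if J ≤ n then A n J else ∅).indicator (fun _ => ψ (t n) / t n) x‖ₑ).toReal := by
    intro J
    refine exists_indicator_sum W (fun n => ?_) (fun n => (div_pos (hpos n) (ht n)).le)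
      (fun n => ?_) (by linarith) hsum
    · split_ifs
      exacts [hAmeas n J, MeasurableSet.empty]
    · split_ifs
      · exact hAvol n J
      · simp
  choose f hf1 hf2 using hf
  have hval : ∀ i J n, i ≤ n → J ≤ n → u n i (f J) = if i = J then 1 else 0 := by
    intro i J n hi hJ
    have h1 : ∫ x in A n i, (f J).1 x ∂m
        = ∫ x in A n i, (A n J).indicator (fun _ => ψ (t n) / t n) x ∂m := by
      rw [integral_congr_ae (ae_restrict_of_ae (hf2 J))]
      refine setIntegral_congr_fun (hAmeas n i) fun x hx => ?_
      rw [tsum_eq_single n, if_pos hJ, toReal_enorm, Real.norm_of_nonneg]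
      · exact indicator_nonneg (fun _ _ => (div_pos (hpos n) (ht n)).le) _
      · intro k hk
        rw [indicator_of_notMem, enorm_zero]
        split_ifs with hJk
        · intro hxk
          exact Set.disjoint_left.1 (hdisj hk) (hAsub k J hJk hxk) (hAsub n i hi hx)
        · exact notMem_empty x
    have h2 := (hpos n).ne'
    have h3 := (ht n).ne'
    rw [hu, h1, setIntegral_indicator (hAmeas n J), setIntegral_const]
    split_ifs with hij
    · subst hij
      have h4 : (0 : ℝ) ≤ i := i.cast_nonneg
      have h5 : (i : ℝ) ≤ n := by exact_mod_cast hi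
      have h6 : m (A n i) = ENNReal.ofReal (t n) := by
        refine (volume_restrict_Ico (by have := ht n; positivity) ?_).trans (by congr 1; ring)
        exact intervalIoo_of_le (htγ n) (by have := ht n; positivity) (by nlinarith [ht n])
      rw [inter_self, Measure.real, h6, ENNReal.toReal_ofReal (ht n).le, smul_eq_mul]
      field_simp
    · rw [(hAdisj n hij).inter_eq, measureReal_empty, zero_smul, mul_zero]
  have hge : ∀ N : ℕ, ∀ᶠ n in (hyperfilter ℕ : Filter ℕ), N ≤ n := fun N =>
    (Nat.hyperfilter_le_atTop) (eventually_ge_atTop N)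
  refine not_isGrothendieckSpace_of_biorthogonal T f hf1 (fun g r => ?_) fun i J => ?_
  · have hlim : Tendsto (fun n => ∑ j ∈ Finset.range r, |u n j g|) (hyperfilter ℕ : Filter ℕ)
        (𝓝 (∑ j ∈ Finset.range r, |T j g|)) :=
      tendsto_finsetSum _ fun j _ => (hT j g).abs
    refine le_of_tendsto hlim ?_
    filter_upwards [hge r] with n hn
    have hsub : (⋃ j ∈ Finset.range r, A n j) ⊆ Ico (t n) ((n + 4) * t n) :=
      iUnion₂_subset fun j hj => hAsub n j ((Finset.mem_range.1 hj).le.trans hn)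
    have hvol : m (⋃ j ∈ Finset.range r, A n j) ≤ ENNReal.ofReal ((n + 4) * t n) :=
      (measure_mono hsub).trans ((volume_restrict_Ico_le γ _ _).trans
        (ENNReal.ofReal_le_ofReal (by linarith [ht n])))
    have h1 := sum_abs_setIntegral_le W g r (hAmeas n) (hAdisj n) (htγ n) hvol
    have h2 := hpos n
    calc ∑ j ∈ Finset.range r, |u n j g|
        = (ψ (t n))⁻¹ * ∑ j ∈ Finset.range r, |∫ x in A n j, g.1 x ∂m| := by
          rw [Finset.mul_sum]
          refine Finset.sum_congr rfl fun j _ => ?_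
          rw [hu, abs_mul, abs_of_pos (inv_pos.2 h2)]
      _ ≤ (ψ (t n))⁻¹ * (2 * ψ (t n) * ‖g‖) := by
          gcongr
          exact h1.trans (mul_le_mul_of_nonneg_right (hflat n) (norm_nonneg g))
      _ = 2 * ‖g‖ := by field_simp
      _ ≤ C * ‖g‖ := by gcongr
  · refine tendsto_nhds_unique (hT i (f J)) (tendsto_const_nhds.congr' ?_)
    filter_upwards [hge i, hge J] with n h1 h2 using (hval i J n h1 h2).symm

/-- Under doubling, the sum of all earlier terms is at most the current one, so the last term with
`P` dominates. -/
theorem sum_le_of_two_mul_le {x : ℕ → ℝ} (hx : ∀ n, 0 ≤ x n) (h : ∀ n, 2 * x n ≤ x (n + 1))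
    {P : ℕ → Prop} [DecidablePred P] {B : ℝ} (hB : 0 ≤ B) (hP : ∀ n, P n → x n ≤ B) :
    ∑' n, ENNReal.ofReal (if P n then x n else 0) ≤ ENNReal.ofReal (2 * B) := by
  have h1 : ∀ N, ∑ n ∈ Finset.range N, x n ≤ x N := by
    intro N
    induction N with
    | zero => simpa using hx 0
    | succ N ih => rw [Finset.sum_range_succ]; linarith [h N]
  have h0 : ∀ n, 0 ≤ if P n then x n else 0 := fun n => by split_ifs; exacts [hx n, le_rfl]
  refine ENNReal.tsum_le_of_sum_range_le fun N => ?_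
  rw [← ENNReal.ofReal_sum_of_nonneg fun n _ => h0 n]
  refine ENNReal.ofReal_le_ofReal ?_
  induction N with
  | zero => simpa using hB
  | succ N ih =>
    rw [Finset.sum_range_succ]
    by_cases hN : P N
    · have h2 : ∑ n ∈ Finset.range N, (if P n then x n else 0) ≤ ∑ n ∈ Finset.range N, x n :=
        Finset.sum_le_sum fun n _ => by split_ifs; exacts [le_rfl, hx n]
      rw [if_pos hN]
      linarith [h1 N, hP N hN]
    · rwa [if_neg hN, add_zero]

theorem sum_le_of_le_half {x : ℕ → ℝ} (hx : ∀ n, 0 ≤ x n) (h : ∀ n, 2 * x (n + 1) ≤ x n)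
    {P : ℕ → Prop} [DecidablePred P] {B : ℝ} (hB : 0 ≤ B) (hP : ∀ n, P n → x n ≤ B) :
    ∑' n, ENNReal.ofReal (if P n then x n else 0) ≤ ENNReal.ofReal (2 * B) := by
  have h0 : ∀ n, 0 ≤ if P n then x n else 0 := fun n => by split_ifs; exacts [hx n, le_rfl]
  refine ENNReal.tsum_le_of_sum_range_le fun N => ?_
  rw [← ENNReal.ofReal_sum_of_nonneg fun n _ => h0 n]
  refine ENNReal.ofReal_le_ofReal ?_
  -- The sum is `0` before the first index with `P`; from then on the halving keeps a reserve of `2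
  -- * x N` for the terms to come.
  have h1 : ∀ N, ∑ n ∈ Finset.range N, (if P n then x n else 0) = 0 ∨
      ∑ n ∈ Finset.range N, (if P n then x n else 0) + 2 * x N ≤ 2 * B := by
    intro N
    induction N with
    | zero => exact Or.inl (by simp)
    | succ N ih =>
      rw [Finset.sum_range_succ]
      by_cases hN : P N
      · right
        rw [if_pos hN]
        rcases ih with ih | ih
        · rw [ih]; linarith [h N, hP N hN]
        · linarith [h N]
      · rw [if_neg hN, add_zero]
        exact ih.imp_right fun ih => by linarith [h N, hx N]
  rcases h1 N with h2 | h2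
  · rw [h2]; linarith
  · linarith [hx N]

/-- Terms with `t n ≤ s` equal `ψ (t n)`, the others `s * ψ (t n) / t n`. Both are parts of
geometrically controlled sequences with entries at most `ψ s`, so each sum is at most `2 * ψ s`. The
two alternatives cover decreasing and increasing `t`. -/
theorem IsConcaveWeight.tsum_min_mul_le (W : IsConcaveWeight ψ γ) {t : ℕ → ℝ}
    (ht : ∀ n, t n ∈ intervalIoo γ)
    (h : (∀ n, 2 * ψ (t (n + 1)) ≤ ψ (t n) ∧ 2 * (ψ (t n) / t n) ≤ ψ (t (n + 1)) / t (n + 1)) ∨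
      ∀ n, 2 * ψ (t n) ≤ ψ (t (n + 1)) ∧ 2 * (ψ (t (n + 1)) / t (n + 1)) ≤ ψ (t n) / t n)
    {s : ℝ} (hs : s ∈ intervalIoo γ) :
    ∑' n, ENNReal.ofReal (min s (t n) * (ψ (t n) / t n)) ≤ ENNReal.ofReal (4 * ψ s) := by
  classical
  have hψs := (W.pos s hs).le
  have hs0 := hs.1.le
  have hψ : ∀ n, 0 ≤ ψ (t n) := fun n => (W.pos _ (ht n)).le
  have hw : ∀ n, 0 ≤ s * (ψ (t n) / t n) := fun n =>
    mul_nonneg hs0 (div_nonneg (hψ n) (ht n).1.le)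
  have hP1 : ∀ n, t n ≤ s → ψ (t n) ≤ ψ s := fun n hn => W.le hs (ht n).1 hn
  have hP2 : ∀ n, s < t n → s * (ψ (t n) / t n) ≤ ψ s := fun n hn => by
    have := W.min_mul_div_le (ht n) hs
    rwa [min_eq_left hn.le] at this
  have hsplit : ∑' n, ENNReal.ofReal (min s (t n) * (ψ (t n) / t n))
      ≤ ∑' n, ENNReal.ofReal (if t n ≤ s then ψ (t n) else 0)
        + ∑' n, ENNReal.ofReal (if s < t n then s * (ψ (t n) / t n) else 0) := by
    rw [← ENNReal.tsum_add]
    refine ENNReal.tsum_le_tsum fun n => ?_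
    rcases le_or_gt (t n) s with hn | hn
    · rw [min_eq_right hn, mul_div_cancel₀ _ (ht n).1.ne', if_pos hn]
      exact le_self_add
    · rw [min_eq_left hn.le, if_pos hn]
      exact le_add_self
  refine hsplit.trans ?_
  rw [show 4 * ψ s = 2 * ψ s + 2 * ψ s by ring, ENNReal.ofReal_add (by linarith) (by linarith)]
  rcases h with h | h
  · refine add_le_add (sum_le_of_le_half hψ (fun n => (h n).1) hψs hP1)
      (sum_le_of_two_mul_le hw (fun n => ?_) hψs hP2)
    rw [mul_left_comm]
    exact mul_le_mul_of_nonneg_left (h n).2 hs0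
  · refine add_le_add (sum_le_of_two_mul_le hψ (fun n => (h n).1) hψs hP1)
      (sum_le_of_le_half hw (fun n => ?_) hψs hP2)
    rw [mul_left_comm]
    exact mul_le_mul_of_nonneg_left (h n).2 hs0

end Sparse

/-! ### Failure of a lower limit produces flat blocks -/

section Flat

variable {ψ : ℝ → ℝ} {γ : ℝ≥0∞}

theorem exists_seq_of_forall_exists {α : Type*} {P : ℕ → α → Prop} {R : ℕ → α → α → Prop}
    (h0 : ∃ x, P 0 x) (h : ∀ n x, P n x → ∃ y, P (n + 1) y ∧ R n x y) :
    ∃ u : ℕ → α, (∀ n, P n (u n)) ∧ ∀ n, R n (u n) (u (n + 1)) := by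
  obtain ⟨x₀, hx₀⟩ := h0
  choose g hg1 hg2 using h
  let v : ∀ n, {x // P n x} := fun n =>
    Nat.rec ⟨x₀, hx₀⟩ (fun n x => ⟨g n x.1 x.2, hg1 n x.1 x.2⟩) n
  exact ⟨fun n => (v n).1, fun n => (v n).2, fun n => hg2 n (v n).1 (v n).2⟩

/-- Where `ψ (2 t) / ψ t` comes close to `1`, the weight is flat on long intervals. -/
theorem IsConcaveWeight.exists_flat (W : IsConcaveWeight ψ γ) {F : Filter ℝ}
    (hF : ¬ 1 < liminf (fun t => ((ψ (2 * t) / ψ t : ℝ) : EReal)) F) {c : ℝ} (hc : 2 ≤ c)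
    {p : ℝ → Prop} (hp : ∀ᶠ t in F, p t) (hγ : ∀ᶠ t in F, 0 < t ∧ c * t ∈ intervalIoo γ) :
    ∃ t, 0 < t ∧ c * t ∈ intervalIoo γ ∧ p t ∧ ψ (c * t) ≤ 2 * ψ t := by
  -- The tolerance `1 / c` is chosen so that `c - 1` increments of size at most `ψ t / c` add at
  -- most `ψ t`.
  have hlt : liminf (fun t => ((ψ (2 * t) / ψ t : ℝ) : EReal)) F < ((1 + 1 / c : ℝ) : EReal) := by
    refine (not_lt.1 hF).trans_lt ?_
    rw [← EReal.coe_one, EReal.coe_lt_coe_iff]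
    have : 0 < 1 / c := by positivity
    linarith
  obtain ⟨t, ht1, htp, ht0, htc⟩ :=
    ((frequently_lt_of_liminf_lt (by isBoundedDefault) hlt).and_eventually (hp.and hγ)).exists
  refine ⟨t, ht0, htc, htp, ?_⟩
  have hψ : 0 < ψ t := W.pos t (intervalIoo_of_le htc ht0 (by nlinarith))
  rw [EReal.coe_lt_coe_iff, div_lt_iff₀ hψ] at ht1
  have h1 := W.sub_le_mul_sub ht0 hc htc
  have h2 : (c - 1) * (ψ (2 * t) - ψ t) ≤ (c - 1) * (1 / c * ψ t) :=
    mul_le_mul_of_nonneg_left (by linarith) (by linarith)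
  have h3 : (c - 1) * (1 / c * ψ t) ≤ ψ t := by
    rw [← mul_assoc, mul_one_div]
    exact mul_le_of_le_one_left hψ.le ((div_le_one (by linarith)).2 (by linarith))
  linarith

/-- Across a flat stretch of ratio at least `4` the quotient `ψ t / t` drops by a factor `2` even
though `ψ` may double. This explains the `4` in the block lengths `n + 4`. -/
theorem IsConcaveWeight.two_mul_div_le (W : IsConcaveWeight ψ γ) {c s t : ℝ} (hc : 4 ≤ c)
    (hs : 0 < s) (ht : t ∈ intervalIoo γ) (hst : c * s ≤ t) (hflat : ψ (c * s) ≤ 2 * ψ s) :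
    2 * (ψ t / t) ≤ ψ s / s := by
  have hψ : 0 ≤ ψ s := (W.pos s (intervalIoo_of_le ht hs (by nlinarith))).le
  have h1 : ψ t / t ≤ ψ (c * s) / (c * s) := W.div_le_div ht (by positivity) hst
  have h2 : ψ (c * s) / (c * s) ≤ 2 * ψ s / (c * s) := by gcongr
  have h3 : 2 * ψ s / (c * s) ≤ 2 * ψ s / (4 * s) := by gcongr
  have h4 : 2 * (2 * ψ s / (4 * s)) = ψ s / s := by field_simp; ring
  linarith

/-- If `ψ` stays away from `0` near `0`, it is constant up to a factor on `(0, b]`, and dyadic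
intervals shrinking to `0` serve as the disjoint sets. Otherwise flat blocks can be chosen towards
`0` with `ψ (t n)` at least halving, as the sparse construction requires. -/
theorem not_isGrothendieckSpace_of_flat_zero (W : IsConcaveWeight ψ γ) (hγ : 0 < γ)
    (hF : ¬ 1 < liminf (fun t => ((ψ (2 * t) / ψ t : ℝ) : EReal)) (𝓝[>] 0)) :
    ¬ IsGrothendieckSpace (marcinkiewiczSpace ψ γ) := by
  obtain ⟨b, hb⟩ := intervalIoo_nonempty hγ
  have hb0 := hb.1
  by_cases hδ : ∃ δ > 0, ∀ t ∈ intervalIoo γ, δ ≤ ψ t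
  · obtain ⟨δ, hδ, hle⟩ := hδ
    have hpow : ∀ j : ℕ, b / 2 ^ j ∈ intervalIoo γ := fun j =>
      intervalIoo_of_le hb (by positivity) (div_le_self hb0.le (one_le_pow₀ (by norm_num)))
    have hsub : ∀ j : ℕ, Ico (b / 2 ^ (j + 1)) (b / 2 ^ j) ⊆ Ico 0 b := fun j x hx =>
      ⟨le_trans (by positivity) hx.1,
        hx.2.trans_le (div_le_self hb0.le (one_le_pow₀ (by norm_num)))⟩
    refine not_isGrothendieckSpace_of_disjoint W (A := fun j => Ico (b / 2 ^ (j + 1)) (b / 2 ^ j))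
      (a := fun j => b / 2 ^ (j + 1)) (C := ψ b / δ) (s := fun _ => b) (fun j => measurableSet_Ico)
      ((pairwise_disjoint_on _).2 fun i j hij => Set.disjoint_left.2 fun x hx hx' => ?_)
      (fun j => hpow (j + 1)) (fun j => ?_) ((one_le_div hδ).2 (hle b hb)) (fun _ => hb)
      (fun n => ?_) fun n j => ?_
    · have h1 : b / 2 ^ j ≤ b / 2 ^ (i + 1) :=
        div_le_div_of_nonneg_left hb0.le (by positivity) (pow_le_pow_right₀ (by norm_num) hij)
      linarith [hx.1, hx'.2]
    · rw [volume_restrict_Ico (by positivity) (hpow j)]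
      congr 1
      rw [pow_succ]; field_simp; ring
    · refine (measure_mono (iUnion₂_subset fun j _ => hsub j)).trans
        ((volume_restrict_Ico_le γ _ _).trans_eq (by rw [sub_zero]))
    · rw [div_mul_eq_mul_div, le_div_iff₀ hδ]
      exact mul_le_mul_of_nonneg_left (hle _ (hpow (j + 1))) (W.pos b hb).le
  · push Not at hδ
    have hstep : ∀ c : ℝ, 2 ≤ c → ∀ a > 0, ∃ t, 0 < t ∧ c * t ∈ intervalIoo γ ∧ t < a ∧
        ψ (c * t) ≤ 2 * ψ t := by
      intro c hc a ha
      have hc0 : 0 < c := by linarith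
      have hev : ∀ r : ℝ, 0 < r → ∀ᶠ t in 𝓝[>] (0 : ℝ), 0 < t ∧ t < r := fun r hr =>
        Ioo_mem_nhdsGT hr
      refine W.exists_flat hF hc ((hev a ha).mono fun t ht => ht.2)
        ((hev (b / c) (by positivity)).mono fun t ht => ⟨ht.1, ?_⟩)
      refine intervalIoo_of_le hb (mul_pos hc0 ht.1) ?_
      rw [mul_comm, ← le_div_iff₀ hc0]
      exact ht.2.le
    have hcast : ∀ n : ℕ, (0 : ℝ) ≤ n := fun n => n.cast_nonneg
    -- The factor `n + 5 = (n + 1) + 4` makes block `n + 1` end before block `n` starts.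
    obtain ⟨t, ht, htR⟩ := exists_seq_of_forall_exists
      (P := fun n t => 0 < t ∧ ((n : ℝ) + 4) * t ∈ intervalIoo γ ∧ ψ ((n + 4) * t) ≤ 2 * ψ t)
      (R := fun n s t => ((n : ℝ) + 5) * t ≤ s ∧ 2 * ψ t ≤ ψ s)
      (by
        obtain ⟨t, h1, h2, -, h3⟩ := hstep ((0 : ℕ) + 4) (by norm_num) 1 one_pos
        exact ⟨t, h1, h2, h3⟩)
      (fun n s hs => by
        have hsγ : s ∈ intervalIoo γ := intervalIoo_of_le hs.2.1 hs.1 (by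
          nlinarith [hs.1, hcast n])
        obtain ⟨r, hr, hrs⟩ := hδ (ψ s / 2) (half_pos (W.pos s hsγ))
        have hn5 : (0 : ℝ) < n + 5 := by linarith [hcast n]
        obtain ⟨t, h1, h2, h3, h4⟩ := hstep ((n + 1 : ℕ) + 4) (by linarith [hcast (n + 1)])
          (min r (s / (n + 5))) (lt_min hr.1 (div_pos hs.1 hn5))
        have h5 : ψ t ≤ ψ r := W.le hr h1 (h3.le.trans (min_le_left _ _))
        refine ⟨t, ⟨h1, h2, h4⟩, ?_, by linarith⟩
        rw [mul_comm, ← le_div_iff₀ hn5]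
        exact h3.le.trans (min_le_right _ _))
    have htγ : ∀ n, t n ∈ intervalIoo γ := fun n =>
      intervalIoo_of_le (ht n).2.1 (ht n).1 (by nlinarith [(ht n).1, hcast n])
    have hanti : Antitone t := antitone_nat_of_succ_le fun n => by
      nlinarith [(htR n).1, (ht (n + 1)).1, hcast n]
    refine not_isGrothendieckSpace_of_sparse W (C := 4) (fun n => (ht n).1) (fun n => (ht n).2.1)
      (fun n => (ht n).2.2)
      ((pairwise_disjoint_on _).2 fun i j hij => Set.disjoint_left.2 fun x hx hx' => ?_)
      (by norm_num) fun s hs => W.tsum_min_mul_le htγ (Or.inl fun n => ⟨(htR n).2, ?_⟩) hs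
    · obtain ⟨k, rfl⟩ := Nat.exists_eq_add_of_lt hij
      have h1 := (htR (i + k)).1
      have h2 := hanti (Nat.le_add_right i k)
      have h3 := hx'.2
      push_cast at h1 h3
      linarith [hx.1]
    · have h1 := (htR n).1
      have h2 := (ht (n + 1)).2.2
      push_cast at h2
      rw [show (n : ℝ) + 1 + 4 = n + 5 by ring] at h2
      exact W.two_mul_div_le (c := n + 5) (by linarith [hcast n]) (ht (n + 1)).1 (htγ n) h1 h2

/-- The mirror image at `∞`: for bounded `ψ` unit intervals serve as the disjoint sets; for
unbounded `ψ` flat blocks move to the right with `ψ (t n)` at least doubling. -/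
theorem not_isGrothendieckSpace_of_flat_top (W : IsConcaveWeight ψ ∞)
    (hF : ¬ 1 < liminf (fun t => ((ψ (2 * t) / ψ t : ℝ) : EReal)) atTop) :
    ¬ IsGrothendieckSpace (marcinkiewiczSpace ψ ∞) := by
  have hmem : ∀ t : ℝ, 0 < t → t ∈ intervalIoo ∞ := fun t ht => ⟨ht, ENNReal.ofReal_lt_top⟩
  have hcast : ∀ n : ℕ, (0 : ℝ) ≤ n := fun n => n.cast_nonneg
  by_cases hB : ∃ B, ∀ t > 0, ψ t ≤ B
  · obtain ⟨B, hB⟩ := hB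
    have h1 : 0 < ψ 1 := W.pos 1 (hmem 1 one_pos)
    refine not_isGrothendieckSpace_of_disjoint W (A := fun j : ℕ => Ico ((j : ℝ) + 1) (j + 2))
      (a := fun _ => 1) (C := B / ψ 1) (s := fun n => n + 1) (fun j => measurableSet_Ico)
      ((pairwise_disjoint_on _).2 fun i j hij => Set.disjoint_left.2 fun x hx hx' => ?_)
      (fun j => hmem 1 one_pos) (fun j => ?_) ((one_le_div h1).2 (hB 1 one_pos))
      (fun n => hmem _ (by positivity)) (fun n => ?_) fun n j => ?_
    · have h2 : (i : ℝ) + 1 ≤ j := by exact_mod_cast hij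
      linarith [hx.2, hx'.1]
    · rw [volume_restrict_Ico (by positivity) (hmem _ (by positivity))]
      congr 1; ring
    · refine (measure_mono (t := Ico 0 ((n : ℝ) + 1)) (iUnion₂_subset fun j hj x hx => ?_)).trans
        ((volume_restrict_Ico_le ∞ _ _).trans_eq (by rw [sub_zero]))
      have h2 : (j : ℝ) + 1 ≤ n := by exact_mod_cast Finset.mem_range.1 hj
      exact ⟨by linarith [hx.1, hcast j], by linarith [hx.2]⟩
    · rw [div_mul_cancel₀ _ h1.ne']
      exact hB _ (by positivity)
  · push Not at hB
    have hstep : ∀ c : ℝ, 2 ≤ c → ∀ a : ℝ, ∃ t, 0 < t ∧ c * t ∈ intervalIoo ∞ ∧ a < t ∧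
        ψ (c * t) ≤ 2 * ψ t := by
      intro c hc a
      refine W.exists_flat hF hc (eventually_gt_atTop a) ((eventually_gt_atTop 0).mono fun t ht =>
        ⟨ht, hmem _ (mul_pos (by linarith) ht)⟩)
    obtain ⟨t, ht, htR⟩ := exists_seq_of_forall_exists
      (P := fun n t => 0 < t ∧ ψ (((n : ℕ) + 4) * t) ≤ 2 * ψ t)
      (R := fun n s t => ((n : ℝ) + 4) * s ≤ t ∧ 2 * ψ s ≤ ψ t)
      (by
        obtain ⟨t, h1, -, -, h3⟩ := hstep ((0 : ℕ) + 4) (by norm_num) 1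
        exact ⟨t, h1, h3⟩)
      (fun n s hs => by
        obtain ⟨r, hr, hrs⟩ := hB (2 * ψ s)
        obtain ⟨t, h1, -, h3, h4⟩ := hstep ((n + 1 : ℕ) + 4) (by linarith [hcast (n + 1)])
          (max r ((n + 4) * s))
        have h5 : ψ r ≤ ψ t := W.le (hmem t h1) hr ((le_max_left _ _).trans h3.le)
        exact ⟨t, ⟨h1, h4⟩, (le_max_right _ _).trans h3.le, by linarith⟩)
    have htγ : ∀ n, t n ∈ intervalIoo ∞ := fun n => hmem _ (ht n).1
    have hmono : Monotone t := monotone_nat_of_le_succ fun n => by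
      nlinarith [(htR n).1, (ht n).1, hcast n]
    refine not_isGrothendieckSpace_of_sparse W (C := 4) (fun n => (ht n).1)
      (fun n => hmem _ (mul_pos (by linarith [hcast n]) (ht n).1)) (fun n => (ht n).2)
      ((pairwise_disjoint_on _).2 fun i j hij => Set.disjoint_left.2 fun x hx hx' => ?_)
      (by norm_num) fun s hs => W.tsum_min_mul_le htγ (Or.inr fun n => ⟨(htR n).2, ?_⟩) hs
    · have h1 := (htR i).1
      have h2 := hmono (Nat.succ_le_of_lt hij)
      have h3 := hx.2
      have h4 := hx'.1
      rw [Nat.succ_eq_add_one] at h2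
      linarith
    · exact W.two_mul_div_le (c := n + 4) (by linarith [hcast n]) (ht n).1 (htγ (n + 1)) (htR n).1
        (ht n).2

end Flat

theorem theorem4 (γ : ℝ≥0∞) (hγ : 0 < γ) (ψ : ℝ → ℝ)
    (hψ_nonneg : ∀ t ∈ intervalIco γ, 0 ≤ ψ t)
    (hψ_ne : ∃ t ∈ intervalIco γ, ψ t ≠ 0)
    (hψ_mono : MonotoneOn ψ (intervalIco γ))
    (hψ_concave : ConcaveOn ℝ (intervalIco γ) ψ)
    (hψ_cont : ContinuousOn ψ (intervalIoo γ))
    (hψ_zero : ψ 0 = 0) :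
    IsGrothendieckSpace (marcinkiewiczSpace ψ γ) ↔ ConditionA ψ γ ∨ ConditionB ψ γ := by
  have W := IsConcaveWeight.of_ne_zero hψ_nonneg hψ_ne hψ_mono hψ_concave hψ_zero
  refine ⟨fun hG => ?_, isGrothendieckSpace_of_condition W hγ⟩
  have hzero : 1 < liminf (fun t => ((ψ (2 * t) / ψ t : ℝ) : EReal)) (𝓝[>] 0) := by
    by_contra h
    exact not_isGrothendieckSpace_of_flat_zero W hγ h hG
  rcases eq_or_ne γ ∞ with rfl | hγ'
  · refine Or.inl ⟨rfl, hzero, ?_⟩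
    by_contra h
    exact not_isGrothendieckSpace_of_flat_top W h hG
  · exact Or.inr ⟨hγ'.lt_top, hzero⟩
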